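/- **Setting.** $N$ agents are the vertices of an undirected graph; $\mathcal N_k$ denotes the set consisting of $k$ and its neighbours. The agents are partitioned into groups $\mathcal G_1,\dots,\mathcal G_G$, each nonempty and inducing a connected subgraph, of sizes $N_m=|\mathcal G_m|$; agents are indexed so that groups are consecutive. Agent $k$ has a strictly convex, twice differentiable cost $J_k:\mathbb R^M\to\mathbb R$ with minimizer $w_k^o$, and agents in the same group have the same minimizer. Write $\mathrm{col}$ for stacking, $\mathcal W^o=\mathrm{col}\{w_1^o,\dots,w_N^o\}$, and $\|\cdot\|$ for the Euclidean norm of vectors and the induced 2-norm of matrices. Assume: * *Costs.* $\lambda_{k,L}I\le\nabla^2J_k(w)\le\lambda_{k,U}I$ for all $w$, with $0\le\lambda_{k,L}\le\lambda_{k,U}<\infty$; every group contains an agent with $\lambda_{k,L}>0$; and $\mathcal W=\mathrm{col}\{w_k\}\mapsto\mathrm{diag}\{\nabla^2J_1(w_1),\dots,\nabla^2J_N(w_N)\}$ is Lipschitz. * *Combination weights.* $A=[a_{\ell k}]$ with $a_{\ell k}>0$ if $\ell\in\mathcal N_k$ lies in the group of $k$, $a_{\ell k}=0$ otherwise, and $\sum_\ell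 a_{\ell k}=1$ for every $k$. * *Gradient noise.* At iteration $i\ge0$ agent $k$ has a random approximation $\widehat{\nabla J}_{k,i}(w)$ of $\nabla J_k(w)$; let $\mathcal S_i(\mathcal W)=\mathrm{col}\{\widehat{\nabla J}_{k,i}(w_k)-\nabla J_k(w_k)\}_{k=1}^N$. There is a filtration $\{\mathbb F_i\}_{i\ge-1}$ and constants $\alpha,\sigma_s,\kappa_s\ge0$, $0<\gamma_s\le4$ such that, for all $i$ and every $\mathbb F_{i-1}$-measurable random $\mathcal W$ with finite fourth moment, $\mathcal S_i(\mathcal W)$ is $\mathbb F_i$-measurable with finite fourth moment and, almost surely, $\mathbb E[\mathcal S_i(\mathcal W)\mid\mathbb F_{i-1}]=0$, $\mathbb E[\|\mathcal S_i(\mathcal W)\|^4\mid\mathbb F_{i-1}]\le\alpha^2\|\mathcal W^o-\mathcal W\|^4+\sigma_s^4$ and $\|\mathcal R_{s,i}(\mathcal W^o)-\mathcal R_{s,i}(\mathcal W)\|\le\kappa_s\|\mathcal W^o-\mathcal W\|^{\gamma_s}$, where $\mathcal R_{s,i}(\mathcal W)=\mathbb E[\mathcal S_i(\mathcal W)\mathcal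 S_i(\mathcal W)^{\mathsf T}\mid\mathbb F_{i-1}]$. Moreover $\mathcal R_{s,i}(\mathcal W^o)\to\mathcal R_s$ almost surely as $i\to\infty$, with $\mathcal R_s$ a deterministic symmetric positive definite matrix. * *Step-sizes.* $\mu_k=\mu_{\max}\tau_k$ with fixed $\tau_k\in(0,1]$ and $\max_k\tau_k=1$. The iterates are $\boldsymbol w_{k,-1}=0$ and, for $i\ge0$, $\boldsymbol\psi_{k,i}=\boldsymbol w_{k,i-1}-\mu_k\widehat{\nabla J}_{k,i}(\boldsymbol w_{k,i-1})$, $\boldsymbol w_{k,i}=\sum_{\ell}a_{\ell k}\boldsymbol\psi_{\ell,i}$. Put $\widetilde{\mathcal W}_i=\mathcal W^o-\mathrm{col}\{\boldsymbol w_{1,i},\dots,\boldsymbol w_{N,i}\}$ and $\Pi_i=\mu_{\max}^{-1}\,\mathbb E[\widetilde{\mathcal W}_i\widetilde{\mathcal W}_i^{\mathsf T}]$. **Theorem (Block structure).** The second moments $\mathbb E\|\widetilde{\mathcal W}_i\|^2$ are finite. There is a unique vector $p=(p_1,\dots,p_N)$ with positive entries, $Ap=p$ and $\sum_{k\in\mathcal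 G_m}p_k=1$ for every $m$. Let $\bar{\mathcal H}=\mathrm{diag}\{\bar H_1,\dots,\bar H_G\}$ with $\bar H_m=\sum_{k\in\mathcal G_m}p_k\tau_k\nabla^2J_k(w_k^o)$, let $p_m^g=\mathrm{col}\{p_k;k\in\mathcal G_m\}$, $\mathcal P=\mathrm{diag}\{p_1^g,\dots,p_G^g\}\otimes I_M$, $\mathcal T=\mathrm{diag}\{\tau_1,\dots,\tau_N\}\otimes I_M$ and $\bar{\mathcal R}=\mathcal P^{\mathsf T}\mathcal T\mathcal R_s\mathcal T\mathcal P$. The continuous Lyapunov equation $$\bar{\mathcal H}\Phi+\Phi\bar{\mathcal H}=\bar{\mathcal R}$$ has a unique solution $\Phi\in\mathbb R^{GM\times GM}$. Let $\Phi_{m,r}$ be its $M\times M$ blocks and let $\Pi\in\mathbb R^{NM\times NM}$ be the matrix whose block with rows in $\mathcal G_m$ and columns in $\mathcal G_r$ is $(\mathbf 1_{N_m}\mathbf 1_{N_r}^{\mathsf T})\otimes\Phi_{m,r}$. Then $$\lim_{\mu_{\max}\to0}\ \limsup_{i\to\infty}\ \|\Pi_i-\Pi\|=0 .$$ -/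

import Mathlib

open MeasureTheory Filter Topology
open scoped ENNReal Kronecker Matrix.Norms.L2Operator

namespace DiffusionNet

/-- The parameter space of one agent, with the Euclidean norm. -/
abbrev Vec (M : ℕ) : Type := EuclideanSpace ℝ (Fin M)

/-- `col {w_1, …, w_N}`: the agents' vectors stacked into one Euclidean vector of length `N M`. -/
noncomputable def col {N M : ℕ} (w : Fin N → Vec M) : EuclideanSpace ℝ (Fin N × Fin M) :=
  WithLp.toLp 2 fun p => w p.1 p.2

/-- The Hessian matrix of `f` at `w`. -/
noncomputable def hessian {M : ℕ} (f : Vec M → ℝ) (w : Vec M) : Matrix (Fin M) (Fin M) ℝ :=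
  Matrix.of fun a b =>
    fderiv ℝ (fderiv ℝ f) w (EuclideanSpace.single a 1) (EuclideanSpace.single b 1)

/-- The network Hessian `diag {∇² J_1(w_1), …, ∇² J_N(w_N)}`. -/
noncomputable def netHessian {N M : ℕ} (J : Fin N → Vec M → ℝ) (w : Fin N → Vec M) :
    Matrix (Fin N × Fin M) (Fin N × Fin M) ℝ :=
  Matrix.of fun p q => if p.1 = q.1 then hessian (J p.1) (w p.1) p.2 q.2 else 0

/-- The groups partition the agents (`grp k` is the group of agent `k`); each group is a nonempty
connected part of the topology, and its members share one minimizer, that is, they belong to one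
cluster (the clusters being the classes of agents with equal minimizers). -/
structure IsGrouping {N G M : ℕ} (T : SimpleGraph (Fin N)) (grp : Fin N → Fin G)
    (wo : Fin N → Vec M) : Prop where
  connected : ∀ m, (T.induce {k | grp k = m}).Connected
  common_minimizer : ∀ k l, grp k = grp l → wo k = wo l

/-- The combination coefficients `A l k = a_{lk}`: positive exactly on the neighbours `l` of `k`
(`k` itself included) in the group of `k`, zero elsewhere, with columns adding up to one. -/
structure IsCombination {N G : ℕ} (T : SimpleGraph (Fin N)) (grp : Fin N → Fin G)
    (A : Matrix (Fin N) (Fin N) ℝ) : Prop where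
  pos : ∀ l k, (l = k ∨ T.Adj l k) ∧ grp l = grp k → 0 < A l k
  zero : ∀ l k, ¬ ((l = k ∨ T.Adj l k) ∧ grp l = grp k) → A l k = 0
  sum_one : ∀ k, ∑ l, A l k = 1

/-- The conditions on the individual costs `J k` and their minimizers `wo k`. -/
structure CostCondition {N G M : ℕ} (grp : Fin N → Fin G) (J : Fin N → Vec M → ℝ)
    (wo : Fin N → Vec M) (lamL lamU : Fin N → ℝ) (κH : ℝ) : Prop where
  strictConvex : ∀ k, StrictConvexOn ℝ Set.univ (J k)
  minimizer : ∀ k, IsMinOn (J k) Set.univ (wo k)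
  differentiable : ∀ k, Differentiable ℝ (J k)
  differentiable_fderiv : ∀ k, Differentiable ℝ (fderiv ℝ (J k))
  lamL_nonneg : ∀ k, 0 ≤ lamL k
  lamL_le_lamU : ∀ k, lamL k ≤ lamU k
  hessian_lower : ∀ k w, (hessian (J k) w - lamL k • (1 : Matrix (Fin M) (Fin M) ℝ)).PosSemidef
  hessian_upper : ∀ k w, (lamU k • (1 : Matrix (Fin M) (Fin M) ℝ) - hessian (J k) w).PosSemidef
  strong : ∀ m, ∃ k, grp k = m ∧ 0 < lamL k
  κH_nonneg : 0 ≤ κH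
  hessian_lipschitz : ∀ w₁ w₂ : Fin N → Vec M,
    ‖netHessian J w₁ - netHessian J w₂‖ ≤ κH * ‖col w₁ - col w₂‖

/-- The network gradient noise at a (deterministic) network parameter `w`:
approximate minus true gradient, stacked over the agents. -/
noncomputable def netNoise {N M : ℕ} {Ω : Type*} (J : Fin N → Vec M → ℝ)
    (ghat : ℕ → Fin N → Vec M → Ω → Vec M) (n : ℕ) (w : Fin N → Vec M) (ω : Ω) :
    EuclideanSpace ℝ (Fin N × Fin M) :=
  col fun k => ghat n k (w k) ω - gradient (J k) (w k)

/-- The conditional second moment matrix `E[S Sᵀ | m]`, entry by entry. -/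
noncomputable def condCov {ι Ω : Type*} {mΩ : MeasurableSpace Ω} (P : Measure Ω)
    (m : MeasurableSpace Ω) (S : Ω → EuclideanSpace ℝ ι) (ω : Ω) : Matrix ι ι ℝ :=
  Matrix.of fun p q => (P[fun ω' => S ω' p * S ω' q | m]) ω

/-- The conditions on the gradient noise. `ℱ n` is the information available before the `n`-th
update (`n = 0, 1, …`), and `ghat n` is the random gradient approximation used in that update. As
usual the conditions are imposed on all `ℱ n`-measurable arguments `W`; those with a finite fourth
moment are enough, and for them the conditional expectations are ordinary ones. -/
structure NoiseCondition {N M : ℕ} {Ω : Type*} {mΩ : MeasurableSpace Ω} (P : Measure Ω)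
    (ℱ : Filtration ℕ mΩ) (J : Fin N → Vec M → ℝ) (wo : Fin N → Vec M)
    (ghat : ℕ → Fin N → Vec M → Ω → Vec M) (α σs κs γs : ℝ)
    (Rs : Matrix (Fin N × Fin M) (Fin N × Fin M) ℝ) : Prop where
  α_nonneg : 0 ≤ α
  σs_nonneg : 0 ≤ σs
  κs_nonneg : 0 ≤ κs
  γs_pos : 0 < γs
  γs_le : γs ≤ 4
  adapted : ∀ (n : ℕ) (W : Ω → Fin N → Vec M), StronglyMeasurable[ℱ n] W →
    MemLp (fun ω => col (W ω)) 4 P →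
    StronglyMeasurable[ℱ (n + 1)] fun ω => netNoise J ghat n (W ω) ω
  memLp : ∀ (n : ℕ) (W : Ω → Fin N → Vec M), StronglyMeasurable[ℱ n] W →
    MemLp (fun ω => col (W ω)) 4 P →
    MemLp (fun ω => netNoise J ghat n (W ω) ω) 4 P
  martingale_difference : ∀ (n : ℕ) (W : Ω → Fin N → Vec M), StronglyMeasurable[ℱ n] W →
    MemLp (fun ω => col (W ω)) 4 P →
    ∀ᵐ ω ∂P, (P[fun ω' => netNoise J ghat n (W ω') ω' | ℱ n]) ω = 0
  fourth_moment : ∀ (n : ℕ) (W : Ω → Fin N → Vec M), StronglyMeasurable[ℱ n] W →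
    MemLp (fun ω => col (W ω)) 4 P →
    ∀ᵐ ω ∂P, (P[fun ω' => ‖netNoise J ghat n (W ω') ω'‖ ^ 4 | ℱ n]) ω
      ≤ α ^ 2 * ‖col wo - col (W ω)‖ ^ 4 + σs ^ 4
  lipschitz_cov : ∀ (n : ℕ) (W : Ω → Fin N → Vec M), StronglyMeasurable[ℱ n] W →
    MemLp (fun ω => col (W ω)) 4 P →
    ∀ᵐ ω ∂P, ‖condCov P (ℱ n) (fun ω' => netNoise J ghat n wo ω') ω
        - condCov P (ℱ n) (fun ω' => netNoise J ghat n (W ω') ω') ω‖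
      ≤ κs * ‖col wo - col (W ω)‖ ^ γs
  convergent_cov : ∀ᵐ ω ∂P,
    Tendsto (fun n => condCov P (ℱ n) (fun ω' => netNoise J ghat n wo ω') ω) atTop (𝓝 Rs)
  Rs_posDef : Rs.PosDef

/-- The step-size profile: agent `k` uses the step-size `μ_k = μ_max τ_k`, with `max_k τ_k = 1`. -/
structure IsStepProfile {N : ℕ} (τ : Fin N → ℝ) : Prop where
  pos : ∀ k, 0 < τ k
  le_one : ∀ k, τ k ≤ 1
  attained : ∃ k, τ k = 1

/-- The adapt-then-combine diffusion iterates with step-sizes `μ_k = μ τ_k`, started at zero;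
`estimate … n` is the vector of estimates after `n` updates. -/
noncomputable def estimate {N M : ℕ} {Ω : Type*} (A : Matrix (Fin N) (Fin N) ℝ) (τ : Fin N → ℝ)
    (ghat : ℕ → Fin N → Vec M → Ω → Vec M) (μ : ℝ) : ℕ → Ω → Fin N → Vec M
  | 0 => fun _ _ => 0
  | n + 1 => fun ω k =>
      ∑ l, A l k • (estimate A τ ghat μ n ω l
        - (μ * τ l) • ghat n l (estimate A τ ghat μ n ω l) ω)

/-- The network error vector `W̃ = W° - W` after `n` updates. -/
noncomputable def netError {N M : ℕ} {Ω : Type*} (A : Matrix (Fin N) (Fin N) ℝ) (τ : Fin N → ℝ)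
    (ghat : ℕ → Fin N → Vec M → Ω → Vec M) (wo : Fin N → Vec M) (μ : ℝ) (n : ℕ) (ω : Ω) :
    EuclideanSpace ℝ (Fin N × Fin M) :=
  col wo - col (estimate A τ ghat μ n ω)

/-- The normalized covariance `c⁻¹ E[X Xᵀ]`. -/
noncomputable def normalizedCov {ι Ω : Type*} {mΩ : MeasurableSpace Ω} (P : Measure Ω) (c : ℝ)
    (X : Ω → EuclideanSpace ℝ ι) : Matrix ι ι ℝ :=
  Matrix.of fun p q => c⁻¹ * ∫ ω, X ω p * X ω q ∂P

/-- The stacked Perron vector: each group part is a positive eigenvector of the group's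
combination matrix for the eigenvalue one, with entries adding up to one. -/
structure IsPerron {N G : ℕ} (grp : Fin N → Fin G) (A : Matrix (Fin N) (Fin N) ℝ)
    (p : Fin N → ℝ) : Prop where
  pos : ∀ k, 0 < p k
  eigen : A.mulVec p = p
  sum_one : ∀ m, ∑ k with grp k = m, p k = 1

/-- `H̄ = diag {H̄_1, …, H̄_G}` with `H̄_m = ∑_{k ∈ G_m} p_k (μ_k / μ_max) ∇² J_k(w_k°)`. -/
noncomputable def Hbar {N G M : ℕ} (grp : Fin N → Fin G) (J : Fin N → Vec M → ℝ)
    (wo : Fin N → Vec M) (τ p : Fin N → ℝ) : Matrix (Fin G × Fin M) (Fin G × Fin M) ℝ :=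
  Matrix.of fun x y =>
    if x.1 = y.1 then (∑ k with grp k = x.1, (p k * τ k) • hessian (J k) (wo k)) x.2 y.2 else 0

/-- `diag {p_1^g, …, p_G^g} ⊗ I_M`. -/
noncomputable def bigP {N G : ℕ} (M : ℕ) (grp : Fin N → Fin G) (p : Fin N → ℝ) :
    Matrix (Fin N × Fin M) (Fin G × Fin M) ℝ :=
  (Matrix.of fun k m => if grp k = m then p k else 0) ⊗ₖ (1 : Matrix (Fin M) (Fin M) ℝ)

/-- `μ_max⁻¹ diag {μ_1, …, μ_N} ⊗ I_M`. -/
noncomputable def bigT {N : ℕ} (M : ℕ) (τ : Fin N → ℝ) :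
    Matrix (Fin N × Fin M) (Fin N × Fin M) ℝ :=
  Matrix.diagonal τ ⊗ₖ (1 : Matrix (Fin M) (Fin M) ℝ)

/-- `R̄ = μ_max⁻² 𝒫ᵀ ℳ R_s ℳ 𝒫`. -/
noncomputable def Rbar {N G M : ℕ} (grp : Fin N → Fin G) (τ p : Fin N → ℝ)
    (Rs : Matrix (Fin N × Fin M) (Fin N × Fin M) ℝ) :
    Matrix (Fin G × Fin M) (Fin G × Fin M) ℝ :=
  (bigP M grp p).transpose * bigT M τ * Rs * bigT M τ * bigP M grp p

/-- `Φ` solves the continuous Lyapunov equation `H̄ Φ + Φ H̄ = R̄`. -/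
def IsLyapunovSolution {N G M : ℕ} (grp : Fin N → Fin G) (J : Fin N → Vec M → ℝ)
    (wo : Fin N → Vec M) (τ p : Fin N → ℝ) (Rs : Matrix (Fin N × Fin M) (Fin N × Fin M) ℝ)
    (Φ : Matrix (Fin G × Fin M) (Fin G × Fin M) ℝ) : Prop :=
  Hbar grp J wo τ p * Φ + Φ * Hbar grp J wo τ p = Rbar grp τ p Rs

/-- The `M × M` block `Φ_{m,r}`. -/
def block {G M : ℕ} (Φ : Matrix (Fin G × Fin M) (Fin G × Fin M) ℝ) (m r : Fin G) :
    Matrix (Fin M) (Fin M) ℝ :=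
  Matrix.of fun a b => Φ (m, a) (r, b)

/-- The part of a network matrix whose rows belong to group `m` and columns to group `r`. -/
def groupBlock {N G M : ℕ} (grp : Fin N → Fin G)
    (X : Matrix (Fin N × Fin M) (Fin N × Fin M) ℝ) (m r : Fin G) :
    Matrix ({k // grp k = m} × Fin M) ({k // grp k = r} × Fin M) ℝ :=
  Matrix.of fun x y => X (x.1.1, x.2) (y.1.1, y.2)

/-- `Π` has the block structure given by `Φ`: its `(m,r)` group block is `(1 1ᵀ) ⊗ Φ_{m,r}`. -/
def HasBlockStructure {N G M : ℕ} (grp : Fin N → Fin G)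
    (Φ : Matrix (Fin G × Fin M) (Fin G × Fin M) ℝ)
    (Pi : Matrix (Fin N × Fin M) (Fin N × Fin M) ℝ) : Prop :=
  ∀ m r, groupBlock grp Pi m r =
    (Matrix.of fun _ _ => (1 : ℝ) : Matrix {k // grp k = m} {k // grp k = r} ℝ) ⊗ₖ block Φ m r

end DiffusionNet

open DiffusionNet

/-! Split the error into its Perron-weighted group averages `z` and the deviations from them. The
combination step fixes the averages and contracts the deviations, so with step-size `μ` the latter
have mean square `O(μ²)`, against `O(μ)` for the averages. Up to a remainder quadratic in the error
and linear in the deviations, the averages follow the linear recursion `z ↦ (1 - μ H̄) z + μ ξ`,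
whose noise `ξ` has a covariance tending to `R̄`. Therefore `μ⁻¹ E[z zᵀ]` is carried by
`X ↦ X - μ (H̄ X + X H̄ - R̄) + o(μ)`, which contracts at rate `μ` to the Lyapunov solution `Φ`.
Limits in `n` followed by `μ → 0` are taken along the filter `(𝓝[>] 0).curry atTop`.
-/

namespace DiffusionNet

open scoped Matrix

/-! ### Iterated limits and linear recursions -/

section IteratedLimits

theorem tendsto_limsup_enorm_sub_of_curry {X Y E : Type*} [SeminormedAddCommGroup E]
    {l : Filter X} {l' : Filter Y} {f : X → Y → E} {a : E}
    (h : Tendsto (fun x : X × Y => f x.1 x.2) (l.curry l') (𝓝 a)) :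
    Tendsto (fun x => limsup (fun y => ‖f x y - a‖ₑ) l') l (𝓝 0) := by
  have hsub : Tendsto (fun x : X × Y => ‖f x.1 x.2 - a‖ₑ) (l.curry l') (𝓝 0) := by
    simpa only [sub_self, ← ofReal_norm, norm_zero, ENNReal.ofReal_zero] using (h.sub_const a).enorm
  refine ENNReal.tendsto_nhds_zero.mpr fun ε hε => ?_
  filter_upwards [ENNReal.tendsto_nhds_zero.mp hsub ε hε] with x hx using limsup_le_of_le (h := hx)

theorem tendsto_fst_curry {X Y : Type*} (l : Filter X) (l' : Filter Y) :
    Tendsto Prod.fst (l.curry l') l :=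
  tendsto_fst.mono_left curry_le_prod

theorem eventually_le_two_mul_div_of_le_one_sub_mul_add {a : ℕ → ℝ} {q B : ℝ} (hq : 0 < q)
    (hq1 : q ≤ 1) (hB : 0 < B) (h : ∀ᶠ n in atTop, a (n + 1) ≤ (1 - q) * a n + B) :
    ∀ᶠ n in atTop, a n ≤ 2 * (B / q) := by
  obtain ⟨n₀, hn₀⟩ := eventually_atTop.mp h
  have hgeom (k : ℕ) : a (k + n₀) - B / q ≤ (1 - q) ^ k * (a n₀ - B / q) := by
    induction k with
    | zero => simp
    | succ k ih =>
      have hstep := hn₀ (k + n₀) (Nat.le_add_left _ _)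
      have hfixed : (1 - q) * (B / q) + B = B / q := by field_simp; ring
      have hscaled := mul_le_mul_of_nonneg_left ih (sub_nonneg.mpr hq1)
      rw [add_right_comm, pow_succ]
      linarith
  have hlim : Tendsto (fun k => (1 - q) ^ k * (a n₀ - B / q)) atTop (𝓝 0) := by
    simpa using (tendsto_pow_atTop_nhds_zero_of_lt_one (sub_nonneg.mpr hq1)
      (by linarith)).mul_const (a n₀ - B / q)
  rw [← map_add_atTop_eq_nat n₀, eventually_map]
  filter_upwards [hlim.eventually_lt_const (div_pos hB hq)] with k hk
  linarith [hgeom k]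

variable {X : Type*} {l : Filter X} {a : X → ℕ → ℝ} {q g : X → ℝ} {b : X × ℕ → ℝ}

theorem eventually_le_of_le_one_sub_mul_add {C : ℝ} (hC : 0 < C)
    (hq : ∀ᶠ x in l, 0 < q x ∧ q x ≤ 1) (hg : ∀ᶠ x in l, 0 < g x)
    (hb : ∀ᶠ x in l.curry atTop, b x ≤ C * (q x.1 * g x.1))
    (h : ∀ᶠ x in l.curry atTop, a x.1 (x.2 + 1) ≤ (1 - q x.1) * a x.1 x.2 + b x) :
    ∀ᶠ x in l.curry atTop, a x.1 x.2 ≤ 2 * C * g x.1 := by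
  rw [eventually_curry_iff] at hb h ⊢
  filter_upwards [hq, hg, hb, h] with x ⟨hqx, hqx1⟩ hgx hbx hx
  have hrec : ∀ᶠ n in atTop, a x (n + 1) ≤ (1 - q x) * a x n + C * (q x * g x) := by
    filter_upwards [hbx, hx] with n hbn hn using hn.trans (by gcongr)
  filter_upwards [eventually_le_two_mul_div_of_le_one_sub_mul_add hqx hqx1 (by positivity) hrec]
    with n hn
  exact hn.trans_eq (by field_simp)

theorem isBigO_of_le_one_sub_mul_add (ha : ∀ x n, 0 ≤ a x n)
    (hq : ∀ᶠ x in l, 0 < q x ∧ q x ≤ 1) (hg : ∀ᶠ x in l, 0 < g x)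
    (hb : b =O[l.curry atTop] fun x => q x.1 * g x.1)
    (h : ∀ᶠ x in l.curry atTop, a x.1 (x.2 + 1) ≤ (1 - q x.1) * a x.1 x.2 + b x) :
    (fun x : X × ℕ => a x.1 x.2) =O[l.curry atTop] fun x => g x.1 := by
  obtain ⟨C, hC, hbC⟩ := hb.exists_pos
  have hqg := (tendsto_fst_curry l (atTop : Filter ℕ)).eventually (hq.and hg)
  refine .of_bound (2 * C) ?_
  have hb' : ∀ᶠ x in l.curry atTop, b x ≤ C * (q x.1 * g x.1) := by
    filter_upwards [hbC.bound, hqg] with x hx ⟨⟨hqx, _⟩, hgx⟩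
    rw [Real.norm_of_nonneg (mul_pos hqx hgx).le] at hx
    exact (le_abs_self _).trans hx
  filter_upwards [eventually_le_of_le_one_sub_mul_add hC hq hg hb' h, hqg] with x hx ⟨_, hgx⟩
  rwa [Real.norm_of_nonneg (ha _ _), Real.norm_of_nonneg hgx.le]

theorem tendsto_zero_of_le_one_sub_mul_add (ha : ∀ x n, 0 ≤ a x n)
    (hq : ∀ᶠ x in l, 0 < q x ∧ q x ≤ 1)
    (hb : b =o[l.curry atTop] fun x => q x.1)
    (h : ∀ᶠ x in l.curry atTop, a x.1 (x.2 + 1) ≤ (1 - q x.1) * a x.1 x.2 + b x) :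
    Tendsto (fun x : X × ℕ => a x.1 x.2) (l.curry atTop) (𝓝 0) := by
  refine (Asymptotics.isLittleO_one_iff ℝ).mp (Asymptotics.isLittleO_iff.mpr fun ε hε => ?_)
  have hqx := (tendsto_fst_curry l (atTop : Filter ℕ)).eventually hq
  have hb' : ∀ᶠ x in l.curry atTop, b x ≤ ε / 2 * (q x.1 * 1) := by
    filter_upwards [hb.bound (half_pos hε), hqx] with x hx ⟨hqx, _⟩
    rw [Real.norm_of_nonneg hqx.le] at hx
    rw [mul_one]
    exact (le_abs_self _).trans hx
  filter_upwards [eventually_le_of_le_one_sub_mul_add (half_pos hε) hq (.of_forall fun _ => one_pos)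
    hb' h] with x hx
  rw [Real.norm_of_nonneg (ha _ _), norm_one]
  linarith

end IteratedLimits

/-! ### Matrices and the Lyapunov equation -/

section Matrices

variable {ι κ : Type*} [Fintype ι] [Fintype κ] [DecidableEq κ]

theorem norm_vecMulVec_le (u : EuclideanSpace ℝ ι) (v : EuclideanSpace ℝ κ) :
    ‖Matrix.vecMulVec u v‖ ≤ ‖u‖ * ‖v‖ := by
  refine ContinuousLinearMap.opNorm_le_bound _ (by positivity) fun x => ?_
  change ‖WithLp.toLp 2 (Matrix.vecMulVec u v *ᵥ x)‖ ≤ _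
  have hinner : v.ofLp ⬝ᵥ x.ofLp = inner ℝ x v := rfl
  rw [Matrix.vecMulVec_mulVec, hinner, op_smul_eq_smul, WithLp.toLp_smul, norm_smul]
  calc ‖inner ℝ x v‖ * ‖u‖ ≤ ‖x‖ * ‖v‖ * ‖u‖ := by gcongr; exact norm_inner_le_norm _ _
    _ = ‖u‖ * ‖v‖ * ‖x‖ := by ring

theorem abs_apply_le_norm (X : Matrix ι κ ℝ) (i : ι) (j : κ) : |X i j| ≤ ‖X‖ := by
  have hcol := X.l2_opNorm_mulVec (EuclideanSpace.single j 1)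
  rw [PiLp.norm_single, norm_one, mul_one] at hcol
  have hentry := (PiLp.norm_apply_le _ i).trans hcol
  simpa using hentry

variable [DecidableEq ι] {H X : Matrix ι ι ℝ} {c : ℝ}

theorem toEuclideanCLM_apply (X : Matrix ι ι ℝ) (x : EuclideanSpace ℝ ι) :
    Matrix.toEuclideanCLM (𝕜 := ℝ) X x = WithLp.toLp 2 (X *ᵥ x) :=
  rfl

theorem inner_toEuclideanCLM_nonneg (hX : X.PosSemidef) (x : EuclideanSpace ℝ ι) :
    0 ≤ inner ℝ x (Matrix.toEuclideanCLM (𝕜 := ℝ) X x) := by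
  simpa [Matrix.inner_toEuclideanCLM] using hX.dotProduct_mulVec_nonneg x

theorem inner_toEuclideanCLM_smul_one_sub (c : ℝ) (X : Matrix ι ι ℝ) (x : EuclideanSpace ℝ ι) :
    inner ℝ x (Matrix.toEuclideanCLM (𝕜 := ℝ) (c • 1 - X) x) =
      c * ‖x‖ ^ 2 - inner ℝ x (Matrix.toEuclideanCLM (𝕜 := ℝ) X x) := by
  simp [inner_sub_right, real_inner_smul_right]

theorem posSemidef_of_inner_nonneg (hX : X.IsHermitian)
    (h : ∀ x, 0 ≤ inner ℝ x (Matrix.toEuclideanCLM (𝕜 := ℝ) X x)) : X.PosSemidef := by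
  refine .of_dotProduct_mulVec_nonneg hX fun x => ?_
  have hx := h (WithLp.toLp 2 x)
  rwa [Matrix.inner_toEuclideanCLM] at hx

theorem norm_le_of_posSemidef (hc : 0 ≤ c) (hX : X.PosSemidef) (hcX : (c • 1 - X).PosSemidef) :
    ‖X‖ ≤ c := by
  have hsymm : (Matrix.toEuclideanCLM (𝕜 := ℝ) X : EuclideanSpace ℝ ι →ₗ[ℝ] _).IsSymmetric :=
    (Matrix.isPositive_toEuclideanLin_iff.mpr hX).isSymmetric
  rw [← Matrix.l2_opNorm_toEuclideanCLM,
    ContinuousLinearMap.norm_eq_iSup_rayleighQuotient _ hsymm]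
  refine Real.iSup_le (fun x => ?_) hc
  have hlower := inner_toEuclideanCLM_nonneg hX x
  have hupper := inner_toEuclideanCLM_nonneg hcX x
  rw [inner_toEuclideanCLM_smul_one_sub, sub_nonneg] at hupper
  rw [ContinuousLinearMap.rayleighQuotient, ContinuousLinearMap.reApplyInnerSelf_apply,
    real_inner_comm, RCLike.re_to_real, abs_div, abs_of_nonneg hlower, abs_of_nonneg (sq_nonneg _)]
  exact div_le_of_le_mul₀ (sq_nonneg _) hc hupper

theorem posSemidef_norm_smul_one_sub (hH : H.IsHermitian) : (‖H‖ • 1 - H).PosSemidef := by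
  refine posSemidef_of_inner_nonneg ((Matrix.isHermitian_one.smul (.all ‖H‖)).sub hH) fun x => ?_
  rw [inner_toEuclideanCLM_smul_one_sub, sub_nonneg, ← Matrix.l2_opNorm_toEuclideanCLM H, sq,
    ← mul_assoc, mul_comm]
  exact (real_inner_le_norm _ _).trans
    (by gcongr; exact ContinuousLinearMap.le_opNorm _ _)

theorem norm_one_sub_smul_le {lam μ : ℝ} (hH : H.IsHermitian)
    (hlam : (H - lam • 1).PosSemidef) (hμ : 0 ≤ μ) (hμH : μ * ‖H‖ ≤ 1) (hμlam : μ * lam ≤ 1) :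
    ‖1 - μ • H‖ ≤ 1 - μ * lam := by
  refine norm_le_of_posSemidef (sub_nonneg.mpr hμlam) ?_ ?_
  · have hsplit : 1 - μ • H = (1 - μ * ‖H‖) • (1 : Matrix ι ι ℝ) + μ • (‖H‖ • 1 - H) := by
      module
    rw [hsplit]
    exact (Matrix.PosSemidef.one.smul (sub_nonneg.mpr hμH)).add
      ((posSemidef_norm_smul_one_sub hH).smul hμ)
  · have hsplit : (1 - μ * lam) • (1 : Matrix ι ι ℝ) - (1 - μ • H) = μ • (H - lam • 1) := by
      module
    rw [hsplit]
    exact hlam.smul hμ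

theorem conj_one_sub_smul (H X : Matrix ι ι ℝ) (μ : ℝ) :
    (1 - μ • H) * X * (1 - μ • H) = X - μ • (H * X + X * H) + μ ^ 2 • (H * X * H) := by
  simp only [sub_mul, mul_sub, one_mul, mul_one, smul_mul_assoc, mul_smul_comm]
  module

end Matrices

section Lyapunov

variable {ι : Type*} [Fintype ι] {H X : Matrix ι ι ℝ}

theorem eq_zero_of_conjTranspose_mul_mul_eq_zero (hH : H.PosDef) (h : Xᴴ * H * X = 0) : X = 0 := by
  classical
  refine Matrix.ext_of_mulVec_single fun i => ?_
  rw [Matrix.zero_mulVec]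
  by_contra hne
  refine (hH.dotProduct_mulVec_pos hne).ne' ?_
  rw [Matrix.star_mulVec, Matrix.dotProduct_mulVec, Matrix.vecMul_vecMul,
    ← Matrix.dotProduct_mulVec, Matrix.mulVec_mulVec, h, Matrix.zero_mulVec, dotProduct_zero]

theorem existsUnique_lyapunov (hH : H.PosDef) (R : Matrix ι ι ℝ) :
    ∃! X, H * X + X * H = R := by
  have hinj : Function.Injective (LinearMap.mulLeft ℝ H + LinearMap.mulRight ℝ H) := by
    refine (injective_iff_map_eq_zero _).mpr fun X hX => ?_
    rw [LinearMap.add_apply, LinearMap.mulLeft_apply, LinearMap.mulRight_apply] at hX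
    have hcol := hH.posSemidef.conjTranspose_mul_mul_same X
    have hrow := hH.posSemidef.mul_mul_conjTranspose_same X
    have htrace : (Xᴴ * H * X).trace + (X * H * Xᴴ).trace = 0 := by
      rw [Matrix.trace_mul_comm (X * H), ← Matrix.trace_add, mul_assoc, ← mul_add, hX, mul_zero,
        Matrix.trace_zero]
    have hzero : (Xᴴ * H * X).trace = 0 := by
      linarith [hcol.trace_nonneg, hrow.trace_nonneg]
    exact eq_zero_of_conjTranspose_mul_mul_eq_zero hH (hcol.trace_eq_zero_iff.mp hzero)
  obtain ⟨X, hX⟩ := LinearMap.injective_iff_surjective.mp hinj R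
  exact ⟨X, hX, fun Y hY => hinj (Eq.trans hY hX.symm)⟩

end Lyapunov

/-! ### Moments and second moment matrices -/

section Moments

variable {Ω : Type*} {m mΩ : MeasurableSpace Ω} {P : Measure Ω}
  {E : Type*} [NormedAddCommGroup E] {F : Type*} [NormedAddCommGroup F]

theorem integrable_norm_sq {f : Ω → E} (hf : MemLp f 2 P) : Integrable (fun ω => ‖f ω‖ ^ 2) P :=
  MemLp.integrable_norm_pow (p := 2) (by exact_mod_cast hf) two_ne_zero

theorem integrable_norm_pow_four {f : Ω → E} (hf : MemLp f 4 P) :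
    Integrable (fun ω => ‖f ω‖ ^ 4) P :=
  MemLp.integrable_norm_pow (p := 4) (by exact_mod_cast hf) four_ne_zero

theorem memLp_two_of_four [IsFiniteMeasure P] {f : Ω → E} (hf : MemLp f 4 P) : MemLp f 2 P :=
  hf.mono_exponent (by norm_num)

theorem sq_integral_norm_sq_le [IsProbabilityMeasure P] {f : Ω → E} (hf : MemLp f 4 P) :
    (∫ ω, ‖f ω‖ ^ 2 ∂P) ^ 2 ≤ ∫ ω, ‖f ω‖ ^ 4 ∂P := by
  have h := (even_two.convexOn_pow (𝕜 := ℝ)).map_integral_le (by fun_prop) isClosed_univ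
    (by simp) (integrable_norm_sq (memLp_two_of_four hf))
    (by simpa only [Function.comp_def, ← pow_mul, Nat.reduceMul] using integrable_norm_pow_four hf)
  simpa only [← pow_mul, Nat.reduceMul] using h

theorem isBigO_integral_norm_sq_of_pow_four [IsProbabilityMeasure P] {X : Type*} {l : Filter X}
    {f : X → Ω → E} {g : X → ℝ} (hf : ∀ x, MemLp (f x) 4 P)
    (h : (fun x => ∫ ω, ‖f x ω‖ ^ 4 ∂P) =O[l] fun x => g x ^ 2) :
    (fun x => ∫ ω, ‖f x ω‖ ^ 2 ∂P) =O[l] g := by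
  refine Asymptotics.IsBigO.of_pow two_ne_zero (.trans (.of_bound 1 (.of_forall fun x => ?_)) h)
  rw [one_mul, Real.norm_of_nonneg (integral_nonneg fun ω => by positivity), Pi.pow_apply,
    Real.norm_of_nonneg (sq_nonneg _)]
  exact sq_integral_norm_sq_le (hf x)

theorem isBigO_integral_norm_sq_of_norm_le {X : Type*} {l : Filter X} {U : X → Ω → E}
    {V : X → Ω → F} {K : ℝ} (hV : ∀ x, MemLp (V x) 2 P) (h : ∀ x ω, ‖U x ω‖ ≤ K * ‖V x ω‖) :
    (fun x => ∫ ω, ‖U x ω‖ ^ 2 ∂P) =O[l] fun x => ∫ ω, ‖V x ω‖ ^ 2 ∂P := by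
  refine Asymptotics.IsBigO.of_bound (K ^ 2) (Eventually.of_forall fun x => ?_)
  rw [Real.norm_of_nonneg (integral_nonneg fun _ => sq_nonneg _),
    Real.norm_of_nonneg (integral_nonneg fun _ => sq_nonneg _), ← integral_const_mul]
  refine integral_mono_of_nonneg (ae_of_all _ fun ω => sq_nonneg _)
    ((integrable_norm_sq (hV x)).const_mul _) (ae_of_all _ fun ω => ?_)
  simpa only [mul_pow] using pow_le_pow_left₀ (norm_nonneg _) (h x ω) 2

section Bilinear

variable [NormedSpace ℝ E] [CompleteSpace E] [NormedSpace ℝ F]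
  {G : Type*} [NormedAddCommGroup G] [NormedSpace ℝ G] [CompleteSpace G]

theorem integral_bilin_eq_zero [IsFiniteMeasure P] (hm : m ≤ mΩ) (B : F →L[ℝ] E →L[ℝ] G)
    {Z : Ω → F} {s : Ω → E} (hZ : StronglyMeasurable[m] Z) (hs : Integrable s P)
    (hs0 : P[s | m] =ᵐ[P] 0) (hZs : Integrable (fun ω => B (Z ω) (s ω)) P) :
    ∫ ω, B (Z ω) (s ω) ∂P = 0 := by
  rw [← integral_condExp hm, ← integral_zero Ω G (μ := P)]
  refine integral_congr_ae ?_
  filter_upwards [condExp_bilin_of_stronglyMeasurable_left B hZ hZs hs, hs0] with ω hpull hzero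
  rw [hpull, hzero, Pi.zero_apply, map_zero]

theorem integral_bilin_add_self [IsFiniteMeasure P] (hm : m ≤ mΩ) (B : E →L[ℝ] E →L[ℝ] G)
    {u v : Ω → E} (hum : StronglyMeasurable[m] u) (hu : MemLp u 2 P) (hv : MemLp v 2 P)
    (hv0 : P[v | m] =ᵐ[P] 0) :
    ∫ ω, B (u ω + v ω) (u ω + v ω) ∂P = ∫ ω, B (u ω) (u ω) ∂P + ∫ ω, B (v ω) (v ω) ∂P := by
  have hint {a b : Ω → E} (ha : MemLp a 2 P) (hb : MemLp b 2 P) :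
      Integrable (fun ω => B (a ω) (b ω)) P :=
    memLp_one_iff_integrable.mp (B.memLp_of_bilin 1 ha hb)
  have hv1 := hv.integrable one_le_two
  have huv := integral_bilin_eq_zero hm B hum hv1 hv0 (hint hu hv)
  have hvu := integral_bilin_eq_zero hm B.flip hum hv1 hv0 (hint hv hu)
  simp only [ContinuousLinearMap.flip_apply] at hvu
  have hleft : Integrable (fun ω => B (u ω) (u ω) + B (v ω) (u ω)) P :=
    (hint hu hu).add (hint hv hu)
  have hright : Integrable (fun ω => B (u ω) (v ω) + B (v ω) (v ω)) P :=
    (hint hu hv).add (hint hv hv)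
  simp only [map_add, add_apply]
  rw [integral_add hleft hright,
    integral_add (hint hu hu) (hint hv hu), integral_add (hint hu hv) (hint hv hv), huv, hvu,
    add_zero, zero_add]

end Bilinear

section InnerProduct

variable [InnerProductSpace ℝ E]

theorem norm_add_pow_four_le (a b : E) {t : ℝ} (ht : 0 < t) :
    ‖a + b‖ ^ 4 ≤
      (1 + t) * ‖a‖ ^ 4 + (3 + 16 / t) * ‖b‖ ^ 4 + 4 * inner ℝ (‖a‖ ^ 2 • a) b := by
  have hexpand : ‖a + b‖ ^ 4 = (‖a‖ ^ 2 + 2 * inner ℝ a b + ‖b‖ ^ 2) ^ 2 := by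
    rw [← norm_add_sq_real]; ring
  have hinner : inner ℝ a b ≤ ‖a‖ * ‖b‖ := real_inner_le_norm a b
  have hinner_sq : inner ℝ a b ^ 2 ≤ (‖a‖ * ‖b‖) ^ 2 := by
    rw [sq_le_sq, abs_of_nonneg (a := ‖a‖ * ‖b‖) (by positivity)]
    exact abs_real_inner_le_norm a b
  have hcubic : 4 * inner ℝ a b * ‖b‖ ^ 2 ≤ 2 * ‖a‖ ^ 2 * ‖b‖ ^ 2 + 2 * ‖b‖ ^ 4 := by
    nlinarith [sq_nonneg ‖b‖, two_mul_le_add_sq ‖a‖ ‖b‖]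
  have hyoung : 8 * ‖a‖ ^ 2 * ‖b‖ ^ 2 ≤ t * ‖a‖ ^ 4 + 16 / t * ‖b‖ ^ 4 := by
    have hsq : t⁻¹ * (t * ‖a‖ ^ 2 - 4 * ‖b‖ ^ 2) ^ 2
        = t * ‖a‖ ^ 4 + 16 / t * ‖b‖ ^ 4 - 8 * ‖a‖ ^ 2 * ‖b‖ ^ 2 := by
      field_simp
      ring
    have : 0 ≤ t⁻¹ * (t * ‖a‖ ^ 2 - 4 * ‖b‖ ^ 2) ^ 2 := by positivity
    linarith
  rw [real_inner_smul_left, hexpand]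
  nlinarith

variable [CompleteSpace E]

theorem integral_norm_add_sq [IsFiniteMeasure P] (hm : m ≤ mΩ) {u v : Ω → E}
    (hum : StronglyMeasurable[m] u) (hu : MemLp u 2 P) (hv : MemLp v 2 P)
    (hv0 : P[v | m] =ᵐ[P] 0) :
    ∫ ω, ‖u ω + v ω‖ ^ 2 ∂P = ∫ ω, ‖u ω‖ ^ 2 ∂P + ∫ ω, ‖v ω‖ ^ 2 ∂P := by
  simpa only [innerSL_apply_apply ℝ, real_inner_self_eq_norm_sq] using
    integral_bilin_add_self hm (innerSL ℝ) hum hu hv hv0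

theorem integral_norm_add_pow_four_le [IsFiniteMeasure P] (hm : m ≤ mΩ) {u v : Ω → E}
    (hum : StronglyMeasurable[m] u) (hu : MemLp u 4 P) (hv : MemLp v 4 P)
    (hv0 : P[v | m] =ᵐ[P] 0) {t : ℝ} (ht : 0 < t) :
    ∫ ω, ‖u ω + v ω‖ ^ 4 ∂P ≤
      (1 + t) * ∫ ω, ‖u ω‖ ^ 4 ∂P + (3 + 16 / t) * ∫ ω, ‖v ω‖ ^ 4 ∂P := by
  have hZ : StronglyMeasurable[m] fun ω => ‖u ω‖ ^ 2 • u ω := (hum.norm.pow 2).smul hum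
  have hu4 := integrable_norm_pow_four hu
  have hv4 := integrable_norm_pow_four hv
  have hcross : Integrable (fun ω => inner ℝ (‖u ω‖ ^ 2 • u ω) (v ω)) P := by
    refine (hu4.add hv4).mono' ((hZ.mono hm).aestronglyMeasurable.inner hv.1)
      (ae_of_all _ fun ω => (norm_inner_le_norm _ _).trans ?_)
    rw [norm_smul, norm_pow, norm_norm, Pi.add_apply]
    nlinarith [two_mul_le_add_sq ‖u ω‖ ‖v ω‖, two_mul_le_add_sq (‖u ω‖ ^ 2) (‖v ω‖ ^ 2),
      mul_le_mul_of_nonneg_left (two_mul_le_add_sq ‖u ω‖ ‖v ω‖) (sq_nonneg ‖u ω‖),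
      sq_nonneg (‖u ω‖ ^ 2), sq_nonneg (‖v ω‖ ^ 2)]
  have hzero : ∫ ω, inner ℝ (‖u ω‖ ^ 2 • u ω) (v ω) ∂P = 0 :=
    integral_bilin_eq_zero hm (innerSL ℝ) hZ (hv.integrable (by norm_num)) hv0 hcross
  have hmain : Integrable (fun ω => (1 + t) * ‖u ω‖ ^ 4 + (3 + 16 / t) * ‖v ω‖ ^ 4) P :=
    (hu4.const_mul _).add (hv4.const_mul _)
  calc ∫ ω, ‖u ω + v ω‖ ^ 4 ∂P
      ≤ ∫ ω, ((1 + t) * ‖u ω‖ ^ 4 + (3 + 16 / t) * ‖v ω‖ ^ 4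
          + 4 * inner ℝ (‖u ω‖ ^ 2 • u ω) (v ω)) ∂P :=
        integral_mono (integrable_norm_pow_four (hu.add hv)) (hmain.add (hcross.const_mul 4))
          fun ω => norm_add_pow_four_le (u ω) (v ω) ht
    _ = (1 + t) * ∫ ω, ‖u ω‖ ^ 4 ∂P + (3 + 16 / t) * ∫ ω, ‖v ω‖ ^ 4 ∂P := by
        rw [integral_add hmain (hcross.const_mul 4),
          integral_add (hu4.const_mul _) (hv4.const_mul _), integral_const_mul, integral_const_mul,
          integral_const_mul, hzero, mul_zero, add_zero]

end InnerProduct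

section SecondMoment

variable {ι κ : Type*} [Fintype ι] [Fintype κ] [DecidableEq κ]

/-- The outer product `u vᵀ` of two Euclidean vectors, as a bounded bilinear map. -/
noncomputable def outer : EuclideanSpace ℝ ι →L[ℝ] EuclideanSpace ℝ κ →L[ℝ] Matrix ι κ ℝ :=
  LinearMap.mkContinuous₂
    ((vecMulVecBilin ℝ ℝ).compl₁₂ (WithLp.linearEquiv 2 ℝ (ι → ℝ)).toLinearMap
      (WithLp.linearEquiv 2 ℝ (κ → ℝ)).toLinearMap) 1
    fun u v => by rw [one_mul]; exact norm_vecMulVec_le u v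

theorem norm_outer_le (u : EuclideanSpace ℝ ι) (v : EuclideanSpace ℝ κ) :
    ‖outer u v‖ ≤ ‖u‖ * ‖v‖ :=
  norm_vecMulVec_le u v

/-- The second moment matrix `E[u uᵀ]`. -/
noncomputable def secondMoment [DecidableEq ι] (P : Measure Ω) (u : Ω → EuclideanSpace ℝ ι) :
    Matrix ι ι ℝ :=
  ∫ ω, outer (u ω) (u ω) ∂P

variable [DecidableEq ι] {u v : Ω → EuclideanSpace ℝ ι}

theorem integrable_outer (hu : MemLp u 2 P) : Integrable (fun ω => outer (u ω) (u ω)) P :=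
  memLp_one_iff_integrable.mp ((outer (ι := ι) (κ := ι)).memLp_of_bilin 1 hu hu)

theorem secondMoment_apply (hu : MemLp u 2 P) (i j : ι) :
    secondMoment P u i j = ∫ ω, u ω i * u ω j ∂P :=
  ((Matrix.entryLinearMap ℝ ℝ i j).toContinuousLinearMap.integral_comp_comm
    (integrable_outer hu)).symm

theorem normalizedCov_eq (hu : MemLp u 2 P) (c : ℝ) :
    normalizedCov P c u = c⁻¹ • secondMoment P u := by
  ext i j
  rw [Matrix.smul_apply, secondMoment_apply hu, smul_eq_mul, normalizedCov, Matrix.of_apply]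

theorem secondMoment_smul (c : ℝ) (u : Ω → EuclideanSpace ℝ ι) :
    secondMoment P (fun ω => c • u ω) = c ^ 2 • secondMoment P u := by
  simp only [secondMoment, map_smul, smul_apply, smul_smul, ← sq,
    integral_smul]

theorem secondMoment_mulVec (hu : MemLp u 2 P) (B : Matrix κ ι ℝ) :
    secondMoment P (fun ω => WithLp.toLp 2 (B *ᵥ u ω)) = B * secondMoment P u * Bᵀ := by
  let L : Matrix ι ι ℝ →L[ℝ] Matrix κ κ ℝ :=
    (LinearMap.mk (AddHom.mk (fun X => B * X * Bᵀ)
      fun X Y => by rw [Matrix.mul_add, Matrix.add_mul])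
      fun c X => by simp [Matrix.mul_smul, Matrix.smul_mul]).toContinuousLinearMap
  rw [secondMoment, secondMoment]
  refine Eq.trans ?_ (L.integral_comp_comm (integrable_outer hu))
  refine integral_congr_ae (ae_of_all _ fun ω => ?_)
  change Matrix.vecMulVec (B *ᵥ u ω) (B *ᵥ u ω) = B * Matrix.vecMulVec (u ω) (u ω) * Bᵀ
  rw [Matrix.mul_vecMulVec, Matrix.vecMulVec_mul, Matrix.vecMul_transpose]

theorem secondMoment_add [IsFiniteMeasure P] (hm : m ≤ mΩ) (hum : StronglyMeasurable[m] u)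
    (hu : MemLp u 2 P) (hv : MemLp v 2 P) (hv0 : P[v | m] =ᵐ[P] 0) :
    secondMoment P (fun ω => u ω + v ω) = secondMoment P u + secondMoment P v :=
  integral_bilin_add_self hm (outer (ι := ι) (κ := ι)) hum hu hv hv0

theorem norm_outer_add_sub_le (u v : EuclideanSpace ℝ ι) {t : ℝ} (ht : 0 < t) :
    ‖outer (u + v) (u + v) - outer u u‖ ≤ t * ‖u‖ ^ 2 + (1 + t⁻¹) * ‖v‖ ^ 2 := by
  have hyoung : 2 * (‖u‖ * ‖v‖) ≤ t * ‖u‖ ^ 2 + t⁻¹ * ‖v‖ ^ 2 := by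
    have hsq : t⁻¹ * (t * ‖u‖ - ‖v‖) ^ 2
        = t * ‖u‖ ^ 2 - 2 * (‖u‖ * ‖v‖) + t⁻¹ * ‖v‖ ^ 2 := by
      field_simp
      ring
    have : 0 ≤ t⁻¹ * (t * ‖u‖ - ‖v‖) ^ 2 := by positivity
    linarith
  calc ‖outer (u + v) (u + v) - outer u u‖
      = ‖outer u v + outer v u + outer v v‖ := by
        simp only [map_add, add_apply]
        congr 1
        abel
    _ ≤ ‖u‖ * ‖v‖ + ‖v‖ * ‖u‖ + ‖v‖ * ‖v‖ :=
        norm_add₃_le.trans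
          (add_le_add_three (norm_outer_le u v) (norm_outer_le v u) (norm_outer_le v v))
    _ ≤ t * ‖u‖ ^ 2 + (1 + t⁻¹) * ‖v‖ ^ 2 := by linarith

theorem norm_secondMoment_add_sub_le (hu : MemLp u 2 P) (hv : MemLp v 2 P) {t : ℝ} (ht : 0 < t) :
    ‖secondMoment P (fun ω => u ω + v ω) - secondMoment P u‖ ≤
      t * ∫ ω, ‖u ω‖ ^ 2 ∂P + (1 + t⁻¹) * ∫ ω, ‖v ω‖ ^ 2 ∂P := by
  have huv : MemLp (fun ω => u ω + v ω) 2 P := hu.add hv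
  have hu2 := (integrable_norm_sq hu).const_mul t
  have hv2 := (integrable_norm_sq hv).const_mul (1 + t⁻¹)
  rw [secondMoment, secondMoment, ← integral_sub (integrable_outer huv) (integrable_outer hu),
    ← integral_const_mul, ← integral_const_mul, ← integral_add hu2 hv2]
  exact norm_integral_le_of_norm_le (hu2.add hv2)
    (ae_of_all _ fun ω => norm_outer_add_sub_le (u ω) (v ω) ht)

theorem isBigO_secondMoment_add_sub {X : Type*} {l : Filter X} {f r : X → ℝ}
    {U V : X → Ω → EuclideanSpace ℝ ι} (hU : ∀ x, MemLp (U x) 2 P) (hV : ∀ x, MemLp (V x) 2 P)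
    (hr : ∀ᶠ x in l, 0 < r x ∧ r x ≤ 1)
    (hUf : (fun x => ∫ ω, ‖U x ω‖ ^ 2 ∂P) =O[l] f)
    (hVf : (fun x => ∫ ω, ‖V x ω‖ ^ 2 ∂P) =O[l] fun x => r x ^ 2 * f x) :
    (fun x => secondMoment P (fun ω => U x ω + V x ω) - secondMoment P (U x))
      =O[l] fun x => r x * f x := by
  have hU' : (fun x => r x * ∫ ω, ‖U x ω‖ ^ 2 ∂P) =O[l] fun x => r x * f x :=
    (Asymptotics.isBigO_refl r l).mul hUf
  have hV' : (fun x => (1 + (r x)⁻¹) * ∫ ω, ‖V x ω‖ ^ 2 ∂P) =O[l] fun x => r x * f x := by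
    have hinv : (fun x => 1 + (r x)⁻¹) =O[l] fun x => (r x)⁻¹ := by
      refine Asymptotics.IsBigO.of_bound 2 (hr.mono fun x hx => ?_)
      have : 1 ≤ (r x)⁻¹ := (one_le_inv₀ hx.1).mpr hx.2
      rw [Real.norm_of_nonneg (by linarith), Real.norm_of_nonneg (by linarith)]
      linarith
    refine (hinv.mul hVf).congr' .rfl (hr.mono fun x hx => ?_)
    have := hx.1.ne'
    field_simp
  refine (Asymptotics.IsBigO.of_norm_eventuallyLE (hr.mono fun x hx => ?_)).trans (hU'.add hV')
  exact norm_secondMoment_add_sub_le (hU x) (hV x) hx.1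

end SecondMoment

end Moments

/-! ### Perron vectors -/

section Fixed

variable {ι κ : Type*} [Fintype ι] {A : Matrix ι ι ℝ} {v : ι → ℝ}

theorem abs_mulVec_eq_of_mem_colStochastic [DecidableEq ι] (hA : A ∈ Matrix.colStochastic ℝ ι)
    (hv : A *ᵥ v = v) : A *ᵥ |v| = |v| := by
  have hle : ∀ k ∈ Finset.univ, |v| k ≤ (A *ᵥ |v|) k := by
    intro k _
    calc |v| k = |∑ l, A k l * v l| := by rw [Pi.abs_apply, ← congrFun hv k]; rfl
      _ ≤ ∑ l, |A k l * v l| := Finset.abs_sum_le_sum_abs _ _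
      _ = (A *ᵥ |v|) k := Finset.sum_congr rfl fun l _ => by
          rw [abs_mul, abs_of_nonneg (Matrix.nonneg_of_mem_colStochastic hA), Pi.abs_apply]
  have hsum : ∑ k, |v| k = ∑ k, (A *ᵥ |v|) k :=
    (Matrix.sum_mulVec_of_mem_colStochastic hA).symm
  funext k
  exact ((Finset.sum_eq_sum_iff_of_le hle).mp hsum k (Finset.mem_univ k)).symm

theorem existsUnique_fixed_with_sums [DecidableEq κ] {grp : ι → κ}
    (hgrp : Function.Surjective grp)
    (hsum : ∀ v m, ∑ k with grp k = m, (A *ᵥ v) k = ∑ k with grp k = m, v k)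
    (hker : ∀ v, A *ᵥ v = v → (∀ m, ∑ k with grp k = m, v k = 0) → v = 0) (c : κ → ℝ) :
    ∃! v, A *ᵥ v = v ∧ ∀ m, ∑ k with grp k = m, v k = c m := by
  let L : (ι → ℝ) →ₗ[ℝ] (ι → ℝ) := LinearMap.id - A.mulVecLin +
    LinearMap.pi fun k => ∑ l with grp l = grp k, LinearMap.proj l
  have hL (v : ι → ℝ) (k : ι) : L v k = v k - (A *ᵥ v) k + ∑ l with grp l = grp k, v l := by
    simp [L]
  have hfixed {v : ι → ℝ} {c : κ → ℝ} (hv : L v = fun k => c (grp k)) :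
      A *ᵥ v = v ∧ ∀ m, ∑ k with grp k = m, v k = c m := by
    have hsums (m : κ) : ∑ k with grp k = m, v k = c m := by
      obtain ⟨k₀, hk₀⟩ := hgrp m
      have hcard : ((Finset.univ.filter fun k => grp k = m).card : ℝ) ≠ 0 :=
        Nat.cast_ne_zero.mpr (Finset.card_ne_zero.mpr ⟨k₀, by simpa using hk₀⟩)
      have htotal : ∑ k with grp k = m, L v k =
          ∑ k with grp k = m, ((v k - (A *ᵥ v) k) + ∑ l with grp l = m, v l) :=
        Finset.sum_congr rfl fun k hk => by rw [hL, (Finset.mem_filter.mp hk).2]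
      rw [Finset.sum_add_distrib, Finset.sum_sub_distrib, hsum, sub_self, zero_add,
        Finset.sum_const, nsmul_eq_mul, hv,
        Finset.sum_congr rfl fun k hk => congrArg c (Finset.mem_filter.mp hk).2,
        Finset.sum_const, nsmul_eq_mul] at htotal
      exact (mul_left_cancel₀ hcard htotal).symm
    refine ⟨funext fun k => ?_, hsums⟩
    have hk := congrFun hv k
    rw [hL, hsums] at hk
    linarith
  have hinj : Function.Injective L := by
    refine (injective_iff_map_eq_zero L).mpr fun v hv => ?_
    obtain ⟨hfix, hsums⟩ := hfixed (c := 0) hv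
    exact hker v hfix hsums
  obtain ⟨v, hv⟩ := LinearMap.injective_iff_surjective.mp hinj fun k => c (grp k)
  refine ⟨v, hfixed hv, fun u hu => hinj (Eq.trans (funext fun k => ?_) hv.symm)⟩
  rw [hL, hu.1, hu.2, sub_self, zero_add]

end Fixed

section Perron

variable {N G M : ℕ} {T : SimpleGraph (Fin N)} {grp : Fin N → Fin G}
  {A : Matrix (Fin N) (Fin N) ℝ} {wo : Fin N → Vec M}

theorem IsGrouping.propagate (hgrp : IsGrouping T grp wo) {f : Fin N → Prop}
    (hf : ∀ k l, T.Adj k l → grp k = grp l → f k → f l) {k l : Fin N} (hkl : grp k = grp l)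
    (hk : f k) : f l := by
  have hconn := (hgrp.connected (grp l)).preconnected ⟨k, hkl⟩ ⟨l, rfl⟩
  rw [SimpleGraph.reachable_iff_reflTransGen] at hconn
  have key : ∀ y : ({k | grp k = grp l} : Set (Fin N)),
      Relation.ReflTransGen (T.induce {k | grp k = grp l}).Adj ⟨k, hkl⟩ y → f y := by
    intro y hy
    induction hy with
    | refl => exact hk
    | @tail b c _ hbc ih =>
      have hb : grp b = grp l := b.2
      have hc : grp c = grp l := c.2
      exact hf b c hbc (hb.trans hc.symm) ih
  exact key _ hconn

theorem IsGrouping.surjective (hgrp : IsGrouping T grp wo) : Function.Surjective grp := fun m =>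
  have ⟨k⟩ := (hgrp.connected m).nonempty
  ⟨k, k.2⟩

theorem IsCombination.nonneg (hA : IsCombination T grp A) (l k : Fin N) : 0 ≤ A l k := by
  by_cases h : (l = k ∨ T.Adj l k) ∧ grp l = grp k
  · exact (hA.pos l k h).le
  · exact (hA.zero l k h).ge

theorem IsCombination.eq_zero_of_grp_ne (hA : IsCombination T grp A) {l k : Fin N}
    (h : grp l ≠ grp k) : A l k = 0 :=
  hA.zero l k fun h' => h h'.2

theorem IsCombination.mem_colStochastic (hA : IsCombination T grp A) :
    A ∈ Matrix.colStochastic ℝ (Fin N) :=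
  Matrix.mem_colStochastic_iff_sum.mpr ⟨hA.nonneg, hA.sum_one⟩

theorem IsCombination.sum_grp (hA : IsCombination T grp A) (m : Fin G) (k : Fin N) :
    ∑ l with grp l = m, A l k = if grp k = m then 1 else 0 := by
  split_ifs with h
  · rw [← hA.sum_one k]
    refine Finset.sum_filter_of_ne fun l _ hl => ?_
    contrapose! hl
    exact hA.eq_zero_of_grp_ne (h ▸ hl)
  · refine Finset.sum_eq_zero fun l hl => hA.eq_zero_of_grp_ne ?_
    rw [(Finset.mem_filter.mp hl).2]
    exact Ne.symm h

theorem IsCombination.sum_grp_mulVec (hA : IsCombination T grp A) (v : Fin N → ℝ) (m : Fin G) :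
    ∑ k with grp k = m, (A *ᵥ v) k = ∑ k with grp k = m, v k := by
  simp only [Matrix.mulVec, dotProduct]
  rw [Finset.sum_comm]
  simp only [← Finset.sum_mul, hA.sum_grp, ite_mul, one_mul, zero_mul, Finset.sum_filter]

theorem IsCombination.pos_of_nonneg_fixed (hgrp : IsGrouping T grp wo) (hA : IsCombination T grp A)
    {v : Fin N → ℝ} (hv : A *ᵥ v = v) (hv0 : 0 ≤ v) {k l : Fin N} (hkl : grp k = grp l)
    (hk : 0 < v k) : 0 < v l := by
  refine hgrp.propagate (f := fun k => 0 < v k) (fun a b hab hg ha => ?_) hkl hk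
  calc 0 < A b a * v a := mul_pos (hA.pos b a ⟨Or.inr hab.symm, hg.symm⟩) ha
    _ ≤ (A *ᵥ v) b := Finset.single_le_sum (f := fun j => A b j * v j)
        (fun j _ => mul_nonneg (hA.nonneg b j) (hv0 j)) (Finset.mem_univ a)
    _ = v b := congrFun hv b

-- Apply the nonnegative case to the fixed vector `|v| + v`.
theorem IsCombination.pos_of_fixed (hgrp : IsGrouping T grp wo) (hA : IsCombination T grp A)
    {v : Fin N → ℝ} (hv : A *ᵥ v = v) {k l : Fin N} (hkl : grp k = grp l) (hk : 0 < v k) :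
    0 < v l := by
  have hfix : A *ᵥ (|v| + v) = |v| + v := by
    rw [Matrix.mulVec_add, abs_mulVec_eq_of_mem_colStochastic hA.mem_colStochastic hv, hv]
  have hpos : 0 < |v l| + v l :=
    hA.pos_of_nonneg_fixed hgrp hfix (fun k => neg_le_iff_add_nonneg.mp (neg_le_abs (v k))) hkl
      (add_pos_of_nonneg_of_pos (abs_nonneg (v k)) hk)
  by_contra! hle
  rw [abs_of_nonpos hle] at hpos
  linarith

theorem IsCombination.eq_zero_of_fixed (hgrp : IsGrouping T grp wo) (hA : IsCombination T grp A)
    {v : Fin N → ℝ} (hv : A *ᵥ v = v) (hsum : ∀ m, ∑ k with grp k = m, v k = 0) : v = 0 := by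
  have hnonpos {u : Fin N → ℝ} (hu : A *ᵥ u = u) (hs : ∀ m, ∑ k with grp k = m, u k = 0)
      (k : Fin N) : u k ≤ 0 := by
    by_contra! hpos
    have : 0 < ∑ l with grp l = grp k, u l :=
      Finset.sum_pos (fun l hl => hA.pos_of_fixed hgrp hu (Finset.mem_filter.mp hl).2.symm hpos)
        ⟨k, by simp⟩
    exact this.ne' (hs _)
  refine funext fun k => le_antisymm (hnonpos hv hsum k) (neg_nonpos.mp ?_)
  exact hnonpos (u := -v) (by rw [Matrix.mulVec_neg, hv]) (by simpa using hsum) k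

theorem IsCombination.existsUnique_perron (hgrp : IsGrouping T grp wo)
    (hA : IsCombination T grp A) : ∃! p, IsPerron grp A p := by
  obtain ⟨p, ⟨hfix, hsum⟩, hunique⟩ := existsUnique_fixed_with_sums hgrp.surjective
    hA.sum_grp_mulVec (fun _ hv hs => hA.eq_zero_of_fixed hgrp hv hs) 1
  refine ⟨p, ⟨fun k => ?_, hfix, hsum⟩, fun q hq => hunique q ⟨hq.eigen, hq.sum_one⟩⟩
  obtain ⟨l, hl, hpos⟩ : ∃ l ∈ Finset.univ.filter (fun l => grp l = grp k), 0 < p l :=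
    Finset.exists_lt_of_sum_lt (by simp [hsum])
  exact hA.pos_of_fixed hgrp hfix (Finset.mem_filter.mp hl).2 hpos

end Perron

/-! ### Group averages and deviations -/

section Groups

variable {ι κ E : Type*} [NormedAddCommGroup E]

section Weighted

variable [Fintype ι] {p : ι → ℝ}

/-- The weighted sum of squares `∑_k p_k ‖e_k‖²`. -/
noncomputable def wsq (p : ι → ℝ) (e : ι → E) : ℝ := ∑ k, p k * ‖e k‖ ^ 2

theorem wsq_nonneg (hp : ∀ k, 0 ≤ p k) (e : ι → E) : 0 ≤ wsq p e :=
  Finset.sum_nonneg fun k _ => mul_nonneg (hp k) (sq_nonneg _)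

theorem mul_norm_sq_le_wsq (hp : ∀ k, 0 ≤ p k) (e : ι → E) (k : ι) :
    p k * ‖e k‖ ^ 2 ≤ wsq p e :=
  Finset.single_le_sum (f := fun k => p k * ‖e k‖ ^ 2)
    (fun j _ => mul_nonneg (hp j) (sq_nonneg _)) (Finset.mem_univ k)

theorem wsq_pos (hp : ∀ k, 0 < p k) {e : ι → E} (he : e ≠ 0) : 0 < wsq p e := by
  obtain ⟨k, hk⟩ := Function.ne_iff.mp he
  have : 0 < p k * ‖e k‖ ^ 2 := mul_pos (hp k) (pow_pos (norm_pos_iff.mpr hk) 2)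
  exact this.trans_le (mul_norm_sq_le_wsq (fun k => (hp k).le) e k)

theorem continuous_wsq (p : ι → ℝ) : Continuous (wsq (E := E) p) := by
  unfold wsq
  fun_prop

end Weighted

variable [InnerProductSpace ℝ E]

/-- The vector of a group, handed to each of its agents. -/
def spread (grp : ι → κ) : (κ → E) →ₗ[ℝ] (ι → E) :=
  LinearMap.funLeft ℝ E grp

theorem spread_apply (grp : ι → κ) (x : κ → E) (k : ι) : spread grp x k = x (grp k) := rfl

variable [Fintype ι]

/-- The combination step `(comb A e)_k = ∑_l a_{lk} e_l`. -/
noncomputable def comb (A : Matrix ι ι ℝ) : (ι → E) →ₗ[ℝ] (ι → E) :=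
  LinearMap.pi fun k => ∑ l, A l k • LinearMap.proj l

/-- The group averages with weights `p`. -/
noncomputable def avg [DecidableEq κ] (grp : ι → κ) (p : ι → ℝ) : (ι → E) →ₗ[ℝ] (κ → E) :=
  LinearMap.pi fun m => ∑ k with grp k = m, p k • LinearMap.proj k

/-- The deviation from the group averages. -/
noncomputable def dev [DecidableEq κ] (grp : ι → κ) (p : ι → ℝ) : (ι → E) →ₗ[ℝ] (ι → E) :=
  LinearMap.id - spread grp ∘ₗ avg grp p

/-- The stacked vector `col {√p_k e_k}`, whose squared norm is `wsq p e`. -/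
noncomputable def wcol (p : ι → ℝ) : (ι → E) →L[ℝ] PiLp 2 fun _ : ι => E :=
  (PiLp.continuousLinearEquiv 2 ℝ fun _ : ι => E).symm.toContinuousLinearMap ∘L
    ContinuousLinearMap.pi fun k => √(p k) • ContinuousLinearMap.proj k

section Basic

variable {p : ι → ℝ}

theorem comb_apply (A : Matrix ι ι ℝ) (e : ι → E) (k : ι) : comb A e k = ∑ l, A l k • e l := by
  simp [comb]

theorem norm_wcol_sq (hp : ∀ k, 0 ≤ p k) (e : ι → E) : ‖wcol p e‖ ^ 2 = wsq p e := by
  rw [PiLp.norm_sq_eq_of_L2]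
  refine Finset.sum_congr rfl fun k _ => ?_
  change ‖√(p k) • e k‖ ^ 2 = _
  rw [norm_smul, mul_pow, Real.norm_eq_abs, sq_abs, Real.sq_sqrt (hp k)]

theorem exists_norm_le_mul_norm_wcol [FiniteDimensional ℝ E] (hp : ∀ k, 0 < p k) :
    ∃ K : ℝ, ∀ e : ι → E, ‖e‖ ≤ K * ‖wcol p e‖ := by
  have hker : LinearMap.ker (wcol (E := E) p).toLinearMap = ⊥ := by
    refine LinearMap.ker_eq_bot'.mpr fun e he => ?_
    by_contra hne
    refine (wsq_pos hp hne).ne' ?_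
    rw [← norm_wcol_sq fun k => (hp k).le, ← ContinuousLinearMap.coe_coe, he, norm_zero,
      zero_pow two_ne_zero]
  obtain ⟨K, -, hK⟩ := LinearMap.exists_antilipschitzWith _ hker
  exact ⟨K, fun e => ZeroHomClass.bound_of_antilipschitz (wcol p) hK e⟩

theorem wsq_smul (p : ι → ℝ) (c : ℝ) (e : ι → E) : wsq p (c • e) = c ^ 2 * wsq p e := by
  simp only [wsq, Pi.smul_apply, norm_smul, mul_pow, Finset.mul_sum, Real.norm_eq_abs, sq_abs]
  exact Finset.sum_congr rfl fun k _ => by ring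

variable [DecidableEq κ] {grp : ι → κ}

theorem avg_apply (grp : ι → κ) (p : ι → ℝ) (e : ι → E) (m : κ) :
    avg grp p e m = ∑ k with grp k = m, p k • e k := by
  simp [avg]

theorem dev_eq_sub (grp : ι → κ) (p : ι → ℝ) (e : ι → E) :
    dev grp p e = e - spread grp (avg grp p e) := rfl

theorem spread_avg_add_dev (grp : ι → κ) (p : ι → ℝ) (e : ι → E) :
    spread grp (avg grp p e) + dev grp p e = e :=
  add_sub_cancel _ e

theorem avg_spread (hp : ∀ m, ∑ k with grp k = m, p k = 1) (x : κ → E) :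
    avg grp p (spread grp x) = x := by
  funext m
  rw [avg_apply, Finset.sum_congr rfl (g := fun k => p k • x m) fun k hk => by
    rw [spread_apply, (Finset.mem_filter.mp hk).2], ← Finset.sum_smul, hp, one_smul]

theorem avg_dev (hp : ∀ m, ∑ k with grp k = m, p k = 1) (e : ι → E) :
    avg grp p (dev grp p e) = 0 := by
  rw [dev_eq_sub, map_sub, avg_spread hp, sub_self]

theorem sum_mul_inner_spread [Fintype κ] (x : κ → E) (y : ι → E) :
    ∑ k, p k * inner ℝ (spread grp x k) (y k) = ∑ m, inner ℝ (x m) (avg grp p y m) := by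
  rw [← Finset.sum_fiberwise Finset.univ grp]
  refine Finset.sum_congr rfl fun m _ => ?_
  rw [avg_apply, inner_sum]
  refine Finset.sum_congr rfl fun k hk => ?_
  rw [real_inner_smul_right, spread_apply, (Finset.mem_filter.mp hk).2]

theorem wsq_add (p : ι → ℝ) (x y : ι → E) :
    wsq p (x + y) = wsq p x + 2 * ∑ k, p k * inner ℝ (x k) (y k) + wsq p y := by
  simp only [wsq, Finset.mul_sum, ← Finset.sum_add_distrib]
  refine Finset.sum_congr rfl fun k _ => ?_
  rw [Pi.add_apply, norm_add_sq_real]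
  ring

theorem wsq_add_le (hp : ∀ k, 0 ≤ p k) (x y : ι → E) {t : ℝ} (ht : 0 < t) :
    wsq p (x + y) ≤ (1 + t) * wsq p x + (1 + t⁻¹) * wsq p y := by
  have hsq : wsq p (t • x + -y) =
      t ^ 2 * wsq p x - 2 * t * ∑ k, p k * inner ℝ (x k) (y k) + wsq p y := by
    rw [wsq_add, wsq_smul, ← neg_one_smul ℝ y, wsq_smul]
    simp only [Pi.smul_apply, real_inner_smul_left, real_inner_smul_right, Finset.mul_sum]
    rw [sub_eq_add_neg, ← Finset.sum_neg_distrib]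
    congr 2
    · exact Finset.sum_congr rfl fun k _ => by ring
    · ring
  have hyoung := mul_nonneg (inv_nonneg.mpr ht.le) ((wsq_nonneg hp _).trans_eq hsq)
  have hcancel : t⁻¹ * (t ^ 2 * wsq p x - 2 * t * ∑ k, p k * inner ℝ (x k) (y k) + wsq p y) =
      t * wsq p x - 2 * ∑ k, p k * inner ℝ (x k) (y k) + t⁻¹ * wsq p y := by
    field_simp
  rw [wsq_add]
  linarith

theorem wsq_spread [Fintype κ] (p : ι → ℝ) (x : κ → E) :
    wsq p (spread grp x) = ∑ m, (∑ k with grp k = m, p k) * ‖x m‖ ^ 2 := by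
  rw [wsq, ← Finset.sum_fiberwise Finset.univ grp]
  refine Finset.sum_congr rfl fun m _ => ?_
  rw [Finset.sum_mul]
  refine Finset.sum_congr rfl fun k hk => ?_
  rw [spread_apply, (Finset.mem_filter.mp hk).2]

theorem wsq_eq_sum_avg_add_wsq_dev [Fintype κ] (hp : ∀ m, ∑ k with grp k = m, p k = 1)
    (e : ι → E) : wsq p e = ∑ m, ‖avg grp p e m‖ ^ 2 + wsq p (dev grp p e) := by
  have horth : ∑ k, p k * inner ℝ (spread grp (avg grp p e) k) (dev grp p e k) = 0 := by
    simp [sum_mul_inner_spread, avg_dev hp]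
  conv_lhs => rw [← spread_avg_add_dev grp p e]
  simp only [wsq_add, horth, wsq_spread, hp, one_mul, mul_zero, add_zero]

end Basic

section Contraction

variable {A : Matrix ι ι ℝ} {p : ι → ℝ}

theorem wsq_sub_wsq_comb (hA : ∀ k, ∑ l, A l k = 1) (hp : A *ᵥ p = p) (e : ι → E) :
    wsq p e - wsq p (comb A e) = ∑ k, p k * ∑ l, A l k * ‖e l - comb A e k‖ ^ 2 := by
  have hinvariant : wsq p e = ∑ k, p k * ∑ l, A l k * ‖e l‖ ^ 2 := by
    simp only [wsq, Finset.mul_sum]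
    rw [Finset.sum_comm]
    refine Finset.sum_congr rfl fun l _ => ?_
    conv_lhs => rw [← hp]
    simp only [Matrix.mulVec, dotProduct, Finset.sum_mul]
    exact Finset.sum_congr rfl fun k _ => by ring
  have hvariance (k : ι) : ∑ l, A l k * ‖e l - comb A e k‖ ^ 2 =
      ∑ l, A l k * ‖e l‖ ^ 2 - ‖comb A e k‖ ^ 2 := by
    have hexpand : ∑ l, A l k * ‖e l - comb A e k‖ ^ 2 = ∑ l, A l k * ‖e l‖ ^ 2
        - 2 * inner ℝ (∑ l, A l k • e l) (comb A e k) + (∑ l, A l k) * ‖comb A e k‖ ^ 2 := by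
      rw [sum_inner, Finset.mul_sum, Finset.sum_mul, ← Finset.sum_sub_distrib,
        ← Finset.sum_add_distrib]
      refine Finset.sum_congr rfl fun l _ => ?_
      rw [norm_sub_sq_real, real_inner_smul_left]
      ring
    rw [hexpand, ← comb_apply, hA, real_inner_self_eq_norm_sq]
    ring
  simp only [hvariance, hinvariant, mul_sub, Finset.sum_sub_distrib]
  rfl

theorem exists_le_one_sub_mul_of_lt {V : Type*} [NormedAddCommGroup V] [NormedSpace ℝ V]
    [FiniteDimensional ℝ V] {f g : V → ℝ} (hf : Continuous f) (hg : Continuous g)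
    (hf2 : ∀ (c : ℝ) x, f (c • x) = c ^ 2 * f x) (hg2 : ∀ (c : ℝ) x, g (c • x) = c ^ 2 * g x)
    (hg0 : ∀ x ≠ 0, 0 < g x) (hlt : ∀ x ≠ 0, f x < g x) :
    ∃ c : ℝ, 0 < c ∧ c < 1 ∧ ∀ x, f x ≤ (1 - c) * g x := by
  have hne {x : V} (hx : x ∈ Metric.sphere (0 : V) 1) : x ≠ 0 :=
    Metric.ne_of_mem_sphere hx one_ne_zero
  obtain ⟨c, hc, hbound⟩ := (isCompact_sphere (0 : V) 1).exists_forall_le' (a := 0)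
    (f := fun x => 1 - f x / g x)
    (continuousOn_const.sub (hf.continuousOn.div hg.continuousOn fun x hx => (hg0 x (hne hx)).ne'))
    fun x hx => sub_pos.mpr ((div_lt_one (hg0 x (hne hx))).mpr (hlt x (hne hx)))
  refine ⟨min c (1 / 2), lt_min hc one_half_pos, (min_le_right _ _).trans_lt one_half_lt_one,
    fun x => ?_⟩
  rcases eq_or_ne x 0 with rfl | hx
  · simpa [hf2 0 0, hg2 0 0] using (show f 0 = (1 - min c (1 / 2)) * g 0 by
      rw [← zero_smul ℝ (0 : V), hf2, hg2]; ring).le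
  · have hunit : ‖x‖⁻¹ • x ∈ Metric.sphere (0 : V) 1 := by
      simpa using norm_smul_inv_norm (𝕜 := ℝ) hx
    have h := hbound _ hunit
    rw [hf2, hg2, mul_div_mul_left _ _ (by positivity), le_sub_comm, div_le_iff₀ (hg0 x hx)] at h
    exact h.trans (mul_le_mul_of_nonneg_right (by linarith [min_le_left c (1 / 2)]) (hg0 x hx).le)

end Contraction

section Network

variable {N G M : ℕ} {T : SimpleGraph (Fin N)} {grp : Fin N → Fin G}
  {A : Matrix (Fin N) (Fin N) ℝ} {wo : Fin N → Vec M} {p : Fin N → ℝ}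

theorem IsPerron.sum_grp (hA : IsCombination T grp A) (hp : IsPerron grp A p) (m : Fin G)
    (l : Fin N) : ∑ k with grp k = m, p k * A l k = if grp l = m then p l else 0 := by
  split_ifs with h
  · rw [← congrFun hp.eigen l, Matrix.mulVec, dotProduct, Finset.sum_filter]
    refine Finset.sum_congr rfl fun k _ => ?_
    split_ifs with hk
    · exact mul_comm _ _
    · rw [hA.eq_zero_of_grp_ne fun h' => hk (h'.symm.trans h), zero_mul]
  · refine Finset.sum_eq_zero fun k hk => ?_
    rw [hA.eq_zero_of_grp_ne fun h' => h (h'.trans (Finset.mem_filter.mp hk).2), mul_zero]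

theorem IsPerron.avg_comb (hA : IsCombination T grp A) (hp : IsPerron grp A p)
    (e : Fin N → E) : avg grp p (comb A e) = avg grp p e := by
  funext m
  simp only [avg_apply, comb_apply, Finset.smul_sum, smul_smul]
  rw [Finset.sum_comm]
  simp only [← Finset.sum_smul, hp.sum_grp hA, ite_smul, zero_smul, Finset.sum_filter]

theorem IsCombination.comb_spread (hA : IsCombination T grp A) (x : Fin G → E) :
    comb A (spread grp x) = spread grp x := by
  funext k
  rw [comb_apply, spread_apply, ← one_smul ℝ (x (grp k)), ← hA.sum_one k, Finset.sum_smul]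
  refine Finset.sum_congr rfl fun l _ => ?_
  by_cases h : grp l = grp k
  · rw [spread_apply, h]
  · rw [hA.eq_zero_of_grp_ne h, zero_smul, zero_smul]

theorem IsPerron.dev_comb (hA : IsCombination T grp A) (hp : IsPerron grp A p)
    (e : Fin N → E) : dev grp p (comb A e) = comb A (dev grp p e) := by
  rw [dev_eq_sub, dev_eq_sub, hp.avg_comb hA, map_sub, hA.comb_spread]

theorem IsPerron.wsq_comb_le (hA : IsCombination T grp A) (hp : IsPerron grp A p)
    (e : Fin N → E) : wsq p (comb A e) ≤ wsq p e := by
  rw [← sub_nonneg, wsq_sub_wsq_comb hA.sum_one hp.eigen]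
  exact Finset.sum_nonneg fun k _ => mul_nonneg (hp.pos k).le
    (Finset.sum_nonneg fun l _ => mul_nonneg (hA.nonneg l k) (sq_nonneg _))

theorem IsPerron.wsq_dev_le (hp : IsPerron grp A p) (e : Fin N → E) :
    wsq p (dev grp p e) ≤ wsq p e := by
  rw [wsq_eq_sum_avg_add_wsq_dev hp.sum_one e]
  exact le_add_of_nonneg_left (Finset.sum_nonneg fun m _ => sq_nonneg _)

theorem IsPerron.eq_comb_of_wsq_comb_eq (hA : IsCombination T grp A) (hp : IsPerron grp A p)
    {y : Fin N → E} (h : wsq p (comb A y) = wsq p y) {l k : Fin N} (hlk : 0 < A l k) :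
    y l = comb A y k := by
  have hterm (k l : Fin N) : 0 ≤ A l k * ‖y l - comb A y k‖ ^ 2 :=
    mul_nonneg (hA.nonneg l k) (sq_nonneg _)
  have hsum := wsq_sub_wsq_comb hA.sum_one hp.eigen y
  rw [h, sub_self, eq_comm, Finset.sum_eq_zero_iff_of_nonneg fun k _ =>
    mul_nonneg (hp.pos k).le (Finset.sum_nonneg fun l _ => hterm k l)] at hsum
  have hinner := (mul_eq_zero.mp (hsum k (Finset.mem_univ k))).resolve_left (hp.pos k).ne'
  rw [Finset.sum_eq_zero_iff_of_nonneg fun l _ => hterm k l] at hinner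
  have hsq := (mul_eq_zero.mp (hinner l (Finset.mem_univ l))).resolve_left hlk.ne'
  rwa [sq_eq_zero_iff, norm_eq_zero, sub_eq_zero] at hsq

theorem IsPerron.eq_zero_of_wsq_comb_eq (hgrp : IsGrouping T grp wo) (hA : IsCombination T grp A)
    (hp : IsPerron grp A p) {y : Fin N → E} (hy : avg grp p y = 0)
    (h : wsq p (comb A y) = wsq p y) : y = 0 := by
  funext k
  have hconst {l : Fin N} (hl : grp l = grp k) : y l = y k :=
    hgrp.propagate (f := fun l => y l = y k) (fun a b hab hg ha => by
      rw [← ha, hp.eq_comb_of_wsq_comb_eq hA h (hA.pos a a ⟨Or.inl rfl, rfl⟩)]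
      exact hp.eq_comb_of_wsq_comb_eq hA h (hA.pos b a ⟨Or.inr hab.symm, hg.symm⟩)) hl.symm rfl
  have havg := congrFun hy (grp k)
  rwa [avg_apply, Finset.sum_congr rfl (g := fun l => p l • y k) fun l hl => by
    rw [hconst (Finset.mem_filter.mp hl).2], ← Finset.sum_smul, hp.sum_one, one_smul] at havg

theorem IsPerron.exists_contraction [FiniteDimensional ℝ E] (hgrp : IsGrouping T grp wo)
    (hA : IsCombination T grp A) (hp : IsPerron grp A p) :
    ∃ c : ℝ, 0 < c ∧ c < 1 ∧ ∀ e : Fin N → E,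
      wsq p (dev grp p (comb A e)) ≤ (1 - c) * wsq p (dev grp p e) := by
  let K := LinearMap.ker (avg grp p : (Fin N → E) →ₗ[ℝ] (Fin G → E))
  obtain ⟨c, hc0, hc1, hc⟩ := exists_le_one_sub_mul_of_lt (V := K)
    (f := fun y => wsq p (comb A y.1)) (g := fun y => wsq p y.1)
    ((continuous_wsq p).comp
      (((comb A).continuous_of_finiteDimensional (E := Fin N → E)).comp continuous_subtype_val))
    ((continuous_wsq p).comp continuous_subtype_val)
    (fun c y => by rw [Submodule.coe_smul, map_smul, wsq_smul])
    (fun c y => by rw [Submodule.coe_smul, wsq_smul])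
    (fun y hy => wsq_pos hp.pos (Subtype.coe_ne_coe.mpr hy))
    fun y hy => (hp.wsq_comb_le hA y.1).lt_of_ne fun h =>
      hy (Subtype.ext (hp.eq_zero_of_wsq_comb_eq hgrp hA y.2 h))
  refine ⟨c, hc0, hc1, fun e => ?_⟩
  rw [hp.dev_comb hA]
  exact hc ⟨dev grp p e, avg_dev hp.sum_one e⟩

theorem IsPerron.wsq_comb_le_sub (hA : IsCombination T grp A) (hp : IsPerron grp A p) {c : ℝ}
    {e : Fin N → E} (hc : wsq p (dev grp p (comb A e)) ≤ (1 - c) * wsq p (dev grp p e)) :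
    wsq p (comb A e) ≤ wsq p e - c * wsq p (dev grp p e) := by
  rw [wsq_eq_sum_avg_add_wsq_dev hp.sum_one (comb A e), hp.avg_comb hA,
    wsq_eq_sum_avg_add_wsq_dev hp.sum_one e]
  linarith

end Network

end Groups

/-! ### Stacked vectors and costs -/

section Stacking

variable {N M : ℕ}

/-- Stacking as a linear homeomorphism from the agents' vectors (with the supremum over the
agents as norm) to Euclidean space. -/
noncomputable def colEquiv (N M : ℕ) :
    (Fin N → Vec M) ≃L[ℝ] EuclideanSpace ℝ (Fin N × Fin M) :=
  LinearEquiv.toContinuousLinearEquiv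
    { toFun := col
      map_add' := fun _ _ => rfl
      map_smul' := fun _ _ => rfl
      invFun := fun x k => WithLp.toLp 2 fun a => x (k, a)
      left_inv := fun _ => rfl
      right_inv := fun _ => rfl }

theorem colEquiv_apply (w : Fin N → Vec M) : colEquiv N M w = col w := rfl

theorem norm_col_sq (w : Fin N → Vec M) : ‖col w‖ ^ 2 = ∑ k, ‖w k‖ ^ 2 := by
  simp only [EuclideanSpace.norm_sq_eq, Fintype.sum_prod_type]
  rfl

theorem norm_apply_le_norm_col (w : Fin N → Vec M) (k : Fin N) : ‖w k‖ ≤ ‖col w‖ := by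
  refine (sq_le_sq₀ (norm_nonneg _) (norm_nonneg _)).mp ?_
  rw [norm_col_sq]
  exact Finset.single_le_sum (f := fun k => ‖w k‖ ^ 2) (fun _ _ => sq_nonneg _)
    (Finset.mem_univ k)

theorem norm_col_single (k : Fin N) (u : Vec M) : ‖col (Pi.single k u)‖ = ‖u‖ := by
  refine (sq_eq_sq₀ (norm_nonneg _) (norm_nonneg _)).mp ?_
  rw [norm_col_sq, Finset.sum_eq_single k (fun l _ hl => by simp [Pi.single_eq_of_ne hl])
    (by simp), Pi.single_eq_same]

end Stacking

section Hessian

variable {N M : ℕ} {f : Vec M → ℝ} {w : Vec M}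

theorem gradient_apply (f : Vec M → ℝ) (w : Vec M) (a : Fin M) :
    gradient f w a = fderiv ℝ f w (EuclideanSpace.single a 1) := by
  rw [← toDual_gradient, InnerProductSpace.toDual_apply_apply, EuclideanSpace.inner_single_right]
  simp

theorem hasFDerivAt_gradient (hf : DifferentiableAt ℝ (fderiv ℝ f) w)
    (hsymm : (hessian f w).IsHermitian) :
    HasFDerivAt (gradient f) (Matrix.toEuclideanCLM (𝕜 := ℝ) (hessian f w)) w := by
  rw [← hasFDerivWithinAt_univ, hasFDerivWithinAt_euclidean]
  intro a
  rw [hasFDerivWithinAt_univ]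
  have hcoord : (fun x => gradient f x a) =
      fun x => fderiv ℝ f x (EuclideanSpace.single a 1) := funext fun x => gradient_apply f x a
  rw [hcoord]
  refine (hf.hasFDerivAt.clm_apply (hasFDerivAt_const _ w)).congr_fderiv ?_
  ext v
  have hv : v = ∑ b, v b • EuclideanSpace.single b (1 : ℝ) := by
    ext b
    simp [Pi.single_apply]
  have hswap (b : Fin M) : fderiv ℝ (fderiv ℝ f) w (EuclideanSpace.single b 1)
      (EuclideanSpace.single a 1) = hessian f w a b := hsymm.apply a b
  conv_lhs => rw [hv]
  simp [toEuclideanCLM_apply, Matrix.mulVec, dotProduct, hswap, mul_comm]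

theorem toEuclideanCLM_netHessian_apply (J : Fin N → Vec M → ℝ) (w u : Fin N → Vec M)
    (k : Fin N) (a : Fin M) :
    Matrix.toEuclideanCLM (𝕜 := ℝ) (netHessian J w) (col u) (k, a) =
      Matrix.toEuclideanCLM (𝕜 := ℝ) (hessian (J k) (w k)) (u k) a := by
  simp [toEuclideanCLM_apply, Matrix.mulVec, dotProduct, netHessian, Fintype.sum_prod_type, col,
    Finset.sum_ite_irrel, ite_mul]

theorem norm_hessian_sub_le (J : Fin N → Vec M → ℝ) (w w' : Fin N → Vec M) (k : Fin N) :
    ‖hessian (J k) (w k) - hessian (J k) (w' k)‖ ≤ ‖netHessian J w - netHessian J w'‖ := by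
  rw [← Matrix.l2_opNorm_toEuclideanCLM]
  refine ContinuousLinearMap.opNorm_le_bound _ (norm_nonneg _) fun v => ?_
  rw [← norm_col_single k v, ← Matrix.l2_opNorm_toEuclideanCLM (netHessian J w - _)]
  refine le_trans ?_ (ContinuousLinearMap.le_opNorm _ _)
  set y := (colEquiv N M).symm
    (Matrix.toEuclideanCLM (𝕜 := ℝ) (netHessian J w - netHessian J w') (col (Pi.single k v)))
  have hblock : Matrix.toEuclideanCLM (𝕜 := ℝ)
      (hessian (J k) (w k) - hessian (J k) (w' k)) v = y k := by
    ext a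
    change _ = Matrix.toEuclideanCLM (𝕜 := ℝ) (netHessian J w - netHessian J w') _ (k, a)
    simp [toEuclideanCLM_netHessian_apply, map_sub]
  rw [hblock, ← (colEquiv N M).apply_symm_apply (Matrix.toEuclideanCLM (𝕜 := ℝ) _ _)]
  exact norm_apply_le_norm_col y k

end Hessian

section Cost

variable {N G M : ℕ} {grp : Fin N → Fin G} {J : Fin N → Vec M → ℝ} {wo : Fin N → Vec M}
  {lamL lamU : Fin N → ℝ} {κH : ℝ}

theorem CostCondition.lamU_nonneg (hJ : CostCondition grp J wo lamL lamU κH) (k : Fin N) :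
    0 ≤ lamU k :=
  (hJ.lamL_nonneg k).trans (hJ.lamL_le_lamU k)

theorem CostCondition.norm_hessian_sub_le (hJ : CostCondition grp J wo lamL lamU κH) (k : Fin N)
    (w w' : Vec M) : ‖hessian (J k) w - hessian (J k) w'‖ ≤ κH * ‖w - w'‖ := by
  have hblock := DiffusionNet.norm_hessian_sub_le J (Pi.single k w) (Pi.single k w') k
  have hnet := hJ.hessian_lipschitz (Pi.single k w) (Pi.single k w')
  rw [← colEquiv_apply, ← colEquiv_apply, ← map_sub, ← Pi.single_sub, colEquiv_apply,
    norm_col_single] at hnet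
  simpa only [Pi.single_eq_same] using hblock.trans hnet

theorem CostCondition.hessian_posSemidef (hJ : CostCondition grp J wo lamL lamU κH) (k : Fin N)
    (w : Vec M) : (hessian (J k) w).PosSemidef := by
  have h := (hJ.hessian_lower k w).add (Matrix.PosSemidef.one.smul (hJ.lamL_nonneg k))
  rwa [sub_add_cancel] at h

theorem CostCondition.norm_hessian_le (hJ : CostCondition grp J wo lamL lamU κH) (k : Fin N)
    (w : Vec M) : ‖hessian (J k) w‖ ≤ lamU k :=
  norm_le_of_posSemidef (hJ.lamU_nonneg k) (hJ.hessian_posSemidef k w) (hJ.hessian_upper k w)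

theorem CostCondition.hasFDerivAt_gradient (hJ : CostCondition grp J wo lamL lamU κH)
    (k : Fin N) (w : Vec M) :
    HasFDerivAt (gradient (J k)) (Matrix.toEuclideanCLM (𝕜 := ℝ) (hessian (J k) w)) w :=
  DiffusionNet.hasFDerivAt_gradient (hJ.differentiable_fderiv k w)
    (hJ.hessian_posSemidef k w).isHermitian

theorem CostCondition.continuous_gradient (hJ : CostCondition grp J wo lamL lamU κH)
    (k : Fin N) : Continuous (gradient (J k)) :=
  continuous_iff_continuousAt.mpr fun w => (hJ.hasFDerivAt_gradient k w).continuousAt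

theorem CostCondition.gradient_wo (hJ : CostCondition grp J wo lamL lamU κH) (k : Fin N) :
    gradient (J k) (wo k) = 0 := by
  have h : fderiv ℝ (J k) (wo k) = 0 :=
    IsLocalMin.fderiv_eq_zero ((hJ.minimizer k).isLocalMin Filter.univ_mem)
  rw [gradient, h, map_zero]

theorem CostCondition.norm_gradient_le (hJ : CostCondition grp J wo lamL lamU κH) (k : Fin N)
    (e : Vec M) : ‖gradient (J k) (wo k - e)‖ ≤ lamU k * ‖e‖ := by
  have h := convex_univ.norm_image_sub_le_of_norm_hasFDerivWithin_le (x := wo k) (y := wo k - e)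
    (fun w _ => (hJ.hasFDerivAt_gradient k w).hasFDerivWithinAt)
    (fun w _ => (Matrix.l2_opNorm_toEuclideanCLM _).trans_le (hJ.norm_hessian_le k w))
    (Set.mem_univ _) (Set.mem_univ _)
  rwa [hJ.gradient_wo, sub_zero, sub_sub_cancel_left, norm_neg] at h

theorem CostCondition.norm_gradient_add_hessian_le
    (hJ : CostCondition grp J wo lamL lamU κH) (k : Fin N) (e : Vec M) :
    ‖gradient (J k) (wo k - e) + Matrix.toEuclideanCLM (𝕜 := ℝ) (hessian (J k) (wo k)) e‖
      ≤ κH * ‖e‖ ^ 2 := by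
  have h := (convex_closedBall (wo k) ‖e‖).norm_image_sub_le_of_norm_hasFDerivWithin_le'
    (φ := Matrix.toEuclideanCLM (𝕜 := ℝ) (hessian (J k) (wo k))) (C := κH * ‖e‖)
    (x := wo k) (y := wo k - e)
    (fun w _ => (hJ.hasFDerivAt_gradient k w).hasFDerivWithinAt) (fun w hw => by
      rw [← map_sub, Matrix.l2_opNorm_toEuclideanCLM]
      exact (hJ.norm_hessian_sub_le k w (wo k)).trans
        (mul_le_mul_of_nonneg_left (mem_closedBall_iff_norm.mp hw) hJ.κH_nonneg))
    (by simp) (by simp)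
  rwa [hJ.gradient_wo, sub_zero, sub_sub_cancel_left, map_neg, sub_neg_eq_add, norm_neg, mul_assoc,
    ← sq] at h

theorem CostCondition.inner_gradient_le (hJ : CostCondition grp J wo lamL lamU κH) (k : Fin N)
    (e : Vec M) : inner ℝ e (gradient (J k) (wo k - e)) ≤ -(lamL k * ‖e‖ ^ 2) := by
  have hderiv (t : ℝ) : HasDerivAt (fun t : ℝ => inner ℝ e (gradient (J k) (wo k - t • e)))
      (-inner ℝ e (Matrix.toEuclideanCLM (𝕜 := ℝ) (hessian (J k) (wo k - t • e)) e)) t := by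
    have hline : HasDerivAt (fun t : ℝ => wo k - t • e) (-e) t := by
      simpa using ((hasDerivAt_id t).smul_const e).const_sub (wo k)
    have h := (innerSL ℝ e).hasFDerivAt.comp_hasDerivAt t
      ((hJ.hasFDerivAt_gradient k _).comp_hasDerivAt t hline)
    rwa [map_neg, map_neg] at h
  have hle (t : ℝ) : -inner ℝ e (Matrix.toEuclideanCLM (𝕜 := ℝ)
      (hessian (J k) (wo k - t • e)) e) ≤ -(lamL k * ‖e‖ ^ 2) := by
    have h := inner_toEuclideanCLM_nonneg (hJ.hessian_lower k (wo k - t • e)) e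
    rw [← neg_sub, map_neg, neg_apply, inner_neg_right, inner_toEuclideanCLM_smul_one_sub] at h
    linarith
  have h := image_sub_le_mul_sub_of_deriv_le (fun t => (hderiv t).differentiableAt)
    (fun t => (hderiv t).deriv.trans_le (hle t)) zero_le_one
  simpa [hJ.gradient_wo] using h

end Cost

/-! ### One step of the noise-free iteration -/

section Step

variable {N G M : ℕ} {T : SimpleGraph (Fin N)} {grp : Fin N → Fin G}
  {A : Matrix (Fin N) (Fin N) ℝ} {J : Fin N → Vec M → ℝ} {wo : Fin N → Vec M}
  {lamL lamU : Fin N → ℝ} {κH : ℝ} {τ p : Fin N → ℝ}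

/-- The direction of the noiseless adaptation step: without noise it changes the agents' errors
`e = w° - w` into `e + μ • drift J wo τ e`. -/
noncomputable def drift (J : Fin N → Vec M → ℝ) (wo : Fin N → Vec M) (τ : Fin N → ℝ)
    (e : Fin N → Vec M) : Fin N → Vec M :=
  fun k => τ k • gradient (J k) (wo k - e k)

theorem CostCondition.continuous_drift (hJ : CostCondition grp J wo lamL lamU κH)
    (τ : Fin N → ℝ) : Continuous (drift J wo τ) := by
  refine continuous_pi fun k => ?_
  have hk := hJ.continuous_gradient k
  unfold drift
  fun_prop

theorem CostCondition.norm_drift_apply_le (hJ : CostCondition grp J wo lamL lamU κH)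
    (hτ : IsStepProfile τ) (e : Fin N → Vec M) (k : Fin N) :
    ‖drift J wo τ e k‖ ≤ (∑ l, lamU l) * ‖e k‖ := by
  have hsum : lamU k ≤ ∑ l, lamU l :=
    Finset.single_le_sum (fun l _ => hJ.lamU_nonneg l) (Finset.mem_univ k)
  calc ‖drift J wo τ e k‖ = τ k * ‖gradient (J k) (wo k - e k)‖ := by
        rw [drift, norm_smul, Real.norm_of_nonneg (hτ.pos k).le]
    _ ≤ 1 * (lamU k * ‖e k‖) := by
        gcongr
        · exact hτ.le_one k
        · exact hJ.norm_gradient_le k (e k)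
    _ ≤ (∑ l, lamU l) * ‖e k‖ := by
        rw [one_mul]
        gcongr

theorem CostCondition.wsq_drift_le (hJ : CostCondition grp J wo lamL lamU κH)
    (hτ : IsStepProfile τ) (hp : ∀ k, 0 ≤ p k) (e : Fin N → Vec M) :
    wsq p (drift J wo τ e) ≤ (∑ l, lamU l) ^ 2 * wsq p e := by
  rw [wsq, wsq, Finset.mul_sum]
  refine Finset.sum_le_sum fun k _ => ?_
  rw [mul_left_comm, ← mul_pow]
  exact mul_le_mul_of_nonneg_left
    (pow_le_pow_left₀ (norm_nonneg _) (hJ.norm_drift_apply_le hτ e k) 2) (hp k)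

theorem CostCondition.exists_le_sum_lamL (hJ : CostCondition grp J wo lamL lamU κH)
    (hτ : IsStepProfile τ) (hp : ∀ k, 0 < p k) :
    ∃ lam : ℝ, 0 < lam ∧ ∀ m, lam ≤ ∑ k with grp k = m, p k * τ k * lamL k := by
  have hpos (m : Fin G) : 0 < ∑ k with grp k = m, p k * τ k * lamL k := by
    obtain ⟨k, hk, hlam⟩ := hJ.strong m
    exact Finset.sum_pos' (fun k _ => mul_nonneg (mul_pos (hp k) (hτ.pos k)).le
      (hJ.lamL_nonneg k)) ⟨k, by simpa using hk, mul_pos (mul_pos (hp k) (hτ.pos k)) hlam⟩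
  obtain ⟨lam, hlam, hle⟩ := (isCompact_univ (X := Fin G)).exists_forall_le'
    continuous_of_discreteTopology.continuousOn fun m _ => hpos m
  exact ⟨lam, hlam, fun m => hle m (Set.mem_univ m)⟩

theorem CostCondition.exists_inner_drift_le (hJ : CostCondition grp J wo lamL lamU κH)
    (hτ : IsStepProfile τ) (hp : ∀ k, 0 < p k) :
    ∃ lam : ℝ, 0 < lam ∧ ∀ e : Fin N → Vec M,
      ∑ k, p k * inner ℝ (e k) (drift J wo τ e k) ≤
        (∑ l, lamU l) * wsq p (dev grp p e) - lam * ∑ m, ‖avg grp p e m‖ ^ 2 := by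
  obtain ⟨lam, hlam, hle⟩ := hJ.exists_le_sum_lamL hτ hp
  refine ⟨lam / 2, half_pos hlam, fun e => ?_⟩
  let β : Fin N → ℝ := fun k => p k * τ k * lamL k
  have hβ (k : Fin N) : 0 ≤ β k := mul_nonneg (mul_pos (hp k) (hτ.pos k)).le (hJ.lamL_nonneg k)
  have hmono : ∑ k, p k * inner ℝ (e k) (drift J wo τ e k) ≤ -wsq β e := by
    rw [wsq, ← Finset.sum_neg_distrib]
    refine Finset.sum_le_sum fun k _ => ?_
    have hk := mul_le_mul_of_nonneg_left (hJ.inner_gradient_le k (e k))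
      (mul_pos (hp k) (hτ.pos k)).le
    rw [drift, real_inner_smul_right]
    linarith
  have havg : lam * ∑ m, ‖avg grp p e m‖ ^ 2 ≤ wsq β (spread grp (avg grp p e)) := by
    rw [wsq_spread, Finset.mul_sum]
    exact Finset.sum_le_sum fun m _ => mul_le_mul_of_nonneg_right (hle m) (sq_nonneg _)
  have hsplit : wsq β (spread grp (avg grp p e)) ≤ 2 * wsq β e + 2 * wsq β (dev grp p e) := by
    have h := wsq_add_le hβ e ((-1 : ℝ) • dev grp p e) one_pos
    rwa [wsq_smul, neg_one_smul, ← sub_eq_add_neg, dev_eq_sub, sub_sub_cancel, ← dev_eq_sub,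
      neg_one_sq, one_mul, inv_one, one_add_one_eq_two] at h
  have hdev : wsq β (dev grp p e) ≤ (∑ l, lamU l) * wsq p (dev grp p e) := by
    rw [wsq, wsq, Finset.mul_sum]
    refine Finset.sum_le_sum fun k _ => ?_
    have hk : τ k * lamL k ≤ ∑ l, lamU l := calc
      τ k * lamL k ≤ 1 * lamU k :=
        mul_le_mul (hτ.le_one k) (hJ.lamL_le_lamU k) (hJ.lamL_nonneg k) zero_le_one
      _ ≤ ∑ l, lamU l := by
        rw [one_mul]
        exact Finset.single_le_sum (fun l _ => hJ.lamU_nonneg l) (Finset.mem_univ k)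
    calc p k * τ k * lamL k * ‖dev grp p e k‖ ^ 2
        = τ k * lamL k * (p k * ‖dev grp p e k‖ ^ 2) := by ring
      _ ≤ _ := mul_le_mul_of_nonneg_right hk (mul_nonneg (hp k).le (sq_nonneg _))
  linarith

theorem IsPerron.wsq_comb_add_smul_le (hA : IsCombination T grp A) (hp : IsPerron grp A p)
    {c lam Λ μ : ℝ} (hc0 : 0 ≤ c) (hc1 : c ≤ 1)
    (hc : ∀ e : Fin N → Vec M,
      wsq p (dev grp p (comb A e)) ≤ (1 - c) * wsq p (dev grp p e))
    (hμ : 0 ≤ μ) (hμc : μ * (2 * Λ + 2 * lam) ≤ c / 2) (hμΛ : 2 * μ * Λ ^ 2 ≤ lam)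
    {e d : Fin N → Vec M} (hd : wsq p d ≤ Λ ^ 2 * wsq p e)
    (hed : ∑ k, p k * inner ℝ (e k) (d k) ≤
      Λ * wsq p (dev grp p e) - lam * ∑ m, ‖avg grp p e m‖ ^ 2) :
    wsq p (comb A (e + μ • d)) ≤ (1 - lam * μ) * wsq p e := by
  have hp0 (k : Fin N) : 0 ≤ p k := (hp.pos k).le
  set X := ∑ m, ‖avg grp p e m‖ ^ 2
  set Y := wsq p (dev grp p e)
  have hY : 0 ≤ Y := wsq_nonneg hp0 _
  have hd0 : 0 ≤ wsq p d := wsq_nonneg hp0 _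
  have hsum : wsq p e = X + Y := wsq_eq_sum_avg_add_wsq_dev hp.sum_one e
  have hcontract := hp.wsq_comb_le_sub hA (hc (e + μ • d))
  have hexpand : wsq p (e + μ • d) =
      wsq p e + 2 * (μ * ∑ k, p k * inner ℝ (e k) (d k)) + μ ^ 2 * wsq p d := by
    rw [wsq_add, wsq_smul]
    simp only [Pi.smul_apply, real_inner_smul_right, Finset.mul_sum, mul_left_comm _ μ]
  have hdev : Y ≤ 2 * wsq p (dev grp p (e + μ • d)) + 2 * (μ ^ 2 * wsq p d) := by
    have h := wsq_add_le hp0 (dev grp p (e + μ • d)) ((-μ) • dev grp p d) one_pos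
    rw [wsq_smul, map_add, map_smul, neg_smul, add_neg_cancel_right, inv_one,
      one_add_one_eq_two, neg_sq] at h
    rw [map_add, map_smul]
    nlinarith [mul_le_mul_of_nonneg_left (hp.wsq_dev_le d) (sq_nonneg μ)]
  have hdrift := mul_le_mul_of_nonneg_left hed hμ
  have hquad : 2 * (μ ^ 2 * wsq p d) ≤ μ * lam * (X + Y) := calc
    2 * (μ ^ 2 * wsq p d) ≤ 2 * (μ ^ 2 * (Λ ^ 2 * (X + Y))) := by
      rw [← hsum]
      gcongr
    _ = μ * (2 * μ * Λ ^ 2 * (X + Y)) := by ring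
    _ ≤ μ * (lam * (X + Y)) := by gcongr
    _ = μ * lam * (X + Y) := by ring
  have hdevc : c / 2 * Y ≤ c * wsq p (dev grp p (e + μ • d)) + μ ^ 2 * wsq p d := by
    nlinarith [mul_le_mul_of_nonneg_left hdev hc0,
      mul_le_mul_of_nonneg_right hc1 (mul_nonneg (sq_nonneg μ) hd0)]
  have hrate := mul_le_mul_of_nonneg_right hμc hY
  rw [hsum] at hexpand ⊢
  linarith

theorem exists_wsq_step_le (hgrp : IsGrouping T grp wo) (hA : IsCombination T grp A)
    (hJ : CostCondition grp J wo lamL lamU κH) (hτ : IsStepProfile τ) (hp : IsPerron grp A p) :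
    ∃ c : ℝ, 0 < c ∧ ∀ᶠ μ in 𝓝[>] (0 : ℝ), ∀ e : Fin N → Vec M,
      wsq p (comb A (e + μ • drift J wo τ e)) ≤ (1 - c * μ) * wsq p e := by
  obtain ⟨c, hc0, hc1, hc⟩ := hp.exists_contraction (E := Vec M) hgrp hA
  obtain ⟨lam, hlam, hdrift⟩ := hJ.exists_inner_drift_le hτ hp.pos
  set Λ := ∑ l, lamU l
  have hμc : ∀ᶠ μ in 𝓝[>] (0 : ℝ), μ * (2 * Λ + 2 * lam) < c / 2 :=
    ((continuous_id.mul continuous_const).tendsto' 0 0 (by simp)).mono_left nhdsWithin_le_nhds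
      |>.eventually_lt_const (half_pos hc0)
  have hμΛ : ∀ᶠ μ in 𝓝[>] (0 : ℝ), 2 * μ * Λ ^ 2 < lam :=
    ((by fun_prop : Continuous fun μ : ℝ => 2 * μ * Λ ^ 2).tendsto' 0 0 (by simp)).mono_left
      nhdsWithin_le_nhds |>.eventually_lt_const hlam
  refine ⟨lam, hlam, ?_⟩
  filter_upwards [self_mem_nhdsWithin, hμc, hμΛ] with μ hμ hμc hμΛ e
  exact hp.wsq_comb_add_smul_le hA hc0.le hc1.le hc (Set.mem_Ioi.mp hμ).le hμc.le hμΛ.le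
    (hJ.wsq_drift_le hτ (fun k => (hp.pos k).le) e) (hdrift e)

theorem exists_wsq_dev_step_le (hgrp : IsGrouping T grp wo) (hA : IsCombination T grp A)
    (hJ : CostCondition grp J wo lamL lamU κH) (hτ : IsStepProfile τ) (hp : IsPerron grp A p) :
    ∃ c C : ℝ, 0 < c ∧ c < 1 ∧ ∀ (μ : ℝ) (e : Fin N → Vec M),
      wsq p (dev grp p (comb A (e + μ • drift J wo τ e))) ≤
        (1 - c) * wsq p (dev grp p e) + C * μ ^ 2 * wsq p e := by
  obtain ⟨c, hc0, hc1, hc⟩ := hp.exists_contraction (E := Vec M) hgrp hA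
  have hp0 (k : Fin N) : 0 ≤ p k := (hp.pos k).le
  set Λ := ∑ l, lamU l
  refine ⟨c / 2, (1 + (c / 2)⁻¹) * Λ ^ 2, half_pos hc0, by linarith, fun μ e => ?_⟩
  set d := drift J wo τ e
  have hdev : wsq p (dev grp p d) ≤ Λ ^ 2 * wsq p e :=
    (hp.wsq_dev_le d).trans (hJ.wsq_drift_le hτ hp0 e)
  have hyoung := wsq_add_le hp0 (dev grp p e) (μ • dev grp p d) (half_pos hc0)
  rw [wsq_smul, ← map_smul, ← map_add] at hyoung
  have hY : 0 ≤ wsq p (dev grp p e) := wsq_nonneg hp0 _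
  calc wsq p (dev grp p (comb A (e + μ • d)))
      ≤ (1 - c) * wsq p (dev grp p (e + μ • d)) := hc _
    _ ≤ (1 - c) * ((1 + c / 2) * wsq p (dev grp p e)
          + (1 + (c / 2)⁻¹) * (μ ^ 2 * (Λ ^ 2 * wsq p e))) := by
        refine mul_le_mul_of_nonneg_left (hyoung.trans ?_) (by linarith)
        gcongr
    _ = (1 - c) * (1 + c / 2) * wsq p (dev grp p e)
          + (1 - c) * ((1 + (c / 2)⁻¹) * Λ ^ 2 * μ ^ 2 * wsq p e) := by ring
    _ ≤ (1 - c / 2) * wsq p (dev grp p e) + 1 * ((1 + (c / 2)⁻¹) * Λ ^ 2 * μ ^ 2 * wsq p e) := by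
        have := wsq_nonneg hp0 e
        gcongr
        · nlinarith
        · linarith
    _ = _ := by ring

end Step

/-! ### Fourth moments of noisy iterations -/

section NoisyIteration

variable {Ω : Type*} {mΩ : MeasurableSpace Ω} {P : Measure Ω} {ℱ : Filtration ℕ mΩ}
  {V E H : Type*} [NormedAddCommGroup V] [NormedSpace ℝ V] [NormedAddCommGroup E] [NormedSpace ℝ E]
  [NormedAddCommGroup H] [InnerProductSpace ℝ H]
  {F : ℝ → V → V} {L : E →L[ℝ] V} {a b : ℝ} {e : ℝ → ℕ → Ω → V} {s : ℝ → ℕ → Ω → E}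

/-- For every step-size `μ`, the process `e μ` follows the recursion
`e (n + 1) = F μ (e n) + μ • L (s n)` driven by martingale differences `s μ n` whose fourth moments
are controlled by those of the state. -/
structure IsNoisyIteration (P : Measure Ω) (ℱ : Filtration ℕ mΩ) (F : ℝ → V → V) (L : E →L[ℝ] V)
    (a b : ℝ) (e : ℝ → ℕ → Ω → V) (s : ℝ → ℕ → Ω → E) : Prop where
  continuous_map : ∀ μ, Continuous (F μ)
  stronglyMeasurable : ∀ μ n, StronglyMeasurable[ℱ n] (e μ n)
  memLp_state : ∀ μ n, MemLp (e μ n) 4 P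
  memLp_noise : ∀ μ n, MemLp (s μ n) 4 P
  condExp_noise : ∀ μ n, P[s μ n | ℱ n] =ᵐ[P] 0
  integral_noise_le : ∀ μ n, ∫ ω, ‖s μ n ω‖ ^ 4 ∂P ≤ a * ∫ ω, ‖e μ n ω‖ ^ 4 ∂P + b
  step : ∀ μ n ω, e μ (n + 1) ω = F μ (e μ n ω) + μ • L (s μ n ω)

theorem tendsto_fst_curry_nhdsGT_zero :
    Tendsto (fun x : ℝ × ℕ => x.1) ((𝓝[>] (0 : ℝ)).curry atTop) (𝓝 0) :=
  (tendsto_fst_curry _ _).mono_right nhdsWithin_le_nhds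

theorem isBigO_fst_one :
    (fun x : ℝ × ℕ => x.1) =O[(𝓝[>] (0 : ℝ)).curry atTop] fun _ => (1 : ℝ) :=
  tendsto_fst_curry_nhdsGT_zero.isBigO_one ℝ

theorem condExp_clm_comp_eq_zero [CompleteSpace E] [CompleteSpace V] (L : E →L[ℝ] V)
    {m : MeasurableSpace Ω} {f : Ω → E} (hf : Integrable f P) (h0 : P[f | m] =ᵐ[P] 0) :
    P[fun ω => L (f ω) | m] =ᵐ[P] 0 := by
  refine (L.comp_condExp_comm hf).symm.trans ?_
  filter_upwards [h0] with ω hω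
  rw [Function.comp_apply, hω, Pi.zero_apply, map_zero, Pi.zero_apply]

namespace IsNoisyIteration

variable (he : IsNoisyIteration P ℱ F L a b e s)

include he

theorem memLp_map (μ : ℝ) (n : ℕ) : MemLp (fun ω => F μ (e μ n ω)) 4 P := by
  have h := (he.memLp_state μ (n + 1)).sub ((L.comp_memLp' (he.memLp_noise μ n)).const_smul μ)
  refine h.ae_eq (ae_of_all _ fun ω => ?_)
  simp [he.step]

theorem stronglyMeasurable_map (μ : ℝ) (n : ℕ) : StronglyMeasurable[ℱ n] fun ω => F μ (e μ n ω) :=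
  (he.continuous_map μ).comp_stronglyMeasurable (he.stronglyMeasurable μ n)

theorem integral_clm_noise_pow_four_le (B : E →L[ℝ] H) (μ : ℝ) (n : ℕ) :
    ∫ ω, ‖B (s μ n ω)‖ ^ 4 ∂P ≤ ‖B‖ ^ 4 * (a * ∫ ω, ‖e μ n ω‖ ^ 4 ∂P + b) := by
  refine le_trans ?_ (mul_le_mul_of_nonneg_left (he.integral_noise_le μ n) (by positivity))
  rw [← integral_const_mul]
  refine integral_mono (integrable_norm_pow_four (B.comp_memLp' (he.memLp_noise μ n)))
    ((integrable_norm_pow_four (he.memLp_noise μ n)).const_mul _) fun ω => ?_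
  simpa only [mul_pow] using pow_le_pow_left₀ (norm_nonneg _) (B.le_opNorm _) 4

theorem clm_succ (Q : V →L[ℝ] H) (μ : ℝ) (n : ℕ) (ω : Ω) :
    Q (e μ (n + 1) ω) = Q (F μ (e μ n ω)) + (μ • Q ∘L L) (s μ n ω) := by
  simp [he.step]

theorem integral_norm_pow_four_le {Q : V →L[ℝ] H} {K : ℝ} (hK : ∀ x, ‖x‖ ≤ K * ‖Q x‖) (μ : ℝ)
    (n : ℕ) : ∫ ω, ‖e μ n ω‖ ^ 4 ∂P ≤ K ^ 4 * ∫ ω, ‖Q (e μ n ω)‖ ^ 4 ∂P := by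
  rw [← integral_const_mul]
  refine integral_mono (integrable_norm_pow_four (he.memLp_state μ n))
    ((integrable_norm_pow_four (Q.comp_memLp' (he.memLp_state μ n))).const_mul _) fun ω => ?_
  simpa only [mul_pow] using pow_le_pow_left₀ (norm_nonneg _) (hK (e μ n ω)) 4

variable [IsProbabilityMeasure P] [CompleteSpace E] [CompleteSpace H]

theorem condExp_smul_clm_noise (B : E →L[ℝ] H) (μ : ℝ) (n : ℕ) :
    P[fun ω => (μ • B) (s μ n ω) | ℱ n] =ᵐ[P] 0 :=
  condExp_clm_comp_eq_zero (μ • B) ((he.memLp_noise μ n).integrable (by norm_num))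
    (he.condExp_noise μ n)

theorem integral_norm_pow_four_succ_le (Q : V →L[ℝ] H) (μ : ℝ) (n : ℕ) {t : ℝ} (ht : 0 < t) :
    ∫ ω, ‖Q (e μ (n + 1) ω)‖ ^ 4 ∂P ≤ (1 + t) * ∫ ω, ‖Q (F μ (e μ n ω))‖ ^ 4 ∂P
      + (3 + 16 / t) * (μ ^ 4 * ‖Q ∘L L‖ ^ 4 * (a * ∫ ω, ‖e μ n ω‖ ^ 4 ∂P + b)) := by
  simp only [he.clm_succ Q]
  refine (integral_norm_add_pow_four_le (ℱ.le n)
    (Q.continuous.comp_stronglyMeasurable (he.stronglyMeasurable_map μ n))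
    (Q.comp_memLp' (he.memLp_map μ n)) ((μ • Q ∘L L).comp_memLp' (he.memLp_noise μ n))
    (he.condExp_smul_clm_noise (Q ∘L L) μ n) ht).trans ?_
  gcongr
  refine (he.integral_clm_noise_pow_four_le (μ • Q ∘L L) μ n).trans_eq ?_
  rw [norm_smul, mul_pow, Real.norm_eq_abs, ← abs_pow, abs_of_nonneg (by positivity : 0 ≤ μ ^ 4)]

theorem integral_norm_sq_succ_le (Q : V →L[ℝ] H) (μ : ℝ) (n : ℕ) :
    ∫ ω, ‖Q (e μ (n + 1) ω)‖ ^ 2 ∂P ≤ ∫ ω, ‖Q (F μ (e μ n ω))‖ ^ 2 ∂P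
      + μ ^ 2 * (‖Q ∘L L‖ ^ 2 * ∫ ω, ‖s μ n ω‖ ^ 2 ∂P) := by
  have hs := memLp_two_of_four (he.memLp_noise μ n)
  have hBs : MemLp (fun ω => (μ • Q ∘L L) (s μ n ω)) 2 P := (μ • Q ∘L L).comp_memLp' hs
  simp only [he.clm_succ Q]
  rw [integral_norm_add_sq (ℱ.le n)
    (Q.continuous.comp_stronglyMeasurable (he.stronglyMeasurable_map μ n))
    (Q.comp_memLp' (memLp_two_of_four (he.memLp_map μ n))) hBs
    (he.condExp_smul_clm_noise (Q ∘L L) μ n), ← integral_const_mul, ← integral_const_mul,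
    add_le_add_iff_left]
  refine integral_mono (integrable_norm_sq hBs) (((integrable_norm_sq hs).const_mul _).const_mul _)
    fun ω => ?_
  simp only [smul_apply, norm_smul, mul_pow, Real.norm_eq_abs, sq_abs]
  gcongr
  simpa only [mul_pow] using pow_le_pow_left₀ (norm_nonneg _) ((Q ∘L L).le_opNorm (s μ n ω)) 2

theorem integral_norm_pow_four_succ_le_of_contraction {Q : V →L[ℝ] H} {K c μ : ℝ}
    (hK : ∀ x, ‖x‖ ≤ K * ‖Q x‖) (hc : 0 < c) (hμ : 0 < μ) (hμ1 : μ ≤ 1) (hcμ : c * μ ≤ 1)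
    (hQ : ∀ x, ‖Q (F μ x)‖ ^ 2 ≤ (1 - c * μ) * ‖Q x‖ ^ 2) (n : ℕ) :
    ∫ ω, ‖Q (e μ (n + 1) ω)‖ ^ 4 ∂P ≤ (1 - c * μ) * ∫ ω, ‖Q (e μ n ω)‖ ^ 4 ∂P
      + (3 + 32 / c) * ‖Q ∘L L‖ ^ 4 * μ ^ 3
        * (|a| * K ^ 4 * ∫ ω, ‖Q (e μ n ω)‖ ^ 4 ∂P + |b|) := by
  have hQe := integrable_norm_pow_four (Q.comp_memLp' (he.memLp_state μ n))
  have hQF := integrable_norm_pow_four (Q.comp_memLp' (he.memLp_map μ n))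
  have hI : 0 ≤ ∫ ω, ‖Q (e μ n ω)‖ ^ 4 ∂P := integral_nonneg fun ω => by positivity
  have hmap : ∫ ω, ‖Q (F μ (e μ n ω))‖ ^ 4 ∂P ≤ (1 - c * μ) ^ 2 * ∫ ω, ‖Q (e μ n ω)‖ ^ 4 ∂P := by
    rw [← integral_const_mul]
    refine integral_mono hQF (hQe.const_mul _) fun ω => ?_
    simpa only [mul_pow, ← pow_mul, Nat.reduceMul] using
      pow_le_pow_left₀ (sq_nonneg _) (hQ (e μ n ω)) 2
  have hnoise : a * ∫ ω, ‖e μ n ω‖ ^ 4 ∂P + b ≤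
      |a| * K ^ 4 * ∫ ω, ‖Q (e μ n ω)‖ ^ 4 ∂P + |b| := by
    rw [mul_assoc]
    exact add_le_add (mul_le_mul (le_abs_self a) (he.integral_norm_pow_four_le hK μ n)
      (integral_nonneg fun ω => by positivity) (abs_nonneg a)) (le_abs_self b)
  have hcoeff : (1 + c * μ / 2) * (1 - c * μ) ^ 2 ≤ 1 - c * μ := by
    nlinarith [mul_nonneg (mul_pos hc hμ).le (sub_nonneg.mpr hcμ),
      mul_nonneg (sub_nonneg.mpr hcμ) (sq_nonneg (c * μ))]
  have hnoise_coeff : (3 + 16 / (c * μ / 2)) * μ ^ 4 ≤ (3 + 32 / c) * μ ^ 3 := by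
    have : (3 + 16 / (c * μ / 2)) * μ ^ 4 = (3 * μ + 32 / c) * μ ^ 3 := by field_simp; ring
    rw [this]
    gcongr
    linarith
  calc ∫ ω, ‖Q (e μ (n + 1) ω)‖ ^ 4 ∂P
      ≤ (1 + c * μ / 2) * ((1 - c * μ) ^ 2 * ∫ ω, ‖Q (e μ n ω)‖ ^ 4 ∂P)
        + (3 + 16 / (c * μ / 2)) * (μ ^ 4 * ‖Q ∘L L‖ ^ 4
          * (|a| * K ^ 4 * ∫ ω, ‖Q (e μ n ω)‖ ^ 4 ∂P + |b|)) := by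
        refine (he.integral_norm_pow_four_succ_le Q μ n (t := c * μ / 2) (by positivity)).trans ?_
        gcongr
    _ ≤ _ := by
        have h1 := mul_le_mul_of_nonneg_right hcoeff hI
        have h2 := mul_le_mul_of_nonneg_right hnoise_coeff
          (by positivity : 0 ≤ ‖Q ∘L L‖ ^ 4 * (|a| * K ^ 4 * ∫ ω, ‖Q (e μ n ω)‖ ^ 4 ∂P + |b|))
        linarith

theorem isBigO_integral_norm_pow_four {Q : V →L[ℝ] H} {K c : ℝ} (hK : ∀ x, ‖x‖ ≤ K * ‖Q x‖)
    (hc : 0 < c) (hQ : ∀ᶠ μ in 𝓝[>] 0, ∀ x, ‖Q (F μ x)‖ ^ 2 ≤ (1 - c * μ) * ‖Q x‖ ^ 2) :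
    (fun x : ℝ × ℕ => ∫ ω, ‖e x.1 x.2 ω‖ ^ 4 ∂P) =O[(𝓝[>] (0 : ℝ)).curry atTop]
      fun x => x.1 ^ 2 := by
  set D := (3 + 32 / c) * ‖Q ∘L L‖ ^ 4
  have hpos : ∀ᶠ μ in 𝓝[>] (0 : ℝ), 0 < μ := self_mem_nhdsWithin
  have hlt {f : ℝ → ℝ} (hf : Continuous f) (hf0 : f 0 = 0) {r : ℝ} (hr : 0 < r) :
      ∀ᶠ μ in 𝓝[>] (0 : ℝ), f μ < r :=
    (hf.tendsto' 0 0 hf0).mono_left nhdsWithin_le_nhds |>.eventually_lt_const hr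
  have hsmall : ∀ᶠ μ in 𝓝[>] (0 : ℝ),
      0 < μ ∧ μ < 1 ∧ c * μ < 1 ∧ D * μ ^ 2 * (|a| * K ^ 4) < c / 2 :=
    hpos.and <| (hlt continuous_id rfl one_pos).and <|
      (hlt (by fun_prop) (mul_zero c) one_pos).and <|
        hlt (by fun_prop) (by ring) (half_pos hc)
  have hrec : ∀ᶠ x : ℝ × ℕ in (𝓝[>] (0 : ℝ)).curry atTop,
      ∫ ω, ‖Q (e x.1 (x.2 + 1) ω)‖ ^ 4 ∂P ≤
        (1 - c / 2 * x.1) * ∫ ω, ‖Q (e x.1 x.2 ω)‖ ^ 4 ∂P + D * |b| * (x.1 * x.1 ^ 2) := by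
    filter_upwards [(tendsto_fst_curry _ atTop).eventually (hsmall.and hQ)]
      with ⟨μ, n⟩ ⟨⟨hμ, hμ1, hcμ, hDμ⟩, hQμ⟩
    have hI : 0 ≤ ∫ ω, ‖Q (e μ n ω)‖ ^ 4 ∂P := integral_nonneg fun ω => by positivity
    have hstep :=
      he.integral_norm_pow_four_succ_le_of_contraction hK hc hμ hμ1.le hcμ.le hQμ n
    have habsorb := mul_le_mul_of_nonneg_right hDμ.le (mul_nonneg hμ.le hI)
    linarith
  have hsource : (fun x : ℝ × ℕ => D * |b| * (x.1 * x.1 ^ 2)) =O[(𝓝[>] (0 : ℝ)).curry atTop]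
      fun x => c / 2 * x.1 * x.1 ^ 2 := by
    simp only [mul_assoc (c / 2)]
    exact ((Asymptotics.isBigO_refl _ _).const_mul_left _).const_mul_right (half_pos hc).ne'
  have hQe := isBigO_of_le_one_sub_mul_add (a := fun μ n => ∫ ω, ‖Q (e μ n ω)‖ ^ 4 ∂P)
    (q := fun μ => c / 2 * μ) (g := fun μ => μ ^ 2)
    (fun μ n => integral_nonneg fun ω => by positivity)
    (hsmall.mono fun μ hμ => ⟨mul_pos (half_pos hc) hμ.1, by linarith⟩)
    (hpos.mono fun μ hμ => pow_pos hμ 2)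
    hsource hrec
  refine (Asymptotics.IsBigO.of_bound (K ^ 4) (.of_forall fun x => ?_)).trans hQe
  rw [Real.norm_of_nonneg (integral_nonneg fun ω => by positivity),
    Real.norm_of_nonneg (integral_nonneg fun ω => by positivity)]
  exact he.integral_norm_pow_four_le hK x.1 x.2

section Moments

omit [CompleteSpace E] [CompleteSpace H]

variable (he4 : (fun x : ℝ × ℕ => ∫ ω, ‖e x.1 x.2 ω‖ ^ 4 ∂P) =O[(𝓝[>] (0 : ℝ)).curry atTop]
  fun x => x.1 ^ 2)

include he4

theorem isBigO_integral_norm_sq :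
    (fun x : ℝ × ℕ => ∫ ω, ‖e x.1 x.2 ω‖ ^ 2 ∂P) =O[(𝓝[>] (0 : ℝ)).curry atTop] fun x => x.1 :=
  isBigO_integral_norm_sq_of_pow_four (fun x => he.memLp_state x.1 x.2) he4

theorem isBigO_integral_noise_norm_sq :
    (fun x : ℝ × ℕ => ∫ ω, ‖s x.1 x.2 ω‖ ^ 2 ∂P) =O[(𝓝[>] (0 : ℝ)).curry atTop]
      fun _ => (1 : ℝ) := by
  refine isBigO_integral_norm_sq_of_pow_four (fun x => he.memLp_noise x.1 x.2) ?_
  have hbound : (fun x : ℝ × ℕ => a * ∫ ω, ‖e x.1 x.2 ω‖ ^ 4 ∂P + b)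
      =O[(𝓝[>] (0 : ℝ)).curry atTop] fun _ => (1 : ℝ) ^ 2 := by
    refine ((he4.trans ?_).const_mul_left a).add (Asymptotics.isBigO_const_const b (by simp) _)
    exact isBigO_fst_one.pow 2
  refine .trans (.of_bound 1 (.of_forall fun x => ?_)) hbound
  rw [one_mul, Real.norm_of_nonneg (integral_nonneg fun ω => by positivity)]
  exact (he.integral_noise_le x.1 x.2).trans (le_abs_self _)

end Moments

theorem isBigO_integral_norm_sq_of_contraction {Q : V →L[ℝ] H} {c C : ℝ} (hc : 0 < c) (hc1 : c < 1)
    (hQ : ∀ μ x, ‖Q (F μ x)‖ ^ 2 ≤ (1 - c) * ‖Q x‖ ^ 2 + C * μ ^ 2 * ‖x‖ ^ 2)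
    (he4 : (fun x : ℝ × ℕ => ∫ ω, ‖e x.1 x.2 ω‖ ^ 4 ∂P) =O[(𝓝[>] (0 : ℝ)).curry atTop]
      fun x => x.1 ^ 2) :
    (fun x : ℝ × ℕ => ∫ ω, ‖Q (e x.1 x.2 ω)‖ ^ 2 ∂P) =O[(𝓝[>] (0 : ℝ)).curry atTop]
      fun x => x.1 ^ 2 := by
  have hsource : (fun x : ℝ × ℕ => C * x.1 ^ 2 * ∫ ω, ‖e x.1 x.2 ω‖ ^ 2 ∂P
      + x.1 ^ 2 * (‖Q ∘L L‖ ^ 2 * ∫ ω, ‖s x.1 x.2 ω‖ ^ 2 ∂P))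
      =O[(𝓝[>] (0 : ℝ)).curry atTop] fun x => c * x.1 ^ 2 := by
    refine .const_mul_right hc.ne' (.add ?_ ?_)
    · simpa only [mul_one] using ((Asymptotics.isBigO_refl _ _).const_mul_left C).mul
        ((he.isBigO_integral_norm_sq he4).trans isBigO_fst_one)
    · simpa only [mul_one] using (Asymptotics.isBigO_refl _ _).mul
        ((he.isBigO_integral_noise_norm_sq he4).const_mul_left (‖Q ∘L L‖ ^ 2))
  refine isBigO_of_le_one_sub_mul_add (a := fun μ n => ∫ ω, ‖Q (e μ n ω)‖ ^ 2 ∂P)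
    (q := fun _ => c) (g := fun μ => μ ^ 2) (fun μ n => integral_nonneg fun ω => by positivity)
    (.of_forall fun _ => ⟨hc, hc1.le⟩)
    (eventually_nhdsWithin_of_forall fun μ (hμ : 0 < μ) => pow_pos hμ 2) hsource
    (.of_forall fun ⟨μ, n⟩ => ?_)
  have hQe : Integrable (fun ω => ‖Q (e μ n ω)‖ ^ 2) P :=
    integrable_norm_sq (Q.comp_memLp' (memLp_two_of_four (he.memLp_state μ n)))
  have hQF : Integrable (fun ω => ‖Q (F μ (e μ n ω))‖ ^ 2) P :=
    integrable_norm_sq (Q.comp_memLp' (memLp_two_of_four (he.memLp_map μ n)))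
  have hen := integrable_norm_sq (memLp_two_of_four (he.memLp_state μ n))
  have hmap := integral_mono hQF ((hQe.const_mul (1 - c)).add (hen.const_mul (C * μ ^ 2)))
    fun ω => hQ μ (e μ n ω)
  simp only [Pi.add_apply] at hmap
  rw [integral_add (hQe.const_mul _) (hen.const_mul _), integral_const_mul,
    integral_const_mul] at hmap
  linarith [he.integral_norm_sq_succ_le Q μ n]

end IsNoisyIteration

end NoisyIteration

/-! ### Stationary covariance of a perturbed linear recursion -/

section StationaryCovariance

variable {Ω : Type*} {mΩ : MeasurableSpace Ω} {P : Measure Ω} {ℱ : Filtration ℕ mΩ}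
  {ι : Type*} [Fintype ι] [DecidableEq ι] {H S Φ : Matrix ι ι ℝ}
  {Z d ξ : ℝ → ℕ → Ω → EuclideanSpace ℝ ι}

/-- For every step-size `μ`, the process `Z μ` follows the linear recursion
`Z (n + 1) = (1 - μ H) Z n + μ (d n + ξ n)` with perturbation `d` and martingale differences `ξ`. -/
structure IsPerturbedLinearRecursion (P : Measure Ω) (ℱ : Filtration ℕ mΩ) (H : Matrix ι ι ℝ)
    (Z d ξ : ℝ → ℕ → Ω → EuclideanSpace ℝ ι) : Prop where
  stronglyMeasurable_state : ∀ μ n, StronglyMeasurable[ℱ n] (Z μ n)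
  stronglyMeasurable_perturbation : ∀ μ n, StronglyMeasurable[ℱ n] (d μ n)
  memLp_state : ∀ μ n, MemLp (Z μ n) 2 P
  memLp_perturbation : ∀ μ n, MemLp (d μ n) 2 P
  memLp_noise : ∀ μ n, MemLp (ξ μ n) 2 P
  condExp_noise : ∀ μ n, P[ξ μ n | ℱ n] =ᵐ[P] 0
  step : ∀ μ n ω, Z μ (n + 1) ω =
    Matrix.toEuclideanCLM (𝕜 := ℝ) (1 - μ • H) (Z μ n ω) + μ • d μ n ω + μ • ξ μ n ω

theorem secondMoment_toEuclideanCLM {u : Ω → EuclideanSpace ℝ ι} (hu : MemLp u 2 P)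
    (B : Matrix ι ι ℝ) :
    secondMoment P (fun ω => Matrix.toEuclideanCLM (𝕜 := ℝ) B (u ω)) = B * secondMoment P u * Bᵀ :=
  secondMoment_mulVec hu B

namespace IsPerturbedLinearRecursion

variable (hZ : IsPerturbedLinearRecursion P ℱ H Z d ξ)

include hZ

theorem secondMoment_succ [IsFiniteMeasure P] (hH : H.IsHermitian) (μ : ℝ) (n : ℕ) :
    secondMoment P (Z μ (n + 1)) =
      (1 - μ • H) * secondMoment P (Z μ n) * (1 - μ • H)
        + (secondMoment P (fun ω =>
            Matrix.toEuclideanCLM (𝕜 := ℝ) (1 - μ • H) (Z μ n ω) + μ • d μ n ω)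
          - secondMoment P fun ω => Matrix.toEuclideanCLM (𝕜 := ℝ) (1 - μ • H) (Z μ n ω))
        + μ ^ 2 • secondMoment P (ξ μ n) := by
  set K := 1 - μ • H with hK
  have hsymm : Kᵀ = K := by
    rw [hK, Matrix.transpose_sub, Matrix.transpose_one, Matrix.transpose_smul,
      ← Matrix.conjTranspose_eq_transpose_of_trivial, hH.eq]
  have hmean : StronglyMeasurable[ℱ n] fun ω =>
      Matrix.toEuclideanCLM (𝕜 := ℝ) K (Z μ n ω) + μ • d μ n ω :=
    ((ContinuousLinearMap.continuous _).comp_stronglyMeasurable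
      (hZ.stronglyMeasurable_state μ n)).add
      ((hZ.stronglyMeasurable_perturbation μ n).const_smul μ)
  have hmean2 : MemLp (fun ω => Matrix.toEuclideanCLM (𝕜 := ℝ) K (Z μ n ω) + μ • d μ n ω) 2 P :=
    ((Matrix.toEuclideanCLM (𝕜 := ℝ) K).comp_memLp' (hZ.memLp_state μ n)).add
      ((hZ.memLp_perturbation μ n).const_smul μ)
  have hnoise2 : MemLp (fun ω => μ • ξ μ n ω) 2 P := (hZ.memLp_noise μ n).const_smul μ
  have hnoise : P[fun ω => μ • ξ μ n ω | ℱ n] =ᵐ[P] 0 :=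
    condExp_clm_comp_eq_zero (μ • ContinuousLinearMap.id ℝ (EuclideanSpace ℝ ι))
      ((hZ.memLp_noise μ n).integrable one_le_two) (hZ.condExp_noise μ n)
  have hconj : secondMoment P (fun ω => Matrix.toEuclideanCLM (𝕜 := ℝ) K (Z μ n ω)) =
      K * secondMoment P (Z μ n) * K := by
    rw [secondMoment_toEuclideanCLM (hZ.memLp_state μ n), hsymm]
  rw [funext (hZ.step μ n), ← hconj, add_sub_cancel, ← secondMoment_smul,
    secondMoment_add (ℱ.le n) hmean hmean2 hnoise2 hnoise]

theorem isBigO_secondMoment_perturbed_sub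
    (hZ2 : (fun x : ℝ × ℕ => ∫ ω, ‖Z x.1 x.2 ω‖ ^ 2 ∂P)
      =O[(𝓝[>] (0 : ℝ)).curry atTop] fun x => x.1)
    (hd2 : (fun x : ℝ × ℕ => ∫ ω, ‖d x.1 x.2 ω‖ ^ 2 ∂P)
      =O[(𝓝[>] (0 : ℝ)).curry atTop] fun x => x.1 ^ 2) :
    (fun x : ℝ × ℕ =>
      secondMoment P (fun ω =>
        Matrix.toEuclideanCLM (𝕜 := ℝ) (1 - x.1 • H) (Z x.1 x.2 ω) + x.1 • d x.1 x.2 ω)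
      - secondMoment P fun ω => Matrix.toEuclideanCLM (𝕜 := ℝ) (1 - x.1 • H) (Z x.1 x.2 ω))
      =O[(𝓝[>] (0 : ℝ)).curry atTop] fun x => x.1 * √x.1 * x.1 := by
  have hsmall : ∀ᶠ x : ℝ × ℕ in (𝓝[>] (0 : ℝ)).curry atTop, 0 < x.1 ∧ x.1 < 1 :=
    (tendsto_fst_curry _ _).eventually (Ioo_mem_nhdsGT one_pos)
  refine isBigO_secondMoment_add_sub (f := fun x : ℝ × ℕ => x.1)
    (fun x => ContinuousLinearMap.comp_memLp' _ (hZ.memLp_state x.1 x.2))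
    (fun x => (hZ.memLp_perturbation x.1 x.2).const_smul x.1) ?_ ?_ ?_
  · filter_upwards [hsmall] with x ⟨hpos, hlt⟩
    exact ⟨mul_pos hpos (Real.sqrt_pos.mpr hpos),
      mul_le_one₀ hlt.le (Real.sqrt_nonneg _) (Real.sqrt_le_one.mpr hlt.le)⟩
  · have hcoeff : (fun x : ℝ × ℕ => ‖1 - x.1 • H‖ ^ 2)
        =O[(𝓝[>] (0 : ℝ)).curry atTop] fun _ => (1 : ℝ) := by
      have : Continuous fun μ : ℝ => ‖1 - μ • H‖ ^ 2 := by fun_prop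
      exact ((this.tendsto 0).comp tendsto_fst_curry_nhdsGT_zero).isBigO_one ℝ
    refine .trans (.of_bound 1 (.of_forall fun x => ?_))
      (by simpa only [one_mul] using hcoeff.mul hZ2)
    rw [one_mul, Real.norm_of_nonneg (integral_nonneg fun ω => sq_nonneg _)]
    refine le_trans ?_ (le_abs_self _)
    rw [← integral_const_mul]
    refine integral_mono (integrable_norm_sq (ContinuousLinearMap.comp_memLp' _
      (hZ.memLp_state x.1 x.2))) ((integrable_norm_sq (hZ.memLp_state x.1 x.2)).const_mul _)
      fun ω => ?_
    have hop : ‖Matrix.toEuclideanCLM (𝕜 := ℝ) (1 - x.1 • H) (Z x.1 x.2 ω)‖ ≤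
        ‖1 - x.1 • H‖ * ‖Z x.1 x.2 ω‖ := Matrix.l2_opNorm_mulVec _ _
    simpa only [mul_pow] using pow_le_pow_left₀ (norm_nonneg _) hop 2
  · simp only [norm_smul, mul_pow, integral_const_mul, Real.norm_eq_abs, sq_abs]
    refine ((Asymptotics.isBigO_refl _ _).mul hd2).congr' .rfl ?_
    filter_upwards [hsmall] with x ⟨hpos, _⟩
    rw [Real.sq_sqrt hpos.le]
    ring

theorem isLittleO_inv_mul_norm_secondMoment_perturbed_sub
    (hZ2 : (fun x : ℝ × ℕ => ∫ ω, ‖Z x.1 x.2 ω‖ ^ 2 ∂P)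
      =O[(𝓝[>] (0 : ℝ)).curry atTop] fun x => x.1)
    (hd2 : (fun x : ℝ × ℕ => ∫ ω, ‖d x.1 x.2 ω‖ ^ 2 ∂P)
      =O[(𝓝[>] (0 : ℝ)).curry atTop] fun x => x.1 ^ 2) :
    (fun x : ℝ × ℕ => x.1⁻¹ * ‖secondMoment P (fun ω =>
          Matrix.toEuclideanCLM (𝕜 := ℝ) (1 - x.1 • H) (Z x.1 x.2 ω) + x.1 • d x.1 x.2 ω)
        - secondMoment P fun ω => Matrix.toEuclideanCLM (𝕜 := ℝ) (1 - x.1 • H) (Z x.1 x.2 ω)‖)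
      =o[(𝓝[>] (0 : ℝ)).curry atTop] fun x => x.1 := by
  have hsqrt : Tendsto (fun x : ℝ × ℕ => √x.1) ((𝓝[>] (0 : ℝ)).curry atTop) (𝓝 0) :=
    (Real.continuous_sqrt.tendsto' 0 0 Real.sqrt_zero).comp tendsto_fst_curry_nhdsGT_zero
  have hpos := (tendsto_fst_curry (𝓝[>] (0 : ℝ)) (atTop : Filter ℕ)).eventually
    self_mem_nhdsWithin
  refine ((Asymptotics.isBigO_refl _ _).mul
    (hZ.isBigO_secondMoment_perturbed_sub hZ2 hd2).norm_left).trans_isLittleO ?_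
  refine (((Asymptotics.isLittleO_one_iff ℝ).mpr hsqrt).mul_isBigO
    (Asymptotics.isBigO_refl Prod.fst _)).congr' ?_ (.of_forall fun x => one_mul _)
  filter_upwards [hpos] with x hx
  have hx' : x.1 ≠ 0 := ne_of_gt hx
  field_simp

theorem norm_inv_smul_secondMoment_sub_succ_le [IsFiniteMeasure P] {lam μ : ℝ}
    (hH : H.IsHermitian) (hlam0 : 0 ≤ lam) (hlam : (H - lam • 1).PosSemidef)
    (hΦ : H * Φ + Φ * H = S) (hμ : 0 < μ) (hμH : μ * ‖H‖ ≤ 1) (hμlam : μ * lam ≤ 1) (n : ℕ) :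
    ‖μ⁻¹ • secondMoment P (Z μ (n + 1)) - Φ‖ ≤
      (1 - lam * μ) * ‖μ⁻¹ • secondMoment P (Z μ n) - Φ‖
        + (μ ^ 2 * ‖H * Φ * H‖
          + μ⁻¹ * ‖secondMoment P (fun ω =>
              Matrix.toEuclideanCLM (𝕜 := ℝ) (1 - μ • H) (Z μ n ω) + μ • d μ n ω)
            - secondMoment P fun ω => Matrix.toEuclideanCLM (𝕜 := ℝ) (1 - μ • H) (Z μ n ω)‖
          + μ * ‖secondMoment P (ξ μ n) - S‖) := by
  rw [hZ.secondMoment_succ hH]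
  set K := 1 - μ • H with hK
  set Q := secondMoment P (Z μ n)
  set W := secondMoment P (fun ω => Matrix.toEuclideanCLM (𝕜 := ℝ) K (Z μ n ω) + μ • d μ n ω)
    - secondMoment P fun ω => Matrix.toEuclideanCLM (𝕜 := ℝ) K (Z μ n ω)
  have hKnorm : ‖K‖ ≤ 1 - μ * lam := norm_one_sub_smul_le hH hlam hμ.le hμH hμlam
  have hrec : μ⁻¹ • (K * Q * K + W + μ ^ 2 • secondMoment P (ξ μ n)) - Φ =
      K * (μ⁻¹ • Q - Φ) * K + (μ ^ 2 • (H * Φ * H) + μ⁻¹ • W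
        + μ • (secondMoment P (ξ μ n) - S)) := by
    have hfixed : K * Φ * K = Φ - μ • S + μ ^ 2 • (H * Φ * H) := by
      rw [hK, conj_one_sub_smul, hΦ]
    have hsq : μ⁻¹ * μ ^ 2 = μ := by field_simp
    rw [mul_sub K, sub_mul _ _ K, hfixed, mul_smul_comm, smul_mul_assoc, smul_add, smul_add,
      smul_smul, hsq]
    module
  have hconj : ‖K * (μ⁻¹ • Q - Φ) * K‖ ≤ (1 - lam * μ) * ‖μ⁻¹ • Q - Φ‖ := by
    calc ‖K * (μ⁻¹ • Q - Φ) * K‖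
        ≤ ‖K‖ * ‖μ⁻¹ • Q - Φ‖ * ‖K‖ := norm_mul₃_le
      _ ≤ (1 - μ * lam) * ‖μ⁻¹ • Q - Φ‖ * 1 := by
        gcongr
        exact hKnorm.trans (sub_le_self _ (mul_nonneg hμ.le hlam0))
      _ = (1 - lam * μ) * ‖μ⁻¹ • Q - Φ‖ := by ring
  rw [hrec]
  refine (norm_add_le _ _).trans (add_le_add hconj (norm_add₃_le.trans ?_))
  rw [norm_smul, norm_smul, norm_smul, Real.norm_of_nonneg (sq_nonneg μ),
    Real.norm_of_nonneg (inv_nonneg.mpr hμ.le), Real.norm_of_nonneg hμ.le]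

theorem tendsto_inv_smul_secondMoment [IsFiniteMeasure P] {lam : ℝ} (hH : H.IsHermitian)
    (hlam0 : 0 < lam) (hlam : (H - lam • 1).PosSemidef) (hΦ : H * Φ + Φ * H = S)
    (hZ2 : (fun x : ℝ × ℕ => ∫ ω, ‖Z x.1 x.2 ω‖ ^ 2 ∂P)
      =O[(𝓝[>] (0 : ℝ)).curry atTop] fun x => x.1)
    (hd2 : (fun x : ℝ × ℕ => ∫ ω, ‖d x.1 x.2 ω‖ ^ 2 ∂P)
      =O[(𝓝[>] (0 : ℝ)).curry atTop] fun x => x.1 ^ 2)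
    (hξ2 : Tendsto (fun x : ℝ × ℕ => secondMoment P (ξ x.1 x.2))
      ((𝓝[>] (0 : ℝ)).curry atTop) (𝓝 S)) :
    Tendsto (fun x : ℝ × ℕ => x.1⁻¹ • secondMoment P (Z x.1 x.2))
      ((𝓝[>] (0 : ℝ)).curry atTop) (𝓝 Φ) := by
  have hpos : ∀ᶠ μ in 𝓝[>] (0 : ℝ), 0 < μ := self_mem_nhdsWithin
  have hle_one (c : ℝ) : ∀ᶠ μ in 𝓝[>] (0 : ℝ), μ * c ≤ 1 :=
    (((continuous_mul_const c).tendsto' 0 0 (zero_mul c)).mono_left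
      nhdsWithin_le_nhds).eventually_le_const one_pos
  have hquad : (fun x : ℝ × ℕ => x.1 ^ 2 * ‖H * Φ * H‖)
      =o[(𝓝[>] (0 : ℝ)).curry atTop] fun x => lam * x.1 := by
    refine .const_mul_right hlam0.ne' ?_
    simpa only [sq, one_mul, mul_one, mul_comm] using (((Asymptotics.isLittleO_one_iff ℝ).mpr
      tendsto_fst_curry_nhdsGT_zero).mul_isBigO (Asymptotics.isBigO_refl Prod.fst
        ((𝓝[>] (0 : ℝ)).curry (atTop : Filter ℕ)))).const_mul_left ‖H * Φ * H‖
  have hpert :=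
    (hZ.isLittleO_inv_mul_norm_secondMoment_perturbed_sub hZ2 hd2).const_mul_right hlam0.ne'
  have hnoise : (fun x : ℝ × ℕ => x.1 * ‖secondMoment P (ξ x.1 x.2) - S‖)
      =o[(𝓝[>] (0 : ℝ)).curry atTop] fun x => lam * x.1 := by
    refine .const_mul_right hlam0.ne' ?_
    simpa only [mul_one] using (Asymptotics.isBigO_refl Prod.fst _).mul_isLittleO
      ((Asymptotics.isLittleO_one_iff ℝ).mpr (tendsto_iff_norm_sub_tendsto_zero.mp hξ2))
  refine tendsto_iff_norm_sub_tendsto_zero.mpr (tendsto_zero_of_le_one_sub_mul_add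
    (a := fun μ n => ‖μ⁻¹ • secondMoment P (Z μ n) - Φ‖) (q := fun μ => lam * μ)
    (fun _ _ => norm_nonneg _) ?_ ((hquad.add hpert).add hnoise) ?_)
  · filter_upwards [hpos, hle_one lam] with μ hμ hle
    exact ⟨mul_pos hlam0 hμ, by rwa [mul_comm]⟩
  · filter_upwards [(tendsto_fst_curry (𝓝[>] (0 : ℝ)) (atTop : Filter ℕ)).eventually
      (hpos.and ((hle_one ‖H‖).and (hle_one lam)))] with x ⟨hμ, hμH, hμlam⟩
    exact hZ.norm_inv_smul_secondMoment_sub_succ_le hH hlam0.le hlam hΦ hμ hμH hμlam x.2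

end IsPerturbedLinearRecursion

end StationaryCovariance

/-! ### Moments of the network error -/

section ErrorRecursion

variable {N G M : ℕ} {Ω : Type*} {mΩ : MeasurableSpace Ω} {P : Measure Ω} {ℱ : Filtration ℕ mΩ}
  {T : SimpleGraph (Fin N)} {grp : Fin N → Fin G} {A : Matrix (Fin N) (Fin N) ℝ}
  {J : Fin N → Vec M → ℝ} {wo : Fin N → Vec M} {lamL lamU : Fin N → ℝ} {κH : ℝ}
  {α σs κs γs : ℝ} {Rs : Matrix (Fin N × Fin M) (Fin N × Fin M) ℝ} {τ p : Fin N → ℝ}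
  {ghat : ℕ → Fin N → Vec M → Ω → Vec M}

/-- The effect of the stacked gradient noise on the combined errors, per unit of step-size. -/
noncomputable def noiseMap (A : Matrix (Fin N) (Fin N) ℝ) (τ : Fin N → ℝ) :
    EuclideanSpace ℝ (Fin N × Fin M) →L[ℝ] (Fin N → Vec M) :=
  LinearMap.toContinuousLinearMap (comb A) ∘L
    ContinuousLinearMap.pi (fun l => τ l • ContinuousLinearMap.proj l) ∘L
      (colEquiv N M).symm.toContinuousLinearMap

theorem noiseMap_col (A : Matrix (Fin N) (Fin N) ℝ) (τ : Fin N → ℝ) (u : Fin N → Vec M) :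
    noiseMap A τ (col u) = comb A fun l => τ l • u l := rfl

theorem wo_sub_estimate_succ (hgrp : IsGrouping T grp wo) (hA : IsCombination T grp A) (μ : ℝ)
    (n : ℕ) (ω : Ω) :
    wo - estimate A τ ghat μ (n + 1) ω =
      comb A ((wo - estimate A τ ghat μ n ω)
          + μ • drift J wo τ (wo - estimate A τ ghat μ n ω))
        + μ • noiseMap A τ (netNoise J ghat n (estimate A τ ghat μ n ω) ω) := by
  have hwo : wo = comb A wo := by
    funext k
    rw [comb_apply]
    conv_lhs => rw [← one_smul ℝ (wo k), ← hA.sum_one k, Finset.sum_smul]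
    refine Finset.sum_congr rfl fun l _ => ?_
    by_cases h : grp l = grp k
    · rw [hgrp.common_minimizer l k h]
    · rw [hA.eq_zero_of_grp_ne h, zero_smul, zero_smul]
  have hest : estimate A τ ghat μ (n + 1) ω = comb A fun l => estimate A τ ghat μ n ω l
      - (μ * τ l) • ghat n l (estimate A τ ghat μ n ω l) ω := by
    funext k
    rw [comb_apply, estimate]
  rw [netNoise, noiseMap_col, hest, ← map_smul, ← map_add]
  nth_rw 1 [hwo]
  rw [← map_sub]
  congr 1
  funext l
  simp only [Pi.add_apply, Pi.sub_apply, Pi.smul_apply, drift, sub_sub_cancel, smul_sub, smul_smul]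
  abel

theorem CostCondition.norm_drift_le (hJ : CostCondition grp J wo lamL lamU κH)
    (hτ : IsStepProfile τ) (e : Fin N → Vec M) :
    ‖drift J wo τ e‖ ≤ (∑ l, lamU l) * ‖e‖ := by
  have hΛ : 0 ≤ ∑ l, lamU l := Finset.sum_nonneg fun l _ => hJ.lamU_nonneg l
  refine (pi_norm_le_iff_of_nonneg (by positivity)).mpr fun k =>
    (hJ.norm_drift_apply_le hτ e k).trans ?_
  gcongr
  exact norm_le_pi_norm e k

theorem CostCondition.memLp_drift (hJ : CostCondition grp J wo lamL lamU κH)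
    (hτ : IsStepProfile τ) {e : Ω → Fin N → Vec M} {q : ℝ≥0∞} (he : MemLp e q P) :
    MemLp (fun ω => drift J wo τ (e ω)) q P :=
  he.of_le_mul ((hJ.continuous_drift τ).comp_aestronglyMeasurable he.1)
    (ae_of_all _ fun ω => hJ.norm_drift_le hτ (e ω))

theorem CostCondition.continuous_comb_add_smul_drift
    (hJ : CostCondition grp J wo lamL lamU κH) (A : Matrix (Fin N) (Fin N) ℝ) (τ : Fin N → ℝ)
    (μ : ℝ) : Continuous fun e => comb A (e + μ • drift J wo τ e) :=
  (LinearMap.toContinuousLinearMap (comb (E := Vec M) A)).continuous.comp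
    (continuous_id.add ((hJ.continuous_drift τ).const_smul μ) :
      Continuous fun e => e + μ • drift J wo τ e)

variable [IsProbabilityMeasure P]

theorem memLp_col_of_sub {W : Ω → Fin N → Vec M} {q : ℝ≥0∞}
    (h : MemLp (fun ω => wo - W ω) q P) : MemLp (fun ω => col (W ω)) q P := by
  have hW : MemLp W q P := by simpa [Pi.sub_def] using (memLp_const wo).sub h
  exact (colEquiv N M).toContinuousLinearMap.comp_memLp' hW

theorem stronglyMeasurable_of_sub {m : MeasurableSpace Ω} {W : Ω → Fin N → Vec M}
    (h : StronglyMeasurable[m] fun ω => wo - W ω) : StronglyMeasurable[m] W := by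
  simpa [Pi.sub_def] using (stronglyMeasurable_const (b := wo)).sub h

theorem stronglyMeasurable_and_memLp_wo_sub_estimate (hgrp : IsGrouping T grp wo)
    (hA : IsCombination T grp A) (hJ : CostCondition grp J wo lamL lamU κH)
    (hτ : IsStepProfile τ) (hS : NoiseCondition P ℱ J wo ghat α σs κs γs Rs) (μ : ℝ) (n : ℕ) :
    StronglyMeasurable[ℱ n] (fun ω => wo - estimate A τ ghat μ n ω) ∧
      MemLp (fun ω => wo - estimate A τ ghat μ n ω) 4 P := by
  induction n with
  | zero =>
    simp only [estimate]
    exact ⟨stronglyMeasurable_const, memLp_const _⟩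
  | succ n ih =>
    obtain ⟨herr, hL⟩ := ih
    have hm := stronglyMeasurable_of_sub herr
    have hcol := memLp_col_of_sub hL
    simp only [wo_sub_estimate_succ hgrp hA (J := J)]
    constructor
    · have hmap := ((hJ.continuous_comb_add_smul_drift A τ μ).comp_stronglyMeasurable
        herr).mono (ℱ.mono n.le_succ)
      exact hmap.add (((noiseMap A τ).continuous.comp_stronglyMeasurable
        (hS.adapted n _ hm hcol)).const_smul μ)
    · have hstep : MemLp (fun ω => (wo - estimate A τ ghat μ n ω)
          + μ • drift J wo τ (wo - estimate A τ ghat μ n ω)) 4 P :=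
        hL.add ((hJ.memLp_drift hτ hL).const_smul μ)
      have hmap : MemLp (fun ω => comb A ((wo - estimate A τ ghat μ n ω)
          + μ • drift J wo τ (wo - estimate A τ ghat μ n ω))) 4 P :=
        (LinearMap.toContinuousLinearMap (comb (E := Vec M) A)).comp_memLp' hstep
      exact hmap.add (((noiseMap A τ).comp_memLp' (hS.memLp n _ hm hcol)).const_smul μ)

theorem NoiseCondition.integral_norm_pow_four_le
    (hS : NoiseCondition P ℱ J wo ghat α σs κs γs Rs) {n : ℕ} {W : Ω → Fin N → Vec M}
    (hW : StronglyMeasurable[ℱ n] W) (hL : MemLp (fun ω => col (W ω)) 4 P) :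
    ∫ ω, ‖netNoise J ghat n (W ω) ω‖ ^ 4 ∂P ≤
      α ^ 2 * ∫ ω, ‖col wo - col (W ω)‖ ^ 4 ∂P + σs ^ 4 := by
  have hint : Integrable (fun ω => α ^ 2 * ‖col wo - col (W ω)‖ ^ 4) P :=
    (integrable_norm_pow_four ((memLp_const (col wo)).sub hL)).const_mul _
  calc ∫ ω, ‖netNoise J ghat n (W ω) ω‖ ^ 4 ∂P
      = ∫ ω, (P[fun ω' => ‖netNoise J ghat n (W ω') ω'‖ ^ 4 | ℱ n]) ω ∂P :=
        (integral_condExp (ℱ.le n)).symm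
    _ ≤ ∫ ω, (α ^ 2 * ‖col wo - col (W ω)‖ ^ 4 + σs ^ 4) ∂P :=
        integral_mono_ae integrable_condExp (hint.add (integrable_const _))
          (hS.fourth_moment n W hW hL)
    _ = _ := by simp [integral_add hint, integral_const_mul]

theorem isNoisyIteration_wo_sub_estimate (hgrp : IsGrouping T grp wo)
    (hA : IsCombination T grp A) (hJ : CostCondition grp J wo lamL lamU κH)
    (hτ : IsStepProfile τ) (hS : NoiseCondition P ℱ J wo ghat α σs κs γs Rs) :
    IsNoisyIteration P ℱ (fun μ e => comb A (e + μ • drift J wo τ e)) (noiseMap A τ)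
      (α ^ 2 * ‖(colEquiv N M).toContinuousLinearMap‖ ^ 4) (σs ^ 4)
      (fun μ n ω => wo - estimate A τ ghat μ n ω)
      (fun μ n ω => netNoise J ghat n (estimate A τ ghat μ n ω) ω) := by
  have hest (μ : ℝ) (n : ℕ) :=
    stronglyMeasurable_and_memLp_wo_sub_estimate hgrp hA hJ hτ hS μ n
  have hm (μ : ℝ) (n : ℕ) := stronglyMeasurable_of_sub (hest μ n).1
  have hcol (μ : ℝ) (n : ℕ) := memLp_col_of_sub (hest μ n).2
  refine ⟨fun μ => hJ.continuous_comb_add_smul_drift A τ μ, fun μ n => (hest μ n).1,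
    fun μ n => (hest μ n).2, fun μ n => hS.memLp n _ (hm μ n) (hcol μ n),
    fun μ n => hS.martingale_difference n _ (hm μ n) (hcol μ n), fun μ n => ?_,
    fun μ n ω => wo_sub_estimate_succ hgrp hA μ n ω⟩
  refine (hS.integral_norm_pow_four_le (hm μ n) (hcol μ n)).trans ?_
  rw [mul_assoc, add_le_add_iff_right]
  refine mul_le_mul_of_nonneg_left ?_ (sq_nonneg α)
  rw [← integral_const_mul]
  refine integral_mono (integrable_norm_pow_four ((memLp_const (col wo)).sub (hcol μ n)))
    ((integrable_norm_pow_four (hest μ n).2).const_mul _) fun ω => ?_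
  have hnorm : ‖col wo - col (estimate A τ ghat μ n ω)‖ ≤ _ :=
    (colEquiv N M).toContinuousLinearMap.le_opNorm (wo - estimate A τ ghat μ n ω)
  exact (pow_le_pow_left₀ (norm_nonneg _) hnorm 4).trans_eq (mul_pow _ _ 4)

section MomentBounds

variable (hgrp : IsGrouping T grp wo) (hA : IsCombination T grp A)
  (hJ : CostCondition grp J wo lamL lamU κH) (hτ : IsStepProfile τ)
  (hS : NoiseCondition P ℱ J wo ghat α σs κs γs Rs) (hp : IsPerron grp A p)

include hgrp hA hJ hτ hS hp

theorem isBigO_integral_norm_wo_sub_estimate_pow_four :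
    (fun x : ℝ × ℕ => ∫ ω, ‖wo - estimate A τ ghat x.1 x.2 ω‖ ^ 4 ∂P)
      =O[(𝓝[>] (0 : ℝ)).curry atTop] fun x => x.1 ^ 2 := by
  obtain ⟨c, hc, hstep⟩ := exists_wsq_step_le hgrp hA hJ hτ hp
  have hp0 (k : Fin N) : 0 ≤ p k := (hp.pos k).le
  obtain ⟨K, hK⟩ := exists_norm_le_mul_norm_wcol (E := Vec M) hp.pos
  refine (isNoisyIteration_wo_sub_estimate hgrp hA hJ hτ hS).isBigO_integral_norm_pow_four
    (Q := wcol p) hK hc ?_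
  filter_upwards [hstep] with μ hμ e
  simpa only [norm_wcol_sq hp0] using hμ e

theorem isBigO_integral_norm_dev_sq :
    (fun x : ℝ × ℕ => ∫ ω, ‖dev grp p (wo - estimate A τ ghat x.1 x.2 ω)‖ ^ 2 ∂P)
      =O[(𝓝[>] (0 : ℝ)).curry atTop] fun x => x.1 ^ 2 := by
  obtain ⟨c, C, hc0, hc1, hstep⟩ := exists_wsq_dev_step_le hgrp hA hJ hτ hp
  have hp0 (k : Fin N) : 0 ≤ p k := (hp.pos k).le
  have he := isNoisyIteration_wo_sub_estimate hgrp hA hJ hτ hS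
  obtain ⟨Q, hQ⟩ : ∃ Q : (Fin N → Vec M) →L[ℝ] PiLp 2 fun _ : Fin N => Vec M,
      ∀ e, Q e = wcol p (dev grp p e) :=
    ⟨wcol p ∘L LinearMap.toContinuousLinearMap (dev grp p), fun _ => rfl⟩
  have hwsq (e : Fin N → Vec M) : wsq p e ≤ ‖wcol (E := Vec M) p‖ ^ 2 * ‖e‖ ^ 2 := by
    rw [← norm_wcol_sq hp0, ← mul_pow]
    exact pow_le_pow_left₀ (norm_nonneg _) ((wcol p).le_opNorm e) 2
  have hcontr (μ : ℝ) (e : Fin N → Vec M) : ‖Q (comb A (e + μ • drift J wo τ e))‖ ^ 2 ≤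
      (1 - c) * ‖Q e‖ ^ 2 + |C| * ‖wcol (E := Vec M) p‖ ^ 2 * μ ^ 2 * ‖e‖ ^ 2 := by
    rw [hQ, hQ, norm_wcol_sq hp0, norm_wcol_sq hp0]
    calc _ ≤ (1 - c) * wsq p (dev grp p e) + C * μ ^ 2 * wsq p e := hstep μ e
      _ ≤ (1 - c) * wsq p (dev grp p e) +
          |C| * μ ^ 2 * (‖wcol (E := Vec M) p‖ ^ 2 * ‖e‖ ^ 2) := by
        gcongr
        · exact wsq_nonneg hp0 e
        · exact le_abs_self C
        · exact hwsq e
      _ = _ := by ring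
  obtain ⟨K, hK⟩ := exists_norm_le_mul_norm_wcol (E := Vec M) hp.pos
  have hQ2 (x : ℝ × ℕ) : MemLp (fun ω => Q (wo - estimate A τ ghat x.1 x.2 ω)) 2 P :=
    Q.comp_memLp' (memLp_two_of_four (he.memLp_state x.1 x.2))
  exact (isBigO_integral_norm_sq_of_norm_le hQ2 fun x ω => by
    simpa only [hQ] using hK (dev grp p (wo - estimate A τ ghat x.1 x.2 ω))).trans
    (he.isBigO_integral_norm_sq_of_contraction hc0 hc1 hcontr
      (isBigO_integral_norm_wo_sub_estimate_pow_four hgrp hA hJ hτ hS hp))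

end MomentBounds

end ErrorRecursion

/-! ### Limit of the noise covariance -/

section RpowMoments

variable {Ω E : Type*} {mΩ : MeasurableSpace Ω} {P : Measure Ω} [IsProbabilityMeasure P]
  [NormedAddCommGroup E] {γ : ℝ}

theorem integrable_norm_rpow_of_le_four (hγ : 0 < γ) (hγ4 : γ ≤ 4) {f : Ω → E}
    (hf : MemLp f 4 P) : Integrable (fun ω => ‖f ω‖ ^ γ) P := by
  have hexp : ENNReal.ofReal γ ≤ 4 := by
    simpa using ENNReal.ofReal_le_ofReal hγ4
  simpa [ENNReal.toReal_ofReal hγ.le] using (hf.mono_exponent hexp).integrable_norm_rpow'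

theorem integral_norm_rpow_le (hγ : 0 < γ) (hγ4 : γ ≤ 4) {f : Ω → E} (hf : MemLp f 4 P) :
    ∫ ω, ‖f ω‖ ^ γ ∂P ≤ (∫ ω, ‖f ω‖ ^ 4 ∂P) ^ (γ / 4) := by
  have hrpow (ω : Ω) : (‖f ω‖ ^ 4) ^ (γ / 4) = ‖f ω‖ ^ γ := by
    rw [← Real.rpow_natCast_mul (norm_nonneg _)]
    congr 1
    push_cast
    ring
  have hjensen := (Real.concaveOn_rpow (p := γ / 4) (by positivity) (by linarith)).le_map_integral
    (Real.continuous_rpow_const (by positivity)).continuousOn isClosed_Ici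
    (ae_of_all P fun ω => Set.mem_Ici.mpr (by positivity : 0 ≤ ‖f ω‖ ^ 4))
    (integrable_norm_pow_four hf)
    ((integrable_norm_rpow_of_le_four hγ hγ4 hf).congr (ae_of_all _ fun ω => (hrpow ω).symm))
  simpa only [hrpow] using hjensen

theorem tendsto_integral_norm_rpow_zero {X : Type*} {l : Filter X} (hγ : 0 < γ) (hγ4 : γ ≤ 4)
    {U : X → Ω → E} (hU : ∀ x, MemLp (U x) 4 P)
    (h : Tendsto (fun x => ∫ ω, ‖U x ω‖ ^ 4 ∂P) l (𝓝 0)) :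
    Tendsto (fun x => ∫ ω, ‖U x ω‖ ^ γ ∂P) l (𝓝 0) := by
  have hlim := h.rpow_const (p := γ / 4) (Or.inr (by positivity))
  rw [Real.zero_rpow (by positivity)] at hlim
  exact squeeze_zero (fun x => integral_nonneg fun ω => by positivity)
    (fun x => integral_norm_rpow_le hγ hγ4 (hU x)) hlim

end RpowMoments

section NoiseCovariance

variable {N M : ℕ} {Ω : Type*} {mΩ : MeasurableSpace Ω} {P : Measure Ω} {ℱ : Filtration ℕ mΩ}
  {J : Fin N → Vec M → ℝ} {wo : Fin N → Vec M} {α σs κs γs : ℝ}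
  {Rs : Matrix (Fin N × Fin M) (Fin N × Fin M) ℝ} {ghat : ℕ → Fin N → Vec M → Ω → Vec M}
  [IsProbabilityMeasure P] (hS : NoiseCondition P ℱ J wo ghat α σs κs γs Rs)

include hS

theorem NoiseCondition.abs_condCov_wo_le (n : ℕ) (i j : Fin N × Fin M) :
    ∀ᵐ ω ∂P, |condCov P (ℱ n) (fun ω' => netNoise J ghat n wo ω') ω i j| ≤ 1 + σs ^ 4 := by
  set s : Ω → EuclideanSpace ℝ (Fin N × Fin M) := fun ω => netNoise J ghat n wo ω
  have hs : MemLp s 4 P := hS.memLp n (fun _ => wo) stronglyMeasurable_const (memLp_const _)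
  have hs4 := integrable_norm_pow_four hs
  have hprod (ω : Ω) : ‖s ω i * s ω j‖ ≤ 1 + ‖s ω‖ ^ 4 := by
    have hle : ‖s ω i * s ω j‖ ≤ ‖s ω‖ * ‖s ω‖ := by
      rw [norm_mul]
      gcongr <;> exact PiLp.norm_apply_le (s ω) _
    nlinarith [sq_nonneg (‖s ω‖ ^ 2 - 1), sq_nonneg ‖s ω‖]
  have hint : Integrable (fun ω => s ω i * s ω j) P :=
    Integrable.mono' ((integrable_const 1).add hs4)
      (((hs.eval_piLp i).1).mul ((hs.eval_piLp j).1)) (ae_of_all _ hprod)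
  have hmono := condExp_mono (m := ℱ n) hint.norm ((integrable_const (1 : ℝ)).add hs4)
    (ae_of_all _ hprod)
  filter_upwards [norm_condExp_le (m := ℱ n) (fun ω => s ω i * s ω j), hmono,
    condExp_add (integrable_const (1 : ℝ)) hs4 (ℱ n),
    hS.fourth_moment n (fun _ => wo) stronglyMeasurable_const (memLp_const _)]
    with ω hnorm hmono hadd hfour
  have hsum : (P[fun ω' => 1 + ‖s ω'‖ ^ 4 | ℱ n]) ω = 1 + (P[fun ω' => ‖s ω'‖ ^ 4 | ℱ n]) ω := by
    refine hadd.trans ?_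
    rw [Pi.add_apply, condExp_const (ℱ.le n)]
  have hfour' : (P[fun ω' => ‖s ω'‖ ^ 4 | ℱ n]) ω ≤ σs ^ 4 := by simpa using hfour
  calc |condCov P (ℱ n) s ω i j|
      ≤ (P[fun ω' => ‖s ω' i * s ω' j‖ | ℱ n]) ω := hnorm
    _ ≤ (P[fun ω' => 1 + ‖s ω'‖ ^ 4 | ℱ n]) ω := hmono
    _ ≤ 1 + σs ^ 4 := by linarith

theorem NoiseCondition.tendsto_integral_mul_wo (i j : Fin N × Fin M) :
    Tendsto (fun n => ∫ ω, netNoise J ghat n wo ω i * netNoise J ghat n wo ω j ∂P) atTop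
      (𝓝 (Rs i j)) := by
  have hlim := tendsto_integral_of_dominated_convergence (μ := P)
    (F := fun n ω => condCov P (ℱ n) (fun ω' => netNoise J ghat n wo ω') ω i j)
    (f := fun _ => Rs i j) (fun _ => 1 + σs ^ 4)
    (fun n => integrable_condExp.aestronglyMeasurable) (integrable_const _)
    (fun n => hS.abs_condCov_wo_le n i j) (by
      filter_upwards [hS.convergent_cov] with ω hω
      exact tendsto_pi_nhds.mp (tendsto_pi_nhds.mp hω i) j)
  have hint (n : ℕ) : ∫ ω, condCov P (ℱ n) (fun ω' => netNoise J ghat n wo ω') ω i j ∂P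
      = ∫ ω, netNoise J ghat n wo ω i * netNoise J ghat n wo ω j ∂P :=
    integral_condExp (ℱ.le n)
  simpa [hint] using hlim

theorem NoiseCondition.abs_integral_mul_sub_le {n : ℕ} {W : Ω → Fin N → Vec M}
    (hW : StronglyMeasurable[ℱ n] W) (hL : MemLp (fun ω => col (W ω)) 4 P)
    (i j : Fin N × Fin M) :
    |(∫ ω, netNoise J ghat n (W ω) ω i * netNoise J ghat n (W ω) ω j ∂P) -
        ∫ ω, netNoise J ghat n wo ω i * netNoise J ghat n wo ω j ∂P| ≤
      κs * ∫ ω, ‖col wo - col (W ω)‖ ^ γs ∂P := by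
  have hcov (V : Ω → Fin N → Vec M) :
      ∫ ω, netNoise J ghat n (V ω) ω i * netNoise J ghat n (V ω) ω j ∂P =
        ∫ ω, condCov P (ℱ n) (fun ω' => netNoise J ghat n (V ω') ω') ω i j ∂P :=
    (integral_condExp (ℱ.le n)).symm
  have hint (V : Ω → Fin N → Vec M) :
      Integrable (fun ω => condCov P (ℱ n) (fun ω' => netNoise J ghat n (V ω') ω') ω i j) P :=
    integrable_condExp
  rw [hcov W, hcov fun _ => wo, ← integral_sub (hint W) (hint fun _ => wo),
    ← integral_const_mul, ← Real.norm_eq_abs]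
  refine norm_integral_le_of_norm_le
    ((integrable_norm_rpow_of_le_four hS.γs_pos hS.γs_le
      ((memLp_const (col wo)).sub hL)).const_mul κs) ?_
  filter_upwards [hS.lipschitz_cov n W hW hL] with ω hω
  rw [norm_sub_rev] at hω
  exact (abs_apply_le_norm _ i j).trans hω

end NoiseCovariance

section NoiseCovarianceLimit

variable {N G M : ℕ} {Ω : Type*} {mΩ : MeasurableSpace Ω} {P : Measure Ω} {ℱ : Filtration ℕ mΩ}
  [IsProbabilityMeasure P]
  {T : SimpleGraph (Fin N)} {grp : Fin N → Fin G} {A : Matrix (Fin N) (Fin N) ℝ}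
  {J : Fin N → Vec M → ℝ} {wo : Fin N → Vec M} {lamL lamU : Fin N → ℝ} {κH : ℝ}
  {α σs κs γs : ℝ} {Rs : Matrix (Fin N × Fin M) (Fin N × Fin M) ℝ} {τ p : Fin N → ℝ}
  {ghat : ℕ → Fin N → Vec M → Ω → Vec M}
  (hgrp : IsGrouping T grp wo) (hA : IsCombination T grp A)
  (hJ : CostCondition grp J wo lamL lamU κH) (hτ : IsStepProfile τ)
  (hS : NoiseCondition P ℱ J wo ghat α σs κs γs Rs)

include hgrp hA hJ hτ hS

theorem memLp_netError (μ : ℝ) (n : ℕ) : MemLp (netError A τ ghat wo μ n) 4 P :=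
  (colEquiv N M).toContinuousLinearMap.comp_memLp'
    (stronglyMeasurable_and_memLp_wo_sub_estimate hgrp hA hJ hτ hS μ n).2

theorem isBigO_integral_norm_netError_pow_four (hp : IsPerron grp A p) :
    (fun x : ℝ × ℕ => ∫ ω, ‖netError A τ ghat wo x.1 x.2 ω‖ ^ 4 ∂P)
      =O[(𝓝[>] (0 : ℝ)).curry atTop] fun x => x.1 ^ 2 := by
  refine .trans (.of_bound (‖(colEquiv N M).toContinuousLinearMap‖ ^ 4) (.of_forall fun x => ?_))
    (isBigO_integral_norm_wo_sub_estimate_pow_four hgrp hA hJ hτ hS hp)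
  have he := (stronglyMeasurable_and_memLp_wo_sub_estimate hgrp hA hJ hτ hS x.1 x.2).2
  rw [Real.norm_of_nonneg (integral_nonneg fun _ => by positivity),
    Real.norm_of_nonneg (integral_nonneg fun _ => by positivity), ← integral_const_mul]
  refine integral_mono (integrable_norm_pow_four (memLp_netError hgrp hA hJ hτ hS x.1 x.2))
    ((integrable_norm_pow_four he).const_mul _) fun ω => ?_
  have hnorm : ‖netError A τ ghat wo x.1 x.2 ω‖ ≤ _ :=
    (colEquiv N M).toContinuousLinearMap.le_opNorm (wo - estimate A τ ghat x.1 x.2 ω)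
  exact (pow_le_pow_left₀ (norm_nonneg _) hnorm 4).trans_eq (mul_pow _ _ 4)

theorem tendsto_secondMoment_netNoise (hp : IsPerron grp A p) :
    Tendsto (fun x : ℝ × ℕ =>
        secondMoment P fun ω => netNoise J ghat x.2 (estimate A τ ghat x.1 x.2 ω) ω)
      ((𝓝[>] (0 : ℝ)).curry atTop) (𝓝 Rs) := by
  have hx : Tendsto (fun x : ℝ × ℕ => x.1 ^ 2) ((𝓝[>] (0 : ℝ)).curry atTop) (𝓝 0) := by
    simpa using tendsto_fst_curry_nhdsGT_zero.pow 2
  have hgap := (tendsto_integral_norm_rpow_zero hS.γs_pos hS.γs_le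
    (fun x : ℝ × ℕ => memLp_netError hgrp hA hJ hτ hS x.1 x.2)
    ((isBigO_integral_norm_netError_pow_four hgrp hA hJ hτ hS hp).trans_tendsto hx)).const_mul κs
  rw [mul_zero] at hgap
  have hest (x : ℝ × ℕ) := stronglyMeasurable_and_memLp_wo_sub_estimate hgrp hA hJ hτ hS x.1 x.2
  have hm (x : ℝ × ℕ) := stronglyMeasurable_of_sub (hest x).1
  have hcol (x : ℝ × ℕ) := memLp_col_of_sub (hest x).2
  refine tendsto_pi_nhds.mpr fun i => tendsto_pi_nhds.mpr fun j => ?_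
  simp only [secondMoment_apply (memLp_two_of_four (hS.memLp _ _ (hm _) (hcol _)))]
  have hwo := (hS.tendsto_integral_mul_wo i j).comp
    (tendsto_snd.mono_left (curry_le_prod (l := 𝓝[>] (0 : ℝ)) (m := atTop)))
  have hdiff := squeeze_zero_norm (f := fun x : ℝ × ℕ =>
      (∫ ω, netNoise J ghat x.2 (estimate A τ ghat x.1 x.2 ω) ω i *
        netNoise J ghat x.2 (estimate A τ ghat x.1 x.2 ω) ω j ∂P) -
        ∫ ω, netNoise J ghat x.2 wo ω i * netNoise J ghat x.2 wo ω j ∂P)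
    (fun x => hS.abs_integral_mul_sub_le (hm x) (hcol x) i j) hgap
  simpa using hdiff.add hwo

end NoiseCovarianceLimit

/-! ### The averaged recursion -/

section AveragedModel

variable {N G M : ℕ} {T : SimpleGraph (Fin N)} {grp : Fin N → Fin G}
  {A : Matrix (Fin N) (Fin N) ℝ} {J : Fin N → Vec M → ℝ} {wo : Fin N → Vec M}
  {lamL lamU : Fin N → ℝ} {κH : ℝ} {τ p : Fin N → ℝ}

theorem inner_col (x y : Fin N → Vec M) :
    inner ℝ (col x) (col y) = ∑ k, inner ℝ (x k) (y k) := by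
  simp only [PiLp.inner_apply, Fintype.sum_prod_type, col]

/-- The stacked group averages of the agents' vectors. -/
noncomputable def colAvg (M : ℕ) (grp : Fin N → Fin G) (p : Fin N → ℝ) :
    (Fin N → Vec M) →L[ℝ] EuclideanSpace ℝ (Fin G × Fin M) :=
  (colEquiv G M).toContinuousLinearMap ∘L LinearMap.toContinuousLinearMap (avg grp p)

theorem colAvg_apply (grp : Fin N → Fin G) (p : Fin N → ℝ) (e : Fin N → Vec M) :
    colAvg M grp p e = col (avg grp p e) := rfl

/-- The linearization of `-drift` at zero error. -/
noncomputable def linDrift (J : Fin N → Vec M → ℝ) (wo : Fin N → Vec M) (τ : Fin N → ℝ) :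
    (Fin N → Vec M) →L[ℝ] (Fin N → Vec M) :=
  ContinuousLinearMap.pi fun k =>
    τ k • Matrix.toEuclideanCLM (𝕜 := ℝ) (hessian (J k) (wo k)) ∘L ContinuousLinearMap.proj k

theorem linDrift_apply (J : Fin N → Vec M → ℝ) (wo : Fin N → Vec M) (τ : Fin N → ℝ)
    (e : Fin N → Vec M) (k : Fin N) :
    linDrift J wo τ e k = τ k • Matrix.toEuclideanCLM (𝕜 := ℝ) (hessian (J k) (wo k)) (e k) := rfl

theorem toEuclideanCLM_Hbar_col (J : Fin N → Vec M → ℝ) (wo : Fin N → Vec M) (τ p : Fin N → ℝ)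
    (x : Fin G → Vec M) :
    Matrix.toEuclideanCLM (𝕜 := ℝ) (Hbar grp J wo τ p) (col x) =
      colAvg M grp p (linDrift J wo τ (spread grp x)) := by
  have hblock (m : Fin G) : avg grp p (linDrift J wo τ (spread grp x)) m =
      Matrix.toEuclideanCLM (𝕜 := ℝ)
        (∑ k with grp k = m, (p k * τ k) • hessian (J k) (wo k)) (x m) := by
    rw [avg_apply, map_sum, _root_.sum_apply]
    refine Finset.sum_congr rfl fun k hk => ?_
    rw [linDrift_apply, spread_apply, (Finset.mem_filter.mp hk).2, map_smul, _root_.smul_apply,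
      smul_smul]
  rw [colAvg_apply, funext hblock]
  ext ⟨m, a⟩
  simp only [toEuclideanCLM_apply, Matrix.mulVec, dotProduct, Hbar, Matrix.of_apply,
    Fintype.sum_prod_type, col, ite_mul, zero_mul, Finset.sum_ite_irrel, Finset.sum_const_zero,
    Finset.sum_ite_eq, Finset.mem_univ, if_true]

theorem CostCondition.isHermitian_Hbar (hJ : CostCondition grp J wo lamL lamU κH)
    (τ p : Fin N → ℝ) : (Hbar grp J wo τ p).IsHermitian := by
  refine Matrix.IsHermitian.ext fun ⟨m, a⟩ ⟨r, b⟩ => ?_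
  by_cases h : m = r
  · subst h
    simp only [Hbar, Matrix.of_apply, if_true, star_trivial, Matrix.sum_apply, Matrix.smul_apply]
    refine Finset.sum_congr rfl fun k _ => ?_
    rw [← (hJ.hessian_posSemidef k (wo k)).isHermitian.apply a b, star_trivial]
  · simp [Hbar, h, Ne.symm h]

theorem CostCondition.inner_Hbar_col_ge (hJ : CostCondition grp J wo lamL lamU κH)
    (hτ : IsStepProfile τ) (hp : ∀ k, 0 < p k) (x : Fin G → Vec M) :
    ∑ m, (∑ k with grp k = m, p k * τ k * lamL k) * ‖x m‖ ^ 2 ≤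
      inner ℝ (col x) (Matrix.toEuclideanCLM (𝕜 := ℝ) (Hbar grp J wo τ p) (col x)) := by
  have hk (k : Fin N) : lamL k * ‖x (grp k)‖ ^ 2 ≤ inner ℝ (x (grp k))
      (Matrix.toEuclideanCLM (𝕜 := ℝ) (hessian (J k) (wo k)) (x (grp k))) := by
    have h := inner_toEuclideanCLM_nonneg (hJ.hessian_lower k (wo k)) (x (grp k))
    simpa [inner_sub_right, real_inner_smul_right] using h
  calc ∑ m, (∑ k with grp k = m, p k * τ k * lamL k) * ‖x m‖ ^ 2
      = ∑ k, p k * (τ k * (lamL k * ‖x (grp k)‖ ^ 2)) := by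
        rw [← Finset.sum_fiberwise Finset.univ grp]
        refine Finset.sum_congr rfl fun m _ => ?_
        rw [Finset.sum_mul]
        refine Finset.sum_congr rfl fun k hk => ?_
        rw [(Finset.mem_filter.mp hk).2]
        ring
    _ ≤ ∑ k, p k * inner ℝ (spread grp x k) (linDrift J wo τ (spread grp x) k) := by
        refine Finset.sum_le_sum fun k _ => mul_le_mul_of_nonneg_left ?_ (hp k).le
        rw [linDrift_apply, real_inner_smul_right]
        exact mul_le_mul_of_nonneg_left (hk k) (hτ.pos k).le
    _ = inner ℝ (col x) (Matrix.toEuclideanCLM (𝕜 := ℝ) (Hbar grp J wo τ p) (col x)) := by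
        rw [toEuclideanCLM_Hbar_col, colAvg_apply, inner_col, sum_mul_inner_spread]

theorem CostCondition.exists_posSemidef_Hbar_sub_smul_one
    (hJ : CostCondition grp J wo lamL lamU κH) (hτ : IsStepProfile τ) (hp : ∀ k, 0 < p k) :
    ∃ lam : ℝ, 0 < lam ∧ (Hbar grp J wo τ p - lam • 1).PosSemidef := by
  obtain ⟨lam, hlam, hle⟩ := hJ.exists_le_sum_lamL hτ hp
  refine ⟨lam, hlam, posSemidef_of_inner_nonneg
    ((hJ.isHermitian_Hbar τ p).sub (Matrix.isHermitian_one.smul (IsSelfAdjoint.all lam)))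
    fun z => ?_⟩
  obtain ⟨x, rfl⟩ := (colEquiv G M).surjective z
  have hx := hJ.inner_Hbar_col_ge hτ hp x
  have hnorm : lam * ‖col x‖ ^ 2 ≤ ∑ m, (∑ k with grp k = m, p k * τ k * lamL k) * ‖x m‖ ^ 2 := by
    rw [norm_col_sq, Finset.mul_sum]
    exact Finset.sum_le_sum fun m _ => mul_le_mul_of_nonneg_right (hle m) (sq_nonneg _)
  rw [colEquiv_apply, map_sub, map_smul, map_one, _root_.sub_apply, _root_.smul_apply,
    one_apply_eq_self, inner_sub_right, real_inner_smul_right,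
    real_inner_self_eq_norm_sq]
  exact sub_nonneg.mpr (hnorm.trans hx)

theorem CostCondition.posDef_Hbar (hJ : CostCondition grp J wo lamL lamU κH)
    (hτ : IsStepProfile τ) (hp : ∀ k, 0 < p k) : (Hbar grp J wo τ p).PosDef := by
  obtain ⟨lam, hlam, hH⟩ := hJ.exists_posSemidef_Hbar_sub_smul_one hτ hp
  simpa using (Matrix.PosDef.one.smul hlam).posSemidef_add hH

/-- The matrix `𝒫ᵀ 𝒯` that maps the network noise to its weighted group averages. -/
noncomputable def avgNoise (M : ℕ) (grp : Fin N → Fin G) (τ p : Fin N → ℝ) :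
    Matrix (Fin G × Fin M) (Fin N × Fin M) ℝ :=
  (bigP M grp p)ᵀ * bigT M τ

theorem Rbar_eq (grp : Fin N → Fin G) (τ p : Fin N → ℝ)
    (Rs : Matrix (Fin N × Fin M) (Fin N × Fin M) ℝ) :
    Rbar grp τ p Rs = avgNoise M grp τ p * Rs * (avgNoise M grp τ p)ᵀ := by
  have hT : (bigT M τ)ᵀ = bigT M τ := by
    rw [bigT, ← Matrix.kroneckerMap_transpose, Matrix.diagonal_transpose, Matrix.transpose_one]
  rw [Rbar, avgNoise, Matrix.transpose_mul, Matrix.transpose_transpose, hT]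
  simp only [Matrix.mul_assoc]

theorem avgNoise_eq (grp : Fin N → Fin G) (τ p : Fin N → ℝ) :
    avgNoise M grp τ p = (.of fun m k => if grp k = m then p k * τ k else 0) ⊗ₖ 1 := by
  rw [avgNoise, bigP, bigT, ← Matrix.kroneckerMap_transpose, ← Matrix.mul_kronecker_mul,
    Matrix.transpose_one, Matrix.mul_one]
  congr 1
  ext m k
  simp [Matrix.mul_diagonal]

theorem toLp_avgNoise_mulVec_col (grp : Fin N → Fin G) (τ p : Fin N → ℝ) (u : Fin N → Vec M) :
    WithLp.toLp 2 (avgNoise M grp τ p *ᵥ col u) = colAvg M grp p fun k => τ k • u k := by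
  ext ⟨m, a⟩
  simp [avgNoise_eq, colAvg_apply, col, avg_apply, Matrix.mulVec, dotProduct,
    Fintype.sum_prod_type, Matrix.one_apply, Finset.sum_filter, smul_smul, apply_ite WithLp.ofLp,
    ite_apply]

theorem IsPerron.colAvg_noiseMap (hA : IsCombination T grp A) (hp : IsPerron grp A p)
    (z : EuclideanSpace ℝ (Fin N × Fin M)) :
    colAvg M grp p (noiseMap A τ z) = WithLp.toLp 2 (avgNoise M grp τ p *ᵥ z) := by
  obtain ⟨u, rfl⟩ := (colEquiv N M).surjective z
  rw [colEquiv_apply, noiseMap_col, toLp_avgNoise_mulVec_col, colAvg_apply, hp.avg_comb hA,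
    colAvg_apply]

end AveragedModel

/-! ### The limit covariance -/

section DriftError

variable {N G M : ℕ} {T : SimpleGraph (Fin N)} {grp : Fin N → Fin G}
  {A : Matrix (Fin N) (Fin N) ℝ} {J : Fin N → Vec M → ℝ} {wo : Fin N → Vec M}
  {lamL lamU : Fin N → ℝ} {κH : ℝ} {τ p : Fin N → ℝ}

/-- The error made in the group averages when the drift is linearized at the minimizers and the
agents' errors are replaced by their group averages. -/
noncomputable def driftError (grp : Fin N → Fin G) (J : Fin N → Vec M → ℝ) (wo : Fin N → Vec M)
    (τ p : Fin N → ℝ) (e : Fin N → Vec M) : EuclideanSpace ℝ (Fin G × Fin M) :=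
  colAvg M grp p (drift J wo τ e)
    + Matrix.toEuclideanCLM (𝕜 := ℝ) (Hbar grp J wo τ p) (colAvg M grp p e)

theorem driftError_eq (grp : Fin N → Fin G) (J : Fin N → Vec M → ℝ) (wo : Fin N → Vec M)
    (τ p : Fin N → ℝ) (e : Fin N → Vec M) :
    driftError grp J wo τ p e = colAvg M grp p (drift J wo τ e + linDrift J wo τ e)
      - colAvg M grp p (linDrift J wo τ (dev grp p e)) := by
  rw [driftError, colAvg_apply grp p e, toEuclideanCLM_Hbar_col, dev_eq_sub, map_sub, map_sub,
    map_add]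
  abel

theorem CostCondition.norm_drift_add_linDrift_le (hJ : CostCondition grp J wo lamL lamU κH)
    (hτ : IsStepProfile τ) (e : Fin N → Vec M) :
    ‖drift J wo τ e + linDrift J wo τ e‖ ≤ κH * ‖e‖ ^ 2 := by
  have hκ := hJ.κH_nonneg
  refine (pi_norm_le_iff_of_nonneg (by positivity)).mpr fun k => ?_
  rw [Pi.add_apply, linDrift_apply, drift, ← smul_add, norm_smul,
    Real.norm_of_nonneg (hτ.pos k).le]
  calc τ k * ‖gradient (J k) (wo k - e k)
          + Matrix.toEuclideanCLM (𝕜 := ℝ) (hessian (J k) (wo k)) (e k)‖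
      ≤ 1 * (κH * ‖e k‖ ^ 2) := by
        gcongr
        · exact hτ.le_one k
        · exact hJ.norm_gradient_add_hessian_le k (e k)
    _ ≤ κH * ‖e‖ ^ 2 := by
        rw [one_mul]
        gcongr
        exact norm_le_pi_norm e k

theorem CostCondition.exists_norm_driftError_sq_le (hJ : CostCondition grp J wo lamL lamU κH)
    (hτ : IsStepProfile τ) (p : Fin N → ℝ) :
    ∃ C : ℝ, ∀ e, ‖driftError grp J wo τ p e‖ ^ 2 ≤ C * (‖e‖ ^ 4 + ‖dev grp p e‖ ^ 2) := by
  set a : ℝ := ‖colAvg M grp p‖ * κH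
  set b : ℝ := ‖colAvg M grp p ∘L linDrift J wo τ‖
  refine ⟨2 * (a ^ 2 + b ^ 2), fun e => ?_⟩
  have hquad : ‖colAvg M grp p (drift J wo τ e + linDrift J wo τ e)‖ ≤ a * ‖e‖ ^ 2 := by
    rw [mul_assoc]
    exact (colAvg M grp p).le_opNorm_of_le (hJ.norm_drift_add_linDrift_le hτ e)
  have hdev : ‖colAvg M grp p (linDrift J wo τ (dev grp p e))‖ ≤ b * ‖dev grp p e‖ :=
    (colAvg M grp p ∘L linDrift J wo τ).le_opNorm _
  calc ‖driftError grp J wo τ p e‖ ^ 2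
      ≤ (a * ‖e‖ ^ 2 + b * ‖dev grp p e‖) ^ 2 := by
        rw [driftError_eq]
        gcongr
        exact norm_sub_le_of_le hquad hdev
    _ ≤ 2 * ((a * ‖e‖ ^ 2) ^ 2 + (b * ‖dev grp p e‖) ^ 2) := add_sq_le
    _ ≤ 2 * (a ^ 2 + b ^ 2) * (‖e‖ ^ 4 + ‖dev grp p e‖ ^ 2) := by
        have h₁ : 0 ≤ b ^ 2 * ‖e‖ ^ 4 := by positivity
        have h₂ : 0 ≤ a ^ 2 * ‖dev grp p e‖ ^ 2 := by positivity
        nlinarith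

theorem CostCondition.continuous_driftError (hJ : CostCondition grp J wo lamL lamU κH)
    (τ p : Fin N → ℝ) : Continuous (driftError grp J wo τ p) :=
  ((colAvg M grp p).continuous.comp (hJ.continuous_drift τ)).add
    ((Matrix.toEuclideanCLM (𝕜 := ℝ) (Hbar grp J wo τ p)).continuous.comp
      (colAvg M grp p).continuous)

theorem CostCondition.memLp_driftError {Ω : Type*} {mΩ : MeasurableSpace Ω} {P : Measure Ω}
    (hJ : CostCondition grp J wo lamL lamU κH) (hτ : IsStepProfile τ) (p : Fin N → ℝ)
    {e : Ω → Fin N → Vec M} {q : ℝ≥0∞} (he : MemLp e q P) :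
    MemLp (fun ω => driftError grp J wo τ p (e ω)) q P := by
  have hdrift : MemLp (fun ω => colAvg M grp p (drift J wo τ (e ω))) q P :=
    (colAvg M grp p).comp_memLp' (hJ.memLp_drift hτ he)
  have havg : MemLp (fun ω => colAvg M grp p (e ω)) q P := (colAvg M grp p).comp_memLp' he
  exact hdrift.add ((Matrix.toEuclideanCLM (𝕜 := ℝ) (Hbar grp J wo τ p)).comp_memLp' havg)

theorem IsPerron.colAvg_step (hA : IsCombination T grp A) (hp : IsPerron grp A p) (μ : ℝ)
    (e : Fin N → Vec M) (z : EuclideanSpace ℝ (Fin N × Fin M)) :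
    colAvg M grp p (comb A (e + μ • drift J wo τ e) + μ • noiseMap A τ z) =
      Matrix.toEuclideanCLM (𝕜 := ℝ) (1 - μ • Hbar grp J wo τ p) (colAvg M grp p e)
        + μ • driftError grp J wo τ p e + μ • WithLp.toLp 2 (avgNoise M grp τ p *ᵥ z) := by
  rw [map_add, map_smul, hp.colAvg_noiseMap hA, colAvg_apply, hp.avg_comb hA, ← colAvg_apply,
    map_add, map_smul, driftError, map_sub, map_one, map_smul, _root_.sub_apply,
    one_apply_eq_self, _root_.smul_apply]
  module

end DriftError

section Limit

variable {N G M : ℕ} {Ω : Type*} {mΩ : MeasurableSpace Ω} {P : Measure Ω} {ℱ : Filtration ℕ mΩ}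
  [IsProbabilityMeasure P]
  {T : SimpleGraph (Fin N)} {grp : Fin N → Fin G} {A : Matrix (Fin N) (Fin N) ℝ}
  {J : Fin N → Vec M → ℝ} {wo : Fin N → Vec M} {lamL lamU : Fin N → ℝ} {κH : ℝ}
  {α σs κs γs : ℝ} {Rs : Matrix (Fin N × Fin M) (Fin N × Fin M) ℝ} {τ p : Fin N → ℝ}
  {ghat : ℕ → Fin N → Vec M → Ω → Vec M}
  (hgrp : IsGrouping T grp wo) (hA : IsCombination T grp A)
  (hJ : CostCondition grp J wo lamL lamU κH) (hτ : IsStepProfile τ)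
  (hS : NoiseCondition P ℱ J wo ghat α σs κs γs Rs) (hp : IsPerron grp A p)

include hgrp hA hJ hτ hS hp

theorem isPerturbedLinearRecursion_colAvg :
    IsPerturbedLinearRecursion P ℱ (Hbar grp J wo τ p)
      (fun μ n ω => colAvg M grp p (wo - estimate A τ ghat μ n ω))
      (fun μ n ω => driftError grp J wo τ p (wo - estimate A τ ghat μ n ω))
      (fun μ n ω => WithLp.toLp 2
        (avgNoise M grp τ p *ᵥ netNoise J ghat n (estimate A τ ghat μ n ω) ω)) := by
  have he := isNoisyIteration_wo_sub_estimate hgrp hA hJ hτ hS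
  have he2 (μ : ℝ) (n : ℕ) := memLp_two_of_four (he.memLp_state μ n)
  have hs2 (μ : ℝ) (n : ℕ) := memLp_two_of_four (he.memLp_noise μ n)
  obtain ⟨Q, hQ⟩ : ∃ Q : EuclideanSpace ℝ (Fin N × Fin M) →L[ℝ] EuclideanSpace ℝ (Fin G × Fin M),
      ∀ z, Q z = WithLp.toLp 2 (avgNoise M grp τ p *ᵥ z) :=
    ⟨LinearMap.toContinuousLinearMap (Matrix.toEuclideanLin (avgNoise M grp τ p)), fun _ => rfl⟩
  simp only [← hQ]
  refine ⟨fun μ n => (colAvg M grp p).continuous.comp_stronglyMeasurable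
      (he.stronglyMeasurable μ n),
    fun μ n => (hJ.continuous_driftError τ p).comp_stronglyMeasurable (he.stronglyMeasurable μ n),
    fun μ n => (colAvg M grp p).comp_memLp' (he2 μ n),
    fun μ n => hJ.memLp_driftError hτ p (he2 μ n),
    fun μ n => Q.comp_memLp' (hs2 μ n),
    fun μ n => condExp_clm_comp_eq_zero Q ((hs2 μ n).integrable one_le_two) (he.condExp_noise μ n),
    fun μ n ω => ?_⟩
  rw [he.step, hp.colAvg_step hA, hQ]

theorem isBigO_integral_norm_driftError_sq :
    (fun x : ℝ × ℕ =>
        ∫ ω, ‖driftError grp J wo τ p (wo - estimate A τ ghat x.1 x.2 ω)‖ ^ 2 ∂P)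
      =O[(𝓝[>] (0 : ℝ)).curry atTop] fun x => x.1 ^ 2 := by
  obtain ⟨C, hC⟩ := hJ.exists_norm_driftError_sq_le hτ p
  have he4 (x : ℝ × ℕ) :=
    (stronglyMeasurable_and_memLp_wo_sub_estimate hgrp hA hJ hτ hS x.1 x.2).2
  have hd2 (x : ℝ × ℕ) :
      MemLp (fun ω => dev grp p (wo - estimate A τ ghat x.1 x.2 ω)) 2 P :=
    (LinearMap.toContinuousLinearMap (dev (E := Vec M) grp p)).comp_memLp'
      (memLp_two_of_four (he4 x))
  refine .trans (.of_bound C (.of_forall fun x => ?_))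
    ((isBigO_integral_norm_wo_sub_estimate_pow_four hgrp hA hJ hτ hS hp).add
      (isBigO_integral_norm_dev_sq hgrp hA hJ hτ hS hp))
  rw [← integral_add (integrable_norm_pow_four (he4 x)) (integrable_norm_sq (hd2 x)),
    Real.norm_of_nonneg (integral_nonneg fun _ => by positivity),
    Real.norm_of_nonneg (integral_nonneg fun _ => by positivity), ← integral_const_mul]
  exact integral_mono
    (integrable_norm_sq (hJ.memLp_driftError hτ p (memLp_two_of_four (he4 x))))
    (((integrable_norm_pow_four (he4 x)).add (integrable_norm_sq (hd2 x))).const_mul C)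
    fun ω => hC _

theorem isBigO_integral_norm_colAvg_sq :
    (fun x : ℝ × ℕ => ∫ ω, ‖colAvg M grp p (wo - estimate A τ ghat x.1 x.2 ω)‖ ^ 2 ∂P)
      =O[(𝓝[>] (0 : ℝ)).curry atTop] fun x => x.1 := by
  have he4 (x : ℝ × ℕ) :=
    (stronglyMeasurable_and_memLp_wo_sub_estimate hgrp hA hJ hτ hS x.1 x.2).2
  exact (isBigO_integral_norm_sq_of_norm_le (fun x => memLp_two_of_four (he4 x))
    fun x ω => (colAvg M grp p).le_opNorm _).trans
    (isBigO_integral_norm_sq_of_pow_four he4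
      (isBigO_integral_norm_wo_sub_estimate_pow_four hgrp hA hJ hτ hS hp))

theorem tendsto_inv_smul_secondMoment_colAvg {Φ : Matrix (Fin G × Fin M) (Fin G × Fin M) ℝ}
    (hΦ : IsLyapunovSolution grp J wo τ p Rs Φ) :
    Tendsto (fun x : ℝ × ℕ => x.1⁻¹ •
        secondMoment P fun ω => colAvg M grp p (wo - estimate A τ ghat x.1 x.2 ω))
      ((𝓝[>] (0 : ℝ)).curry atTop) (𝓝 Φ) := by
  obtain ⟨lam, hlam, hH⟩ := hJ.exists_posSemidef_Hbar_sub_smul_one hτ hp.pos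
  have hs2 (x : ℝ × ℕ) := memLp_two_of_four
    ((isNoisyIteration_wo_sub_estimate hgrp hA hJ hτ hS).memLp_noise x.1 x.2)
  refine (isPerturbedLinearRecursion_colAvg hgrp hA hJ hτ hS hp).tendsto_inv_smul_secondMoment
    (hJ.isHermitian_Hbar τ p) hlam hH hΦ
    (isBigO_integral_norm_colAvg_sq hgrp hA hJ hτ hS hp)
    (isBigO_integral_norm_driftError_sq hgrp hA hJ hτ hS hp) ?_
  simp only [secondMoment_mulVec (hs2 _)]
  rw [Rbar_eq]
  have hnoise := tendsto_secondMoment_netNoise hgrp hA hJ hτ hS hp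
  exact (((continuous_const.matrix_mul continuous_id).matrix_mul continuous_const).tendsto Rs).comp
    hnoise

end Limit

section BlockStructure

variable {N G M : ℕ}

/-- The matrix that hands every agent the vector of its group. -/
def spreadMatrix (M : ℕ) (grp : Fin N → Fin G) : Matrix (Fin N × Fin M) (Fin G × Fin M) ℝ :=
  Matrix.of fun x y => if (grp x.1, x.2) = y then 1 else 0

theorem toLp_spreadMatrix_mulVec_col (grp : Fin N → Fin G) (x : Fin G → Vec M) :
    WithLp.toLp 2 (spreadMatrix M grp *ᵥ col x) = col (spread grp x) := by
  ext ⟨k, a⟩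
  simp [spreadMatrix, Matrix.mulVec, dotProduct, col, spread_apply]

theorem hasBlockStructure_spreadMatrix_mul_mul (grp : Fin N → Fin G)
    (Φ : Matrix (Fin G × Fin M) (Fin G × Fin M) ℝ) :
    HasBlockStructure grp Φ (spreadMatrix M grp * Φ * (spreadMatrix M grp)ᵀ) := by
  intro m r
  ext ⟨⟨k, hk⟩, a⟩ ⟨⟨l, hl⟩, b⟩
  simp [groupBlock, block, spreadMatrix, Matrix.mul_apply, hk, hl]

end BlockStructure

section NetworkLimit

variable {N G M : ℕ} {Ω : Type*} {mΩ : MeasurableSpace Ω} {P : Measure Ω} {ℱ : Filtration ℕ mΩ}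
  {T : SimpleGraph (Fin N)} {grp : Fin N → Fin G} {A : Matrix (Fin N) (Fin N) ℝ}
  {J : Fin N → Vec M → ℝ} {wo : Fin N → Vec M} {lamL lamU : Fin N → ℝ} {κH : ℝ}
  {α σs κs γs : ℝ} {Rs : Matrix (Fin N × Fin M) (Fin N × Fin M) ℝ} {τ p : Fin N → ℝ}
  {ghat : ℕ → Fin N → Vec M → Ω → Vec M}

theorem netError_eq_spread_add_dev (grp : Fin N → Fin G) (p : Fin N → ℝ) (μ : ℝ) (n : ℕ) (ω : Ω) :
    netError A τ ghat wo μ n ω =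
      WithLp.toLp 2 (spreadMatrix M grp *ᵥ colAvg M grp p (wo - estimate A τ ghat μ n ω))
        + col (dev grp p (wo - estimate A τ ghat μ n ω)) := by
  rw [colAvg_apply, toLp_spreadMatrix_mulVec_col, ← colEquiv_apply, ← colEquiv_apply, ← map_add,
    spread_avg_add_dev]
  rfl

variable [IsProbabilityMeasure P] (hgrp : IsGrouping T grp wo) (hA : IsCombination T grp A)
  (hJ : CostCondition grp J wo lamL lamU κH) (hτ : IsStepProfile τ)
  (hS : NoiseCondition P ℱ J wo ghat α σs κs γs Rs) (hp : IsPerron grp A p)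

include hgrp hA hJ hτ hS hp

theorem isBigO_secondMoment_netError_sub :
    (fun x : ℝ × ℕ => secondMoment P (netError A τ ghat wo x.1 x.2) -
        spreadMatrix M grp *
          secondMoment P (fun ω => colAvg M grp p (wo - estimate A τ ghat x.1 x.2 ω)) *
          (spreadMatrix M grp)ᵀ)
      =O[(𝓝[>] (0 : ℝ)).curry atTop] fun x => √x.1 * x.1 := by
  have he2 (x : ℝ × ℕ) := memLp_two_of_four
    (stronglyMeasurable_and_memLp_wo_sub_estimate hgrp hA hJ hτ hS x.1 x.2).2
  have hZ2 (x : ℝ × ℕ) :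
      MemLp (fun ω => colAvg M grp p (wo - estimate A τ ghat x.1 x.2 ω)) 2 P :=
    (colAvg M grp p).comp_memLp' (he2 x)
  obtain ⟨Q, hQ⟩ : ∃ Q : EuclideanSpace ℝ (Fin G × Fin M) →L[ℝ] EuclideanSpace ℝ (Fin N × Fin M),
      ∀ z, Q z = WithLp.toLp 2 (spreadMatrix M grp *ᵥ z) :=
    ⟨LinearMap.toContinuousLinearMap (Matrix.toEuclideanLin (spreadMatrix M grp)), fun _ => rfl⟩
  have hd2 (x : ℝ × ℕ) : MemLp (fun ω => dev grp p (wo - estimate A τ ghat x.1 x.2 ω)) 2 P :=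
    (LinearMap.toContinuousLinearMap (dev (E := Vec M) grp p)).comp_memLp' (he2 x)
  have hspread := (isBigO_integral_norm_sq_of_norm_le hZ2 fun x ω => Q.le_opNorm _).trans
    (isBigO_integral_norm_colAvg_sq hgrp hA hJ hτ hS hp)
  have hdev := (isBigO_integral_norm_sq_of_norm_le hd2
    fun x ω => (colEquiv N M).toContinuousLinearMap.le_opNorm _).trans
    (isBigO_integral_norm_dev_sq hgrp hA hJ hτ hS hp)
  have hsmall : ∀ᶠ x : ℝ × ℕ in (𝓝[>] (0 : ℝ)).curry atTop, 0 < x.1 ∧ x.1 ≤ 1 :=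
    (tendsto_fst_curry _ _).eventually (Ioc_mem_nhdsGT one_pos)
  have hsqrt : (fun x : ℝ × ℕ => x.1 ^ 2) =ᶠ[(𝓝[>] (0 : ℝ)).curry atTop]
      fun x => √x.1 ^ 2 * x.1 := by
    filter_upwards [hsmall] with x hx
    rw [Real.sq_sqrt hx.1.le, sq]
  have hsum := isBigO_secondMoment_add_sub (fun x => Q.comp_memLp' (hZ2 x))
    (fun x => (colEquiv N M).toContinuousLinearMap.comp_memLp' (hd2 x))
    (hsmall.mono fun x hx => ⟨Real.sqrt_pos.2 hx.1, Real.sqrt_le_one.2 hx.2⟩)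
    hspread (hdev.trans_eventuallyEq hsqrt)
  refine hsum.congr_left fun x => ?_
  rw [← secondMoment_mulVec (hZ2 x)]
  congr 2
  · funext ω
    rw [netError_eq_spread_add_dev grp p, ← hQ]
    rfl
  · funext ω
    exact hQ _

theorem tendsto_normalizedCov_netError {Φ : Matrix (Fin G × Fin M) (Fin G × Fin M) ℝ}
    (hΦ : IsLyapunovSolution grp J wo τ p Rs Φ) :
    Tendsto (fun x : ℝ × ℕ => normalizedCov P x.1 (netError A τ ghat wo x.1 x.2))
      ((𝓝[>] (0 : ℝ)).curry atTop) (𝓝 (spreadMatrix M grp * Φ * (spreadMatrix M grp)ᵀ)) := by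
  have hspread : Continuous fun X : Matrix (Fin G × Fin M) (Fin G × Fin M) ℝ =>
      spreadMatrix M grp * X * (spreadMatrix M grp)ᵀ :=
    (continuous_const.matrix_mul continuous_id).matrix_mul continuous_const
  have hlift :=
    (hspread.tendsto Φ).comp (tendsto_inv_smul_secondMoment_colAvg hgrp hA hJ hτ hS hp hΦ)
  have hsqrt : Tendsto (fun x : ℝ × ℕ => √x.1) ((𝓝[>] (0 : ℝ)).curry atTop) (𝓝 0) := by
    simpa only [Real.sqrt_zero] using tendsto_fst_curry_nhdsGT_zero.sqrt
  have hremainder := (((Asymptotics.isBigO_refl (fun x : ℝ × ℕ => x.1⁻¹) _).smul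
    (isBigO_secondMoment_netError_sub hgrp hA hJ hτ hS hp)).trans_eventuallyEq
      (g₂ := fun x => √x.1) ?_).trans_tendsto hsqrt
  · refine (zero_add (spreadMatrix M grp * Φ * (spreadMatrix M grp)ᵀ) ▸
      hremainder.add hlift).congr fun x => ?_
    rw [normalizedCov_eq (memLp_two_of_four (memLp_netError hgrp hA hJ hτ hS x.1 x.2)),
      Function.comp_apply, Matrix.mul_smul, Matrix.smul_mul, ← smul_add, sub_add_cancel]
  · filter_upwards [(tendsto_fst_curry _ atTop).eventually self_mem_nhdsWithin] with x hx
    rw [smul_eq_mul, mul_left_comm, inv_mul_cancel₀ (ne_of_gt hx), mul_one]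

end NetworkLimit

end DiffusionNet

theorem mainTheorem3 {N G M : ℕ} {Ω : Type*} {mΩ : MeasurableSpace Ω}
    (P : Measure Ω) [IsProbabilityMeasure P] (ℱ : Filtration ℕ mΩ)
    (T : SimpleGraph (Fin N)) (grp : Fin N → Fin G) (A : Matrix (Fin N) (Fin N) ℝ)
    (J : Fin N → Vec M → ℝ) (wo : Fin N → Vec M) (lamL lamU : Fin N → ℝ) (κH : ℝ)
    (ghat : ℕ → Fin N → Vec M → Ω → Vec M) (α σs κs γs : ℝ)
    (Rs : Matrix (Fin N × Fin M) (Fin N × Fin M) ℝ) (τ : Fin N → ℝ)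
    (hgrp : IsGrouping T grp wo) (hA : IsCombination T grp A)
    (hJ : CostCondition grp J wo lamL lamU κH)
    (hS : NoiseCondition P ℱ J wo ghat α σs κs γs Rs)
    (hτ : IsStepProfile τ) :
    (∀ (μ : ℝ) (i : ℕ), MemLp (netError A τ ghat wo μ i) 2 P) ∧
    (∃! p, IsPerron grp A p) ∧
    ∀ p, IsPerron grp A p →
      (∃! Φ, IsLyapunovSolution grp J wo τ p Rs Φ) ∧
      ∀ Φ, IsLyapunovSolution grp J wo τ p Rs Φ →
        ∃ Pi : Matrix (Fin N × Fin M) (Fin N × Fin M) ℝ, HasBlockStructure grp Φ Pi ∧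
          Tendsto (fun μ : ℝ =>
              limsup (fun i : ℕ => ‖normalizedCov P μ (netError A τ ghat wo μ i) - Pi‖ₑ) atTop)
            (𝓝[>] 0) (𝓝 0) := by
  have hmem (μ : ℝ) (i : ℕ) := memLp_two_of_four (memLp_netError hgrp hA hJ hτ hS μ i)
  refine ⟨hmem, hA.existsUnique_perron hgrp, fun p hp => ⟨?_, fun Φ hΦ => ?_⟩⟩
  · exact existsUnique_lyapunov (hJ.posDef_Hbar hτ hp.pos) _
  · exact ⟨_, hasBlockStructure_spreadMatrix_mul_mul grp Φ, tendsto_limsup_enorm_sub_of_curry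
      (tendsto_normalizedCov_netError hgrp hA hJ hτ hS hp hΦ)⟩
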